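/- **Definitions.** Let $\Omega\subset\mathbb R$ be a set of angles and $k\in\mathbb N$. Let $\mathcal B_{\Omega,k}$ be the collection of all closed convex polygons $B\subset[0,1]^2$ with nonempty interior, with at most $k$ sides, all of whose outer side normals are among the vectors $\pm(\cos\theta,\sin\theta)$, $\theta\in\Omega$. For a finite set $\mathcal P\subset[0,1]^2$ with $\#\mathcal P=N$ and $B\in\mathcal B_{\Omega,k}$ put $D(\mathcal P,B)=\bigl|\#(\mathcal P\cap B)-N|B|\bigr|$, where $|B|$ is the area of $B$. A probability measure on $\mathcal B_{\Omega,k}$ is one defined on any $\sigma$-algebra that contains the sets $\{B: p\in B\}$ for all points $p$. Write $\log N$ for $\max\{1,\log_2 N\}$. A sequence $(x_n)$ of reals is *lacunary, converging to $\omega$, with ratio $A\in(0,1)$*, if $|x_{n+1}-\omega|<A|x_n-\omega|$ for all $n$. A set is *lacunary of order $1$* if it is covered by one lacunary sequence. A set is *lacunary of order $M+1$* if there are a set $\Omega'$ that is lacunary of order $M$, a number $A\in(0,1)$, and for each $\omega\in\Omega'$ a lacunary sequence with ratio $A$ converging to $\omega$, such that each point $y$ of the set either lies in $\Omega'$ or,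 for some $\omega\in\Omega'$, is a term of the sequence converging to $\omega$ and no point of $\Omega'$ lies strictly between $\omega$ and $y$. The *upper Minkowski dimension* of a set of reals is the infimum of the $s\ge 0$ such that, for all sufficiently small $\delta>0$, the set can be covered by $O(\delta^{-s})$ intervals of length $\delta$. **Theorem 4.** Let $\Omega\subset\mathbb R$ and $k\in\mathbb N$. 1) Let $\Omega$ be a finite union of lacunary sets of order at most $M$, where $M\ge1$. Then there is a constant $C$, depending only on $\Omega$, $k$ and $M$, such that for every $N\ge1$ and every probability measure $\sigma$ on $\mathcal B_{\Omega,k}$ there exists $\mathcal P\subset[0,1]^2$ with $\#\mathcal P=N$, for which $B\mapsto D(\mathcal P,B)^2$ is $\sigma$-integrable and $$\left(\int_{\mathcal B_{\Omega,k}}|D(\mathcal P,B)|^2\,d\sigma(B)\right)^{1/2}\le C\,\log^{2M+\frac12}N .$$ 2) Let $\Omega$ have upper Minkowski dimension $d$, $0\le d<1$, and assume that $\tau=\frac{2}{(1-d)^2}-2$ satisfies $\tau<1$. Then there are constants $C_\varepsilon$, $\varepsilon>0$, depending only on $\Omega$, $k$ and $\varepsilon$, such that for every $N\ge1$ and every probability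 measure $\sigma$ on $\mathcal B_{\Omega,k}$ there exists $\mathcal P\subset[0,1]^2$ with $\#\mathcal P=N$, for which $B\mapsto D(\mathcal P,B)^2$ is $\sigma$-integrable and, for all $\varepsilon>0$, $$\left(\int_{\mathcal B_{\Omega,k}}|D(\mathcal P,B)|^2\,d\sigma(B)\right)^{1/2}\le C_\varepsilon\,N^{\frac{\tau}{2(\tau+1)}+\varepsilon} .$$ -/

import Mathlib

open MeasureTheory

noncomputable section

/-- The unit square `[0,1]²`. -/
def unitSquare : Set (ℝ × ℝ) := Set.Icc (0 : ℝ) 1 ×ˢ Set.Icc (0 : ℝ) 1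

/-- The unit vectors `± (cos θ, sin θ)`, where the angle `θ` ranges over `Ω`. -/
def normals (Ω : Set ℝ) : Set (ℝ × ℝ) :=
  {v | ∃ θ ∈ Ω, v = (Real.cos θ, Real.sin θ) ∨ v = (-Real.cos θ, -Real.sin θ)}

/-- The (closed, nondegenerate) convex polygons in the unit square with at most `k` sides, all of
whose outer side normals are in `± Ω`: the sets with nonempty interior that are intersections of at
most `k` closed half-planes with such normals. -/
def convexPolygons (Ω : Set ℝ) (k : ℕ) : Set (Set (ℝ × ℝ)) :=
  {B | B ⊆ unitSquare ∧ (interior B).Nonempty ∧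
    ∃ m ≤ k, ∃ (u : Fin m → ℝ × ℝ) (c : Fin m → ℝ), (∀ i, u i ∈ normals Ω) ∧
      B = {p | ∀ i, (u i).1 * p.1 + (u i).2 * p.2 ≤ c i}}

/-- The discrepancy `|#(P ∩ B) - #P · |B||` of the finite point set `P` with respect to `B`. -/
def discrepancy (P : Finset (ℝ × ℝ)) (B : Set (ℝ × ℝ)) : ℝ :=
  |(((P : Set (ℝ × ℝ)) ∩ B).ncard : ℝ) - (P.card : ℝ) * (volume B).toReal|

/-- `x` is a lacunary sequence converging to `ω`, with ratio `A`. The strict inequality forces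
`x n ≠ ω` for all `n`. -/
def IsLacunarySeq (A ω : ℝ) (x : ℕ → ℝ) : Prop :=
  0 < A ∧ A < 1 ∧ ∀ n, |x (n + 1) - ω| < A * |x n - ω|

/-- Lacunary sets of finite order `≥ 1`. A set is lacunary of order one if it is covered by a
lacunary sequence; it is lacunary of order `M + 1` if it is covered by a lacunary set `Ω'` of order
`M` and lacunary sequences `x ω` converging to the points `ω` of `Ω'`. As usual the ratio `A` is
common to these sequences, and from the sequence converging to `ω` only terms are used that lie in
a gap of `Ω'` next to `ω`, i.e. that are not separated from `ω` by a point of `Ω'`. -/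
inductive IsLacunaryOfOrder : ℕ → Set ℝ → Prop
  | one {Ω : Set ℝ} (A ω : ℝ) (x : ℕ → ℝ) (hx : IsLacunarySeq A ω x)
      (hcover : Ω ⊆ Set.range x) : IsLacunaryOfOrder 1 Ω
  | succ {M : ℕ} {Ω Ω' : Set ℝ} (A : ℝ) (x : ℝ → ℕ → ℝ) (hΩ' : IsLacunaryOfOrder M Ω')
      (hx : ∀ ω ∈ Ω', IsLacunarySeq A ω (x ω))
      (hcover : ∀ y ∈ Ω, y ∈ Ω' ∨
        ∃ ω ∈ Ω', y ∈ Set.range (x ω) ∧ Disjoint Ω' (Set.Ioo (min ω y) (max ω y))) :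
      IsLacunaryOfOrder (M + 1) Ω

/-- `Ω` is a finite union of lacunary sets of order at most `M`. -/
def IsFiniteUnionLacunary (M : ℕ) (Ω : Set ℝ) : Prop :=
  ∃ (n : ℕ) (E : Fin n → Set ℝ),
    (∀ i, ∃ m ≤ M, IsLacunaryOfOrder m (E i)) ∧ Ω = ⋃ i, E i

/-- For all small `δ > 0`, the set `Ω` is covered by `O(δ ^ (-s))` intervals of length `δ`. -/
def HasCoveringExponent (Ω : Set ℝ) (s : ℝ) : Prop :=
  ∃ C δ₀ : ℝ, 0 < δ₀ ∧ ∀ δ : ℝ, 0 < δ → δ < δ₀ →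
    ∃ F : Finset ℝ, (F.card : ℝ) ≤ C * δ ^ (-s) ∧ Ω ⊆ ⋃ a ∈ F, Set.Icc a (a + δ)

/-- `Ω` has upper Minkowski dimension `d`: the infimum of the covering exponents exists and is
`d`. (Negative exponents occur for the empty set only, whose dimension is taken to be `0`.) -/
def HasUpperMinkowskiDim (Ω : Set ℝ) (d : ℝ) : Prop :=
  IsGLB {s : ℝ | 0 ≤ s ∧ HasCoveringExponent Ω s} d

/-- `max {1, log₂ N}`. -/
def logPlus (N : ℕ) : ℝ := max 1 (Real.logb 2 N)

end

/-- The finite set `F` of left end points of intervals of length `δ` covers `Ω`. -/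
def Covers (F : Finset ℝ) (δ : ℝ) (Ω : Set ℝ) : Prop :=
  ∀ y ∈ Ω, ∃ a ∈ F, a ≤ y ∧ y ≤ a + δ

theorem IsLacunarySeq.abs_sub_le {A ω : ℝ} {x : ℕ → ℝ} (hx : IsLacunarySeq A ω x) (n j : ℕ) :
    |x (n + j) - ω| ≤ A ^ j * |x n - ω| := by
  induction j with
  | zero => simp
  | succ j ih =>
    have h1 := (hx.2.2 (n + j)).le
    have h2 := mul_le_mul_of_nonneg_left ih hx.1.le
    calc |x (n + (j + 1)) - ω| ≤ A * |x (n + j) - ω| := h1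
      _ ≤ A * (A ^ j * |x n - ω|) := h2
      _ = A ^ (j + 1) * |x n - ω| := by ring

theorem IsLacunarySeq.abs_sub_le_zero {A ω : ℝ} {x : ℕ → ℝ} (hx : IsLacunarySeq A ω x) (n : ℕ) :
    |x n - ω| ≤ |x 0 - ω| := by
  have h := hx.abs_sub_le 0 n
  rw [zero_add] at h
  refine h.trans ?_
  have : A ^ n ≤ 1 := pow_le_one₀ hx.1.le hx.2.1.le
  nlinarith [abs_nonneg (x 0 - ω)]

theorem IsLacunarySeq.exists_finset_terms {A ω : ℝ} {x : ℕ → ℝ} (hx : IsLacunarySeq A ω x)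
    {q : ℕ} (hq : A ^ q ≤ 1 / 2) (i r : ℕ) :
    ∃ F : Finset ℝ, F.card ≤ q * (i + r) + 1 ∧
      ∀ n, (1 / 2 : ℝ) ^ i < |x n - ω| → |x n - ω| ≤ 2 ^ r → x n ∈ F := by
  classical
  by_cases hne : ∃ n, (1 / 2 : ℝ) ^ i < |x n - ω| ∧ |x n - ω| ≤ 2 ^ r
  swap
  · exact ⟨∅, by simp, fun n h1 h2 => absurd ⟨n, h1, h2⟩ hne⟩
  let n₁ := Nat.find hne
  have hn₁ := Nat.find_spec hne
  refine ⟨(Finset.range (q * (i + r) + 1)).image fun j => x (n₁ + j),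
    Finset.card_image_le.trans (by simp), fun n h1 h2 => ?_⟩
  have hle : n₁ ≤ n := Nat.find_min' hne ⟨h1, h2⟩
  obtain ⟨j, rfl⟩ := Nat.exists_eq_add_of_le hle
  refine Finset.mem_image.2 ⟨j, Finset.mem_range.2 ?_, rfl⟩
  by_contra hj
  have hj' : q * (i + r) ≤ j := by omega
  have h3 := hx.abs_sub_le n₁ j
  have h4 : A ^ j ≤ (1 / 2) ^ (i + r) := calc
    A ^ j ≤ A ^ (q * (i + r)) := pow_le_pow_of_le_one hx.1.le hx.2.1.le hj'
    _ = (A ^ q) ^ (i + r) := pow_mul _ _ _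
    _ ≤ (1 / 2) ^ (i + r) := pow_le_pow_left₀ (pow_nonneg hx.1.le _) hq _
  have h5 : A ^ j * |x n₁ - ω| ≤ (1 / 2) ^ (i + r) * 2 ^ r :=
    mul_le_mul h4 hn₁.2 (abs_nonneg _) (by positivity)
  have h6 : (1 / 2 : ℝ) ^ (i + r) * 2 ^ r = (1 / 2) ^ i := by
    rw [pow_add, mul_assoc, ← mul_pow]; norm_num
  linarith

theorem exists_pow_le_half {A : ℝ} (h1 : A < 1) : ∃ q : ℕ, A ^ q ≤ 1 / 2 := by
  obtain ⟨q, hq⟩ := exists_pow_lt_of_lt_one (by norm_num : (0 : ℝ) < 1 / 2) h1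
  exact ⟨q, hq.le⟩

theorem IsLacunaryOfOrder.exists_abs_le {M : ℕ} {Ω : Set ℝ} (h : IsLacunaryOfOrder M Ω) :
    ∃ R : ℝ, ∀ y ∈ Ω, |y| ≤ R := by
  induction h with
  | @one Ω A ω x hx hcover =>
    refine ⟨|ω| + |x 0 - ω|, fun y hy => ?_⟩
    obtain ⟨n, rfl⟩ := hcover hy
    have := abs_add_le ω (x n - ω)
    rw [add_sub_cancel] at this
    linarith [hx.abs_sub_le_zero n]
  | @succ M Ω Ω' A x hΩ' hx hcover ih =>
    obtain ⟨R, hR⟩ := ih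
    have key : ∀ ω ∈ Ω', ∀ n, |x ω n| ≤ R + |x ω 0 - ω| := fun ω hω n => by
      have := abs_add_le ω (x ω n - ω)
      rw [add_sub_cancel] at this
      linarith [(hx ω hω).abs_sub_le_zero n, hR ω hω]
    have h1 : ∃ R₁ : ℝ, ∀ ω, IsGreatest Ω' ω → |x ω 0 - ω| ≤ R₁ := by
      by_cases h : ∃ ω, IsGreatest Ω' ω
      · obtain ⟨ω, hω⟩ := h
        exact ⟨|x ω 0 - ω|, fun ω' hω' => by rw [hω'.unique hω]⟩
      · exact ⟨0, fun ω hω => absurd ⟨ω, hω⟩ h⟩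
    have h2 : ∃ R₂ : ℝ, ∀ ω, IsLeast Ω' ω → |x ω 0 - ω| ≤ R₂ := by
      by_cases h : ∃ ω, IsLeast Ω' ω
      · obtain ⟨ω, hω⟩ := h
        exact ⟨|x ω 0 - ω|, fun ω' hω' => by rw [hω'.unique hω]⟩
      · exact ⟨0, fun ω hω => absurd ⟨ω, hω⟩ h⟩
    obtain ⟨R₁, hR₁⟩ := h1
    obtain ⟨R₂, hR₂⟩ := h2
    refine ⟨max R (max (R + R₁) (R + R₂)), fun y hy => ?_⟩
    rcases hcover y hy with hy | ⟨ω, hω, ⟨n, rfl⟩, hdisj⟩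
    · exact le_max_of_le_left (hR y hy)
    by_cases hyR : |x ω n| ≤ R
    · exact le_max_of_le_left hyR
    refine le_max_of_le_right ?_
    have hk := key ω hω n
    rw [not_le, lt_abs] at hyR
    have hb : ∀ w ∈ Ω', -R ≤ w ∧ w ≤ R := fun w hw => abs_le.1 (hR w hw)
    rcases hyR with hlt | hlt
    · refine le_max_of_le_left (hk.trans ?_)
      have : IsGreatest Ω' ω := ⟨hω, fun w hw => by
        by_contra hwω
        exact Set.disjoint_left.1 hdisj hw ⟨min_lt_of_left_lt (not_le.1 hwω),
          lt_max_of_lt_right ((hb w hw).2.trans_lt hlt)⟩⟩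
      linarith [hR₁ ω this]
    · refine le_max_of_le_right (hk.trans ?_)
      have : IsLeast Ω' ω := ⟨hω, fun w hw => by
        by_contra hwω
        exact Set.disjoint_left.1 hdisj hw ⟨min_lt_of_right_lt (by linarith [(hb w hw).1]),
          lt_max_of_lt_left (not_le.1 hwω)⟩⟩
      linarith [hR₂ ω this]

/-- At the scale `2⁻ⁱ` the set `Ω` is covered by `O((i + 1) ^ M)` intervals. -/
def HasLogCovering (M : ℕ) (Ω : Set ℝ) : Prop :=
  ∃ C : ℕ, ∀ i : ℕ, ∃ F : Finset ℝ, F.card ≤ C * (i + 1) ^ M ∧ Covers F ((1 / 2) ^ i) Ω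

theorem exists_le_two_pow (D : ℝ) : ∃ r : ℕ, D ≤ 2 ^ r := by
  obtain ⟨r, hr⟩ := pow_unbounded_of_one_lt D (by norm_num : (1 : ℝ) < 2)
  exact ⟨r, hr.le⟩

theorem hasLogCovering_one {A ω : ℝ} {x : ℕ → ℝ} (hx : IsLacunarySeq A ω x) :
    HasLogCovering 1 (Set.range x) := by
  classical
  obtain ⟨q, hq⟩ := exists_pow_le_half hx.2.1
  obtain ⟨r, hr⟩ := exists_le_two_pow |x 0 - ω|
  refine ⟨q * (r + 1) + 3, fun i => ?_⟩
  obtain ⟨F, hF, hcov⟩ := hx.exists_finset_terms hq i r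
  refine ⟨insert (ω - (1 / 2) ^ i) (insert ω F), ?_, ?_⟩
  · have h1 := Finset.card_insert_le (ω - (1 / 2) ^ i) (insert ω F)
    have h2 := Finset.card_insert_le ω F
    have : q * (i + r) + 3 ≤ (q * (r + 1) + 3) * (i + 1) ^ 1 := by nlinarith [Nat.zero_le (q * r * i)]
    omega
  · rintro _ ⟨n, rfl⟩
    by_cases h : |x n - ω| ≤ (1 / 2) ^ i
    · rw [abs_le] at h
      rcases le_total (x n) ω with h' | h'
      · exact ⟨_, Finset.mem_insert_self _ _, by linarith, by linarith⟩
      · exact ⟨ω, by simp, by linarith, by linarith⟩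
    · exact ⟨x n, by simp [hcov n (not_le.1 h) ((hx.abs_sub_le_zero n).trans hr)], le_rfl,
        by simp⟩

theorem HasLogCovering.mono_order {M M' : ℕ} (h : M ≤ M') {Ω : Set ℝ} (hΩ : HasLogCovering M Ω) :
    HasLogCovering M' Ω := by
  obtain ⟨C, hC⟩ := hΩ
  refine ⟨C, fun i => ?_⟩
  obtain ⟨F, hF, hc⟩ := hC i
  exact ⟨F, hF.trans (Nat.mul_le_mul_left _ (Nat.pow_le_pow_right (by omega) h)), hc⟩

theorem HasLogCovering.mono {M : ℕ} {Ω Ω' : Set ℝ} (h : Ω ⊆ Ω') (hΩ : HasLogCovering M Ω') :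
    HasLogCovering M Ω := by
  obtain ⟨C, hC⟩ := hΩ
  refine ⟨C, fun i => ?_⟩
  obtain ⟨F, hF, hc⟩ := hC i
  exact ⟨F, hF, fun y hy => hc y (h hy)⟩

theorem HasLogCovering.union {M : ℕ} {Ω Ω' : Set ℝ} (h : HasLogCovering M Ω)
    (h' : HasLogCovering M Ω') : HasLogCovering M (Ω ∪ Ω') := by
  classical
  obtain ⟨C, hC⟩ := h
  obtain ⟨C', hC'⟩ := h'
  refine ⟨C + C', fun i => ?_⟩
  obtain ⟨F, hF, hc⟩ := hC i
  obtain ⟨F', hF', hc'⟩ := hC' i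
  refine ⟨F ∪ F', ?_, ?_⟩
  · rw [add_mul]
    exact (Finset.card_union_le _ _).trans (add_le_add hF hF')
  · rintro y (hy | hy)
    · obtain ⟨a, ha, h⟩ := hc y hy
      exact ⟨a, Finset.mem_union_left _ ha, h⟩
    · obtain ⟨a, ha, h⟩ := hc' y hy
      exact ⟨a, Finset.mem_union_right _ ha, h⟩

theorem Set.Finite.hasLogCovering {Ω : Set ℝ} (h : Ω.Finite) (M : ℕ) : HasLogCovering M Ω := by
  refine ⟨h.toFinset.card, fun i => ⟨h.toFinset, ?_, fun y hy => ⟨y, by simpa using hy, le_rfl, by simp⟩⟩⟩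
  exact Nat.le_mul_of_pos_right _ (by positivity)

theorem exists_finset_covers_gap {Ω' : Set ℝ} {A : ℝ} {x : ℝ → ℕ → ℝ}
    (hx : ∀ ω ∈ Ω', IsLacunarySeq A ω (x ω)) {q : ℕ} (hq : A ^ q ≤ 1 / 2) (i r : ℕ) (a : ℝ) :
    ∃ F : Finset ℝ, F.card ≤ 2 * (q * (i + r) + 1) + 3 ∧
      ∀ ω ∈ Ω', a ≤ ω → ω ≤ a + (1 / 2) ^ i → ∀ y ∈ Set.range (x ω), |y - ω| ≤ 2 ^ r →
        Disjoint Ω' (Set.Ioo (min ω y) (max ω y)) → ∃ c ∈ F, c ≤ y ∧ y ≤ c + (1 / 2) ^ i := by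
  classical
  set δ : ℝ := (1 / 2) ^ i with hδ
  set E : Set ℝ := {ω | ω ∈ Ω' ∧ a ≤ ω ∧ ω ≤ a + δ} with hE
  have terms : ∀ P : ℝ → Prop, (∀ ω, P ω → ω ∈ Ω') → (∀ ω ω', P ω → P ω' → ω = ω') →
      ∃ F : Finset ℝ, F.card ≤ q * (i + r) + 1 ∧ ∀ ω, P ω → ∀ y ∈ Set.range (x ω),
        δ < |y - ω| → |y - ω| ≤ 2 ^ r → y ∈ F := by
    intro P hP hu
    by_cases h : ∃ ω, P ω
    · obtain ⟨ω, hω⟩ := h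
      obtain ⟨F, hF, hF'⟩ := (hx ω (hP ω hω)).exists_finset_terms hq i r
      refine ⟨F, hF, ?_⟩
      rintro ω' hω' _ ⟨n, rfl⟩ h1 h2
      obtain rfl := hu _ _ hω hω'
      exact hF' n h1 h2
    · exact ⟨∅, by simp, fun ω hω => absurd ⟨ω, hω⟩ h⟩
  obtain ⟨F₁, hF₁, hc₁⟩ := terms (IsGreatest E) (fun ω h => h.1.1) (fun _ _ h h' => h.unique h')
  obtain ⟨F₂, hF₂, hc₂⟩ := terms (IsLeast E) (fun ω h => h.1.1) (fun _ _ h h' => h.unique h')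
  refine ⟨{a - δ, a, a + δ} ∪ (F₁ ∪ F₂), ?_, ?_⟩
  · have h1 := Finset.card_union_le ({a - δ, a, a + δ} : Finset ℝ) (F₁ ∪ F₂)
    have h2 := Finset.card_union_le F₁ F₂
    have h3 : ({a - δ, a, a + δ} : Finset ℝ).card ≤ 3 := Finset.card_le_three
    omega
  intro ω hω ha1 ha2 y hy hyr hdisj
  have hδ0 : 0 < δ := by positivity
  by_cases hyδ : |y - ω| ≤ δ
  · rw [abs_le] at hyδ
    rcases le_total y a with h1 | h1
    · exact ⟨a - δ, by simp, by linarith, by linarith⟩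
    rcases le_total y (a + δ) with h2 | h2
    · exact ⟨a, by simp, by linarith, by linarith⟩
    · exact ⟨a + δ, by simp, by linarith, by linarith⟩
  rw [not_le] at hyδ
  suffices y ∈ F₁ ∪ F₂ from ⟨y, Finset.mem_union_right _ this, le_rfl, by linarith⟩
  rcases lt_abs.1 hyδ with h | h
  · refine Finset.mem_union_left _ (hc₁ ω ⟨⟨hω, ha1, ha2⟩, fun w hw => ?_⟩ y hy hyδ hyr)
    by_contra hwω
    exact Set.disjoint_left.1 hdisj hw.1 ⟨min_lt_of_left_lt (not_le.1 hwω),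
      lt_max_of_lt_right (by linarith [hw.2.2])⟩
  · refine Finset.mem_union_right _ (hc₂ ω ⟨⟨hω, ha1, ha2⟩, fun w hw => ?_⟩ y hy hyδ hyr)
    by_contra hwω
    exact Set.disjoint_left.1 hdisj hw.1 ⟨min_lt_of_right_lt (by linarith [hw.2.1]),
      lt_max_of_lt_left (not_le.1 hwω)⟩

theorem IsLacunaryOfOrder.hasLogCovering {M : ℕ} {Ω : Set ℝ} (h : IsLacunaryOfOrder M Ω) :
    HasLogCovering M Ω := by
  classical
  induction h with
  | @one Ω A ω x hx hcover => exact (hasLogCovering_one hx).mono hcover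
  | @succ M Ω Ω' A x hΩ' hx hcover ih =>
    obtain ⟨R, hR⟩ := (IsLacunaryOfOrder.succ A x hΩ' hx hcover).exists_abs_le
    obtain ⟨R', hR'⟩ := hΩ'.exists_abs_le
    obtain ⟨r, hr⟩ := exists_le_two_pow (R + R')
    obtain ⟨C, hC⟩ := ih
    by_cases hA : 0 < A ∧ A < 1
    swap
    · refine (Set.finite_empty.hasLogCovering _).mono fun y hy => ?_
      rcases hcover y hy with h | ⟨ω, h, -⟩
      · exact absurd ⟨(hx y h).1, (hx y h).2.1⟩ hA
      · exact absurd ⟨(hx ω h).1, (hx ω h).2.1⟩ hA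
    obtain ⟨q, hq⟩ := exists_pow_le_half hA.2
    refine ⟨C * (2 * (q * (r + 1) + 1) + 4), fun i => ?_⟩
    obtain ⟨F, hF, hc⟩ := hC i
    choose G hG hG' using exists_finset_covers_gap hx hq i r
    refine ⟨F ∪ F.biUnion G, ?_, ?_⟩
    · calc (F ∪ F.biUnion G).card ≤ F.card + (F.biUnion G).card := Finset.card_union_le _ _
        _ ≤ F.card + F.card * (2 * (q * (i + r) + 1) + 3) :=
          Nat.add_le_add_left (Finset.card_biUnion_le_card_mul _ _ _ fun a _ => hG a) _
        _ = F.card * (2 * (q * (i + r) + 1) + 4) := by ring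
        _ ≤ C * (i + 1) ^ M * ((2 * (q * (r + 1) + 1) + 4) * (i + 1)) := by
          refine Nat.mul_le_mul hF ?_
          nlinarith [Nat.zero_le (q * r * i)]
        _ = C * (2 * (q * (r + 1) + 1) + 4) * (i + 1) ^ (M + 1) := by ring
    · intro y hy
      rcases hcover y hy with hy' | ⟨ω, hω, hyω, hdisj⟩
      · obtain ⟨a, ha, h⟩ := hc y hy'
        exact ⟨a, Finset.mem_union_left _ ha, h⟩
      · obtain ⟨a, ha, h⟩ := hc ω hω
        have hyr : |y - ω| ≤ 2 ^ r := by
          have := abs_sub y ω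
          linarith [hR y hy, hR' ω hω]
        obtain ⟨c, hcG, h'⟩ := hG' a ω hω h.1 h.2 y hyω hyr hdisj
        exact ⟨c, Finset.mem_union_right _ (Finset.mem_biUnion.2 ⟨a, ha, hcG⟩), h'⟩

theorem IsFiniteUnionLacunary.hasLogCovering {M : ℕ} {Ω : Set ℝ}
    (h : IsFiniteUnionLacunary M Ω) : HasLogCovering M Ω := by
  obtain ⟨n, E, hE, rfl⟩ := h
  have h' : ∀ i, HasLogCovering M (E i) := fun i => by
    obtain ⟨m, hm, hm'⟩ := hE i
    exact hm'.hasLogCovering.mono_order hm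
  clear hE
  induction n with
  | zero => simpa using Set.finite_empty.hasLogCovering M
  | succ n ih =>
    refine ((ih (fun i => E i.castSucc) fun i => h' _).union (h' (Fin.last n))).mono ?_
    intro y hy
    obtain ⟨i, hi⟩ := Set.mem_iUnion.1 hy
    induction i using Fin.lastCases with
    | last => exact Or.inr hi
    | cast i => exact Or.inl (Set.mem_iUnion.2 ⟨i, hi⟩)

theorem one_le_sq_add_sq {m p : ℤ} (h : (m, p) ≠ 0) : (1 : ℝ) ≤ (m : ℝ) ^ 2 + (p : ℝ) ^ 2 := by
  have : 1 ≤ m ^ 2 + p ^ 2 := by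
    by_contra hc
    have hm : m = 0 := by nlinarith [sq_nonneg m, sq_nonneg p]
    have hp : p = 0 := by nlinarith [sq_nonneg m, sq_nonneg p]
    exact h (by rw [hm, hp]; rfl)
  exact_mod_cast this

theorem abs_sub_le_of_small_forms {m p m' p' : ℤ} {x x' ρ ℓ : ℝ} (hν : (m, p) ≠ 0)
    (hν' : (m', p') ≠ 0) (hρ : 10 * ρ ≤ ℓ) (hρ0 : 0 ≤ ρ) (hℓ0 : 0 < ℓ) (hℓ : ℓ ≤ 1 / 8)
    (hQ : 8 * ((m : ℝ) ^ 2 + (p : ℝ) ^ 2) * ℓ ≤ 1)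
    (hQ' : 8 * ((m' : ℝ) ^ 2 + (p' : ℝ) ^ 2) * ℓ ≤ 1) (hx : |x - x'| ≤ 2 * ℓ)
    (h : (m * Real.cos x + p * Real.sin x) ^ 2 < ρ ^ 2 * ((m : ℝ) ^ 2 + (p : ℝ) ^ 2))
    (h' : (m' * Real.cos x' + p' * Real.sin x') ^ 2 < ρ ^ 2 * ((m' : ℝ) ^ 2 + (p' : ℝ) ^ 2)) :
    |x - x'| ≤ 4 * ρ := by
  set n : ℝ := Real.sqrt ((m : ℝ) ^ 2 + (p : ℝ) ^ 2) with hn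
  set n' : ℝ := Real.sqrt ((m' : ℝ) ^ 2 + (p' : ℝ) ^ 2) with hn'
  have hnsq : n ^ 2 = (m : ℝ) ^ 2 + (p : ℝ) ^ 2 := Real.sq_sqrt (by positivity)
  have hnsq' : n' ^ 2 = (m' : ℝ) ^ 2 + (p' : ℝ) ^ 2 := Real.sq_sqrt (by positivity)
  have hn0 : 0 ≤ n := Real.sqrt_nonneg _
  have hn0' : 0 ≤ n' := Real.sqrt_nonneg _
  have hsc : Real.cos x ^ 2 + Real.sin x ^ 2 = 1 := Real.cos_sq_add_sin_sq x
  have hsc' : Real.cos x' ^ 2 + Real.sin x' ^ 2 = 1 := Real.cos_sq_add_sin_sq x'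
  rw [← hnsq] at h hQ
  rw [← hnsq'] at h' hQ'
  set a := m * Real.cos x + p * Real.sin x with ha
  set b := p * Real.cos x - m * Real.sin x with hb
  set a' := m' * Real.cos x' + p' * Real.sin x' with ha'
  set b' := p' * Real.cos x' - m' * Real.sin x' with hb'
  have hab : a ^ 2 + b ^ 2 = n ^ 2 := by
    rw [hnsq, ha, hb]; linear_combination ((m : ℝ) ^ 2 + (p : ℝ) ^ 2) * hsc
  have hab' : a' ^ 2 + b' ^ 2 = n' ^ 2 := by
    rw [hnsq', ha', hb']; linear_combination ((m' : ℝ) ^ 2 + (p' : ℝ) ^ 2) * hsc'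
  have hA : |a| ≤ ρ * n := abs_le_of_sq_le_sq (by rw [mul_pow]; exact h.le) (by positivity)
  have hA' : |a'| ≤ ρ * n' := abs_le_of_sq_le_sq (by rw [mul_pow]; exact h'.le) (by positivity)
  have hB : |b| ≤ n := abs_le_of_sq_le_sq (by linarith [sq_nonneg a]) hn0
  have hB' : |b'| ≤ n' := abs_le_of_sq_le_sq (by linarith [sq_nonneg a']) hn0'
  set D : ℤ := m * p' - p * m' with hD
  set S : ℤ := m * m' + p * p' with hS
  have hDS : (D : ℝ) ^ 2 + (S : ℝ) ^ 2 = (n * n') ^ 2 := by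
    rw [mul_pow, hnsq, hnsq', hD, hS]; push_cast; ring
  have hid : (D : ℝ) * Real.cos (x - x') + S * Real.sin (x - x') = a * b' - b * a' := by
    rw [Real.cos_sub, Real.sin_sub, hD, hS, ha, hb, ha', hb']; push_cast; ring
  have hbound : |a * b' - b * a'| ≤ 2 * ρ * (n * n') := by
    have h1 : |a * b'| ≤ ρ * n * n' := by
      rw [abs_mul]; exact mul_le_mul hA hB' (abs_nonneg _) (by positivity)
    have h2 : |b * a'| ≤ n * (ρ * n') := by
      rw [abs_mul]; exact mul_le_mul hB hA' (abs_nonneg _) hn0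
    have := abs_sub (a * b') (b * a')
    linarith
  have hnn : 8 * (n * n') * ℓ ≤ 1 := by linarith [mul_nonneg (sq_nonneg (n - n')) hℓ0.le]
  have hnn0 : 0 < n * n' := by
    exact mul_pos (Real.sqrt_pos.2 (one_pos.trans_le (one_le_sq_add_sq hν)))
      (Real.sqrt_pos.2 (one_pos.trans_le (one_le_sq_add_sq hν')))
  have hcos : 7 / 8 ≤ Real.cos (x - x') := by
    have := Real.one_sub_sq_div_two_le_cos (x := x - x')
    have h3 : (x - x') ^ 2 ≤ (2 * (1 / 8)) ^ 2 :=
      sq_le_sq' (by linarith [(abs_le.1 hx).1]) (by linarith [(abs_le.1 hx).2])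
    linarith
  have hsin : |Real.sin (x - x')| ≤ 2 * ℓ := (Real.abs_sin_le_abs).trans hx
  have hSle : |(S : ℝ)| ≤ n * n' := abs_le_of_sq_le_sq (by linarith [sq_nonneg (D : ℝ)]) hnn0.le
  have hD0 : D = 0 := by
    by_contra hne
    have h1 : (1 : ℝ) ≤ |(D : ℝ)| := by exact_mod_cast Int.one_le_abs hne
    have h4 : |(D : ℝ) * Real.cos (x - x')| ≤ 2 * ρ * (n * n') + n * n' * (2 * ℓ) := by
      have : (D : ℝ) * Real.cos (x - x') = (a * b' - b * a') - S * Real.sin (x - x') := by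
        linarith
      rw [this]
      refine (abs_sub _ _).trans (add_le_add hbound ?_)
      rw [abs_mul]
      exact mul_le_mul hSle hsin (abs_nonneg _) hnn0.le
    rw [abs_mul, abs_of_nonneg (by linarith : 0 ≤ Real.cos (x - x'))] at h4
    have h8 : 1 * (7 / 8) ≤ |(D : ℝ)| * Real.cos (x - x') :=
      mul_le_mul h1 hcos (by norm_num) (abs_nonneg _)
    have h9 : 10 * ρ * (n * n') ≤ ℓ * (n * n') := mul_le_mul_of_nonneg_right hρ hnn0.le
    linarith
  rw [hD0] at hDS hid
  have hS2 : |(S : ℝ)| = n * n' := by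
    rw [← abs_of_nonneg hnn0.le]; exact (sq_eq_sq_iff_abs_eq_abs _ _).1 (by simpa using hDS)
  have h5 : |Real.sin (x - x')| ≤ 2 * ρ := by
    have : |(S : ℝ) * Real.sin (x - x')| ≤ 2 * ρ * (n * n') := by
      have h6 : (S : ℝ) * Real.sin (x - x') = a * b' - b * a' := by simpa using hid
      rw [h6]; exact hbound
    rw [abs_mul, hS2, mul_comm] at this
    exact le_of_mul_le_mul_right this hnn0
  have h6 : 2 / Real.pi * |x - x'| ≤ |Real.sin (x - x')| :=
    Real.mul_abs_le_abs_sin (by linarith [Real.pi_gt_three])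
  have h7 : 1 / 2 ≤ 2 / Real.pi := by
    rw [div_le_div_iff₀ (by norm_num) Real.pi_pos]; linarith [Real.pi_lt_four]
  have h8 := mul_le_mul_of_nonneg_right h7 (abs_nonneg (x - x'))
  linarith

/-- Pigeonhole: some subinterval of length `r` of an interval avoids finitely many sets of small
diameter. -/
theorem exists_subinterval_avoiding {ι : Type*} (F : Finset ι) (Bad : ι → Set ℝ) {r a : ℝ}
    (hr : 0 < r) (hBad : ∀ i ∈ F, ∀ x ∈ Bad i, ∀ y ∈ Bad i, |x - y| ≤ 5 * r) :
    ∃ c, a ≤ c ∧ c + r ≤ a + 7 * (F.card + 1) * r ∧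
      ∀ i ∈ F, Disjoint (Bad i) (Set.Icc c (c + r)) := by
  classical
  by_contra! hcon
  have h1 : ∀ t ∈ Finset.range (F.card + 1), ∃ i ∈ F,
      ¬ Disjoint (Bad i) (Set.Icc (a + 7 * t * r) (a + 7 * t * r + r)) := by
    intro t ht
    have ht' : (t : ℝ) ≤ F.card := by exact_mod_cast Nat.lt_succ_iff.1 (Finset.mem_range.1 ht)
    have hmul := mul_le_mul_of_nonneg_right ht' hr.le
    exact hcon (a + 7 * t * r) (by have : 0 ≤ (t : ℝ) * r := by positivity
                                   linarith) (by linarith)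
  have : Nonempty ι := ⟨(h1 0 (by simp)).choose⟩
  choose! g hg hg' using h1
  obtain ⟨t, ht, t', ht', hne, heq⟩ := Finset.exists_ne_map_eq_of_card_lt_of_maps_to
    (by simp : F.card < (Finset.range (F.card + 1)).card) hg
  obtain ⟨x, hx, hx1, hx2⟩ := Set.not_disjoint_iff.1 (hg' t ht)
  obtain ⟨y, hy, hy1, hy2⟩ := Set.not_disjoint_iff.1 (hg' t' ht')
  rw [← heq] at hy
  have hxy := abs_le.1 (hBad _ (hg t ht) x hx y hy)
  rcases lt_or_gt_of_ne hne with h | h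
  · have : (t : ℝ) + 1 ≤ t' := by exact_mod_cast h
    nlinarith
  · have : (t' : ℝ) + 1 ≤ t := by exact_mod_cast h
    nlinarith

theorem exists_mem_nested_intervals {ℓ c : ℕ → ℝ} (hpos : ∀ j, 0 < ℓ j)
    (h : ∀ j, c j ≤ c (j + 1) ∧ c (j + 1) + ℓ (j + 1) ≤ c j + ℓ j) :
    ∃ x, ∀ j, x ∈ Set.Icc (c j) (c j + ℓ j) := by
  have hmono : Monotone c := monotone_nat_of_le_succ fun j => (h j).1
  have hanti : Antitone fun j => c j + ℓ j := antitone_nat_of_succ_le fun j => (h j).2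
  have hle : ∀ i j, c i ≤ c j + ℓ j := fun i j => by
    have h1 := hmono (le_max_left i j)
    have h2 := hanti (le_max_right i j)
    have h3 := hpos (max i j)
    simp only at h2
    linarith
  exact ⟨⨆ i, c i, fun j => ⟨le_ciSup ⟨c 0 + ℓ 0, by rintro _ ⟨i, rfl⟩; exact hle i 0⟩ j,
    ciSup_le fun i => hle i j⟩⟩

theorem exists_angle_of_scales {Ω : Set ℝ} {ℓ : ℕ → ℝ} {F : ℕ → Finset ℝ} (hpos : ∀ j, 0 < ℓ j)
    (h0 : ℓ 0 ≤ 1 / 8) (hcov : ∀ j, Covers (F j) (ℓ (j + 1)) Ω)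
    (hcard : ∀ j, (F j).Nonempty) (hK : ∀ j, 7 * ((F j).card + 1) * ℓ (j + 1) ≤ ℓ j) :
    ∃ α : ℝ, ∀ j, ∀ m p : ℤ, (m, p) ≠ 0 → 8 * ((m : ℝ) ^ 2 + (p : ℝ) ^ 2) * ℓ j ≤ 1 →
      ∀ θ ∈ Ω, ℓ (j + 1) ^ 2 * ((m : ℝ) ^ 2 + (p : ℝ) ^ 2) ≤
        (m * Real.cos (θ - α) + p * Real.sin (θ - α)) ^ 2 := by
  have h10 : ∀ j, 10 * ℓ (j + 1) ≤ ℓ j := fun j => by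
    have h1 : (1 : ℝ) ≤ (F j).card := by exact_mod_cast (hcard j).card_pos
    nlinarith [hK j, hpos (j + 1)]
  have hle : ∀ j, ℓ j ≤ 1 / 8 := fun j => by
    induction j with
    | zero => exact h0
    | succ j ih => linarith [h10 j, hpos (j + 1)]
  have step : ∀ j (a : ℝ), ∃ c, a ≤ c ∧ c + ℓ (j + 1) ≤ a + ℓ j ∧
      ∀ α ∈ Set.Icc c (c + ℓ (j + 1)), ∀ m p : ℤ, (m, p) ≠ 0 →
        8 * ((m : ℝ) ^ 2 + (p : ℝ) ^ 2) * ℓ j ≤ 1 →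
      ∀ θ ∈ Ω, ℓ (j + 1) ^ 2 * ((m : ℝ) ^ 2 + (p : ℝ) ^ 2) ≤
        (m * Real.cos (θ - α) + p * Real.sin (θ - α)) ^ 2 := by
    intro j a
    obtain ⟨c, hc1, hc2, hc3⟩ := exists_subinterval_avoiding (F j) (a := a)
      (fun b => {α | α ∈ Set.Icc a (a + ℓ j) ∧ ∃ θ, b ≤ θ ∧ θ ≤ b + ℓ (j + 1) ∧
        ∃ m p : ℤ, (m, p) ≠ 0 ∧ 8 * ((m : ℝ) ^ 2 + (p : ℝ) ^ 2) * ℓ j ≤ 1 ∧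
          (m * Real.cos (θ - α) + p * Real.sin (θ - α)) ^ 2 <
            ℓ (j + 1) ^ 2 * ((m : ℝ) ^ 2 + (p : ℝ) ^ 2)}) (hpos (j + 1)) (by
      rintro b - α ⟨⟨hα1, hα2⟩, θ, hθ1, hθ2, m, p, hν, hQ, hF⟩ α' ⟨⟨hα1', hα2'⟩, θ', hθ1', hθ2',
        m', p', hν', hQ', hF'⟩
      have hr := h10 j
      have hp := hpos (j + 1)
      have hx : |θ - α - (θ' - α')| ≤ 2 * ℓ j := abs_le.2 ⟨by linarith, by linarith⟩
      have := abs_le.1 (abs_sub_le_of_small_forms hν hν' hr hp.le (hpos j) (hle j) hQ hQ' hx hF hF')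
      exact abs_le.2 ⟨by linarith, by linarith⟩)
    have hc2' := hc2.trans (add_le_add_right (hK j) a)
    refine ⟨c, hc1, hc2', fun α hα m p hν hQ θ hθ => ?_⟩
    obtain ⟨b, hb, hb1, hb2⟩ := hcov j θ hθ
    by_contra hlt
    exact Set.disjoint_left.1 (hc3 b hb) ⟨⟨hc1.trans hα.1, hα.2.trans hc2'⟩, θ, hb1, hb2, m, p,
      hν, hQ, not_le.1 hlt⟩ hα
  choose next hn1 hn2 hn3 using step
  let c : ℕ → ℝ := fun j => Nat.rec 0 next j
  obtain ⟨α, hα⟩ := exists_mem_nested_intervals (c := c) hpos fun j => ⟨hn1 j (c j), hn2 j (c j)⟩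
  exact ⟨α, fun j m p hν hQ θ hθ => hn3 j (c j) α (hα (j + 1)) m p hν hQ θ hθ⟩

/-- The relation between the exponents of consecutive scales `2⁻ᵃ`, `2⁻ᵇ` if `κ i` intervals of
length `2⁻ⁱ` are needed at the scale `2⁻ⁱ`. -/
def ScaleStep (κ : ℕ → ℕ) (a b : ℕ) : Prop :=
  (2 : ℝ) ^ b ≤ 14 * (κ (b - 1) + 1) * 2 ^ a

theorem exists_angle {Ω : Set ℝ} (hΩ : Ω.Nonempty) {κ : ℕ → ℕ}
    (hcov : ∀ i, ∃ F : Finset ℝ, F.card = κ i ∧ Covers F ((1 / 2) ^ i) Ω)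
    (hκ : ∀ a : ℕ, ∃ b : ℕ, 7 * ((κ b : ℝ) + 1) * 2 ^ a ≤ 2 ^ b) :
    ∃ α : ℝ, ∀ m p : ℤ, (m, p) ≠ 0 → ∃ i i' i'' : ℕ, (2 : ℝ) ^ i ≤ 8 * ((m : ℝ) ^ 2 + (p : ℝ) ^ 2) ∧
      ScaleStep κ i i' ∧ ScaleStep κ i' i'' ∧ ∀ θ ∈ Ω,
        (m : ℝ) ^ 2 + (p : ℝ) ^ 2 ≤
          (2 ^ i'' * (m * Real.cos (θ - α) + p * Real.sin (θ - α))) ^ 2 := by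
  classical
  choose F hFc hF using hcov
  let next : ℕ → ℕ := fun a => Nat.find (hκ a)
  have hnext : ∀ a, 7 * ((κ (next a) : ℝ) + 1) * 2 ^ a ≤ 2 ^ next a := fun a => Nat.find_spec (hκ a)
  have hlt : ∀ a, a < next a := fun a => by
    have h1 := hnext a
    have h2 : (2 : ℝ) ^ a < 2 ^ next a := by
      have : (0 : ℝ) < 2 ^ a := by positivity
      have : (0 : ℝ) ≤ κ (next a) * 2 ^ a := by positivity
      nlinarith
    exact (pow_lt_pow_iff_right₀ (by norm_num)).1 h2
  have hstep : ∀ a, ScaleStep κ a (next a) := fun a => by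
    have h1 := Nat.find_min (hκ a) (m := next a - 1) (by have := hlt a; change next a - 1 < next a; omega)
    rw [not_le] at h1
    have h2 : (2 : ℝ) ^ next a = 2 * 2 ^ (next a - 1) := by
      rw [← pow_succ']; congr 1; have := hlt a; omega
    unfold ScaleStep
    linarith
  let e : ℕ → ℕ := fun j => Nat.rec 3 (fun _ a => next a) j
  have he : ∀ j, e (j + 1) = next (e j) := fun j => rfl
  have hcancel : ∀ n : ℕ, (1 / 2 : ℝ) ^ n * 2 ^ n = 1 := fun n => by
    rw [← mul_pow]; norm_num
  obtain ⟨α, hα⟩ := exists_angle_of_scales (Ω := Ω) (ℓ := fun j => (1 / 2) ^ e j)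
    (F := fun j => F (e (j + 1))) (fun j => by positivity) (by norm_num [e])
    (fun j => hF _) (fun j => by
      obtain ⟨y, hy⟩ := hΩ
      obtain ⟨a, ha, -⟩ := hF (e (j + 1)) y hy
      exact ⟨a, ha⟩) (fun j => by
      have h1 := hnext (e j)
      rw [← he] at h1
      rw [hFc]
      have h2 := hcancel (e j)
      have h3 := hcancel (e (j + 1))
      calc 7 * ((κ (e (j + 1)) : ℝ) + 1) * (1 / 2) ^ e (j + 1)
          = (7 * ((κ (e (j + 1)) : ℝ) + 1) * 2 ^ e j) * ((1 / 2) ^ e j * (1 / 2) ^ e (j + 1)) := by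
            linear_combination (-7 * ((κ (e (j + 1)) : ℝ) + 1) * (1 / 2) ^ e (j + 1)) * h2
        _ ≤ 2 ^ e (j + 1) * ((1 / 2) ^ e j * (1 / 2) ^ e (j + 1)) :=
            mul_le_mul_of_nonneg_right h1 (by positivity)
        _ = (1 / 2) ^ e j := by linear_combination ((1 / 2 : ℝ) ^ e j) * h3)
  have hbig : ∀ j, j ≤ e j := fun j => by
    induction j with
    | zero => simp
    | succ j ih => exact Nat.succ_le_of_lt (ih.trans_lt (hlt _))
  refine ⟨α, fun m p hν => ?_⟩
  have hex : ∃ j, 8 * ((m : ℝ) ^ 2 + (p : ℝ) ^ 2) ≤ 2 ^ e j := by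
    obtain ⟨r, hr⟩ := exists_le_two_pow (8 * ((m : ℝ) ^ 2 + (p : ℝ) ^ 2))
    exact ⟨r, hr.trans (pow_le_pow_right₀ (by norm_num) (hbig r))⟩
  have key : ∀ j, 8 * ((m : ℝ) ^ 2 + (p : ℝ) ^ 2) ≤ 2 ^ e j → ∀ θ ∈ Ω,
      (m : ℝ) ^ 2 + (p : ℝ) ^ 2 ≤
        (2 ^ e (j + 1) * (m * Real.cos (θ - α) + p * Real.sin (θ - α))) ^ 2 := by
    intro j hj θ hθ
    have h1 := hα j m p hν (by
      have h2 : (0 : ℝ) ≤ (1 / 2) ^ e j := by positivity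
      have := mul_le_mul_of_nonneg_right hj h2
      linarith [hcancel (e j)]) θ hθ
    have h3 := hcancel (e (j + 1))
    have h4 := mul_le_mul_of_nonneg_left h1 (sq_nonneg ((2 : ℝ) ^ e (j + 1)))
    rw [← mul_assoc, ← mul_pow, mul_comm ((2 : ℝ) ^ e (j + 1)), h3, ← mul_pow] at h4
    simpa using h4
  have hspec := Nat.find_spec hex
  rcases Nat.eq_zero_or_pos (Nat.find hex) with hz | hz
  · rw [hz] at hspec
    refine ⟨3, 3, next 3, ?_, ?_, hstep 3, key 0 hspec⟩
    · have := one_le_sq_add_sq hν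
      linarith
    · unfold ScaleStep
      have : (0 : ℝ) ≤ (κ (3 - 1) : ℝ) := Nat.cast_nonneg _
      nlinarith
  · obtain ⟨j, hj⟩ := Nat.exists_eq_succ_of_ne_zero hz.ne'
    have hmin := Nat.find_min hex (m := j) (by omega)
    rw [hj] at hspec
    exact ⟨e j, e (j + 1), e (j + 2), (not_le.1 hmin).le, hstep _, hstep _, key (j + 1) hspec⟩

/-- The sawtooth function. -/
noncomputable def saw (x : ℝ) : ℝ := 1 / 2 - Int.fract x

theorem measurable_saw : Measurable saw := measurable_const.sub measurable_fract

theorem abs_saw_le (x : ℝ) : |saw x| ≤ 1 / 2 := by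
  have h1 := Int.fract_nonneg x
  have h2 := (Int.fract_lt_one x).le
  unfold saw
  exact abs_le.2 ⟨by linarith, by linarith⟩

theorem saw_add_int (x : ℝ) (n : ℤ) : saw (x + n) = saw x := by simp [saw]

theorem saw_fract_add (x b : ℝ) : saw (Int.fract x + b) = saw (x + b) := by
  rw [← saw_add_int (Int.fract x + b) ⌊x⌋]
  congr 1
  linarith [Int.fract_add_floor x]

theorem intervalIntegrable_of_measurable_of_abs_le {f : ℝ → ℝ} (hf : Measurable f) {K : ℝ}
    (hK : ∀ x, |f x| ≤ K) (a b : ℝ) : IntervalIntegrable f volume a b := by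
  rw [intervalIntegrable_iff]
  exact Measure.integrableOn_of_bounded (M := K) (by simp) hf.aestronglyMeasurable
    (Filter.Eventually.of_forall fun x => by simpa using hK x)

theorem intervalIntegrable_saw_mul_saw (x y a b : ℝ) :
    IntervalIntegrable (fun t => saw (x + t) * saw (y + t)) volume a b := by
  refine intervalIntegrable_of_measurable_of_abs_le (K := 1 / 2 * (1 / 2))
    ((measurable_saw.comp (measurable_const_add x)).mul
      (measurable_saw.comp (measurable_const_add y))) (fun t => ?_) a b
  rw [Pi.mul_apply, abs_mul]
  exact mul_le_mul (abs_saw_le _) (abs_saw_le _) (abs_nonneg _) (by norm_num)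

theorem integral_saw_mul_saw_zero {z : ℝ} (h0 : 0 ≤ z) (h1 : z < 1) :
    ∫ b in (0 : ℝ)..1, saw (z + b) * saw (0 + b) = (z ^ 2 - z + 1 / 6) / 2 := by
  rw [← intervalIntegral.integral_add_adjacent_intervals
    (intervalIntegrable_saw_mul_saw z 0 0 (1 - z)) (intervalIntegrable_saw_mul_saw z 0 (1 - z) 1)]
  have e1 : ∫ b in (0 : ℝ)..(1 - z), saw (z + b) * saw (0 + b) =
      ∫ b in (0 : ℝ)..(1 - z), ((1 / 2 - z) * (1 / 2) - (1 - z) * b + b ^ 2) := by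
    refine intervalIntegral.integral_congr_ae ?_
    have : ∀ᵐ b : ℝ, b ≠ 1 - z := by simp [ae_iff, measure_singleton]
    filter_upwards [this] with b hb hmem
    rw [Set.uIoc_of_le (by linarith)] at hmem
    have hlt : b < 1 - z := lt_of_le_of_ne hmem.2 hb
    have f1 : Int.fract (z + b) = z + b := Int.fract_eq_self.2 ⟨by linarith [hmem.1], by linarith⟩
    have f2 : Int.fract (0 + b) = b := by
      rw [zero_add]; exact Int.fract_eq_self.2 ⟨hmem.1.le, by linarith⟩
    rw [saw, saw, f1, f2]; ring
  have e2 : ∫ b in (1 - z)..(1 : ℝ), saw (z + b) * saw (0 + b) =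
      ∫ b in (1 - z)..(1 : ℝ), ((3 / 2 - z) * (1 / 2) - (2 - z) * b + b ^ 2) := by
    refine intervalIntegral.integral_congr_ae ?_
    have : ∀ᵐ b : ℝ, b ≠ 1 := by simp [ae_iff, measure_singleton]
    filter_upwards [this] with b hb hmem
    rw [Set.uIoc_of_le (by linarith)] at hmem
    have hlt : b < 1 := lt_of_le_of_ne hmem.2 hb
    have f1 : Int.fract (z + b) = z + b - 1 := by
      rw [← Int.fract_sub_one]
      exact Int.fract_eq_self.2 ⟨by linarith [hmem.1], by linarith⟩
    have f2 : Int.fract (0 + b) = b := by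
      rw [zero_add]; exact Int.fract_eq_self.2 ⟨by linarith [hmem.1], by linarith⟩
    rw [saw, saw, f1, f2]; ring
  rw [e1, e2, intervalIntegral.integral_add (Continuous.intervalIntegrable (by fun_prop) _ _)
    (Continuous.intervalIntegrable (by fun_prop) _ _),
    intervalIntegral.integral_sub (Continuous.intervalIntegrable (by fun_prop) _ _)
    (Continuous.intervalIntegrable (by fun_prop) _ _),
    intervalIntegral.integral_add (Continuous.intervalIntegrable (by fun_prop) _ _)
    (Continuous.intervalIntegrable (by fun_prop) _ _),
    intervalIntegral.integral_sub (Continuous.intervalIntegrable (by fun_prop) _ _)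
    (Continuous.intervalIntegrable (by fun_prop) _ _)]
  have hmul : ∀ c u v : ℝ, ∫ b in u..v, c * b = c * ((v ^ 2 - u ^ 2) / 2) := fun c u v => by
    rw [intervalIntegral.integral_const_mul, integral_id]
  simp only [intervalIntegral.integral_const, hmul, integral_pow, smul_eq_mul]
  push_cast
  ring

theorem integral_saw_mul_saw (x y : ℝ) :
    ∫ b in (0 : ℝ)..1, saw (x + b) * saw (y + b) =
      (Int.fract (x - y) ^ 2 - Int.fract (x - y) + 1 / 6) / 2 := by
  rw [← integral_saw_mul_saw_zero (Int.fract_nonneg (x - y)) (Int.fract_lt_one (x - y))]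
  have hper : Function.Periodic (fun b => saw (x - y + b) * saw (0 + b)) 1 := fun b => by
    have h := fun z : ℝ => saw_add_int z 1
    push_cast at h
    simp only [← add_assoc, h]
  have h1 := hper.intervalIntegral_add_eq 0 y
  rw [zero_add] at h1
  simp only [saw_fract_add]
  have h2 := intervalIntegral.integral_comp_add_right (a := 0) (b := 1)
    (fun b => saw (x - y + b) * saw (0 + b)) y
  rw [zero_add, add_comm 1 y] at h2
  rw [h1, ← h2]
  congr 1
  ext b
  congr 2 <;> ring

theorem hasSum_cos_div_sq (x : ℝ) :
    HasSum (fun m : ℕ => 1 / (2 * Real.pi ^ 2) * (1 / (m : ℝ) ^ 2 * Real.cos (2 * Real.pi * m * x)))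
      ((Int.fract x ^ 2 - Int.fract x + 1 / 6) / 2) := by
  have h := hasSum_one_div_nat_pow_mul_cos one_ne_zero (x := Int.fract x)
    ⟨Int.fract_nonneg x, (Int.fract_lt_one x).le⟩
  have hb : Polynomial.eval (Int.fract x) (Polynomial.map (algebraMap ℚ ℝ)
      (Polynomial.bernoulli (2 * 1))) = Int.fract x ^ 2 - Int.fract x + 6⁻¹ :=
    bernoulliFun_two (Int.fract x)
  rw [hb] at h
  have h' := h.mul_left (1 / (2 * Real.pi ^ 2))
  have hpi := Real.pi_ne_zero
  have e1 : ∀ m : ℕ, Real.cos (2 * Real.pi * m * Int.fract x) = Real.cos (2 * Real.pi * m * x) := by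
    intro m
    rw [← Real.cos_sub_int_mul_two_pi (2 * Real.pi * m * x) ((m : ℤ) * ⌊x⌋)]
    congr 1
    push_cast
    rw [Int.fract]
    ring
  have e2 : 1 / (2 * Real.pi ^ 2) * ((-1) ^ (1 + 1) * (2 * Real.pi) ^ (2 * 1) / 2 /
      ((2 * 1).factorial : ℝ) * (Int.fract x ^ 2 - Int.fract x + 6⁻¹)) =
      (Int.fract x ^ 2 - Int.fract x + 1 / 6) / 2 := by
    norm_num [Nat.factorial]
    field_simp
  rw [e2] at h'
  simpa only [e1, mul_one] using h'

theorem geometric_trig_bound (x : ℝ) (a : ℤ) (L : ℕ) :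
    Real.sin (x / 2) ^ 2 * ((∑ i ∈ Finset.range L, Real.cos (x * (a + i : ℤ))) ^ 2 +
      (∑ i ∈ Finset.range L, Real.sin (x * (a + i : ℤ))) ^ 2) ≤ 1 := by
  have hC : 2 * Real.sin (x / 2) * ∑ i ∈ Finset.range L, Real.cos (x * (a + i : ℤ)) =
      Real.sin (x * (a + L) - x / 2) - Real.sin (x * a - x / 2) := by
    induction L with
    | zero => simp
    | succ L ih =>
      rw [Finset.sum_range_succ, mul_add, ih]
      have h1 : x * (a + (L + 1 : ℕ)) - x / 2 = x * (a + L) + x / 2 := by push_cast; ring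
      rw [h1, Real.sin_add, Real.sin_sub]
      push_cast
      ring
  have hS : 2 * Real.sin (x / 2) * ∑ i ∈ Finset.range L, Real.sin (x * (a + i : ℤ)) =
      Real.cos (x * a - x / 2) - Real.cos (x * (a + L) - x / 2) := by
    clear hC
    induction L with
    | zero => simp
    | succ L ih =>
      rw [Finset.sum_range_succ, mul_add, ih]
      have h1 : x * (a + (L + 1 : ℕ)) - x / 2 = x * (a + L) + x / 2 := by push_cast; ring
      rw [h1, Real.cos_add (x * (a + L)), Real.cos_sub (x * (a + L))]
      push_cast
      ring
  generalize ∑ i ∈ Finset.range L, Real.cos (x * (a + i : ℤ)) = C at hC ⊢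
  generalize ∑ i ∈ Finset.range L, Real.sin (x * (a + i : ℤ)) = S at hS ⊢
  generalize x * (a + L) - x / 2 = u at hC hS
  generalize x * a - x / 2 = v at hC hS
  have h4 : 4 * (Real.sin (x / 2) ^ 2 * (C ^ 2 + S ^ 2)) ≤ 4 := by
    calc 4 * (Real.sin (x / 2) ^ 2 * (C ^ 2 + S ^ 2))
        = (2 * Real.sin (x / 2) * C) ^ 2 + (2 * Real.sin (x / 2) * S) ^ 2 := by ring
      _ = 2 - 2 * Real.cos (u - v) := by
        rw [hC, hS, Real.cos_sub]
        linear_combination Real.sin_sq_add_cos_sq u + Real.sin_sq_add_cos_sq v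
      _ ≤ 4 := by linarith [Real.neg_one_le_cos (u - v)]
  linarith

theorem four_mul_sq_le_sin_sq (x : ℝ) :
    4 * (x - round x) ^ 2 ≤ Real.sin (Real.pi * x) ^ 2 := by
  have h1 : Real.sin (Real.pi * x) ^ 2 = Real.sin (Real.pi * (x - round x)) ^ 2 := by
    rw [mul_sub, mul_comm Real.pi (round x : ℝ), Real.sin_sub_int_mul_pi, mul_pow,
      ← sq_abs ((-1 : ℝ) ^ round x), abs_neg_one_zpow, one_pow, one_mul]
  have h2 := abs_sub_round x
  have hpi := Real.pi_pos
  have h3 := Real.mul_abs_le_abs_sin (x := Real.pi * (x - round x)) (by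
    rw [abs_mul, abs_of_pos hpi]; nlinarith)
  rw [h1, ← sq_abs (Real.sin _)]
  rw [abs_mul, abs_of_pos hpi, ← mul_assoc, div_mul_cancel₀ _ hpi.ne'] at h3
  calc 4 * (x - round x) ^ 2 = (2 * |x - round x|) ^ 2 := by rw [mul_pow, sq_abs]; norm_num
    _ ≤ _ := pow_le_pow_left₀ (by positivity) h3 2

theorem integral_saw_sum_sq {s : ℝ} (a : ℤ) (L : ℕ) (t : ℝ) :
    HasSum (fun m : ℕ => 1 / (2 * Real.pi ^ 2) * (1 / (m : ℝ) ^ 2 *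
      ((∑ i ∈ Finset.range L, Real.cos (2 * Real.pi * m * s * (a + i : ℤ))) ^ 2 +
        (∑ i ∈ Finset.range L, Real.sin (2 * Real.pi * m * s * (a + i : ℤ))) ^ 2)))
      (∫ b in (0 : ℝ)..1, (∑ i ∈ Finset.range L, saw (s * (a + i : ℤ) + t + b)) ^ 2) := by
  have h1 : ∫ b in (0 : ℝ)..1, (∑ i ∈ Finset.range L, saw (s * (a + i : ℤ) + t + b)) ^ 2 =
      ∑ i ∈ Finset.range L, ∑ j ∈ Finset.range L,
        (Int.fract (s * (a + i : ℤ) - s * (a + j : ℤ)) ^ 2 -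
          Int.fract (s * (a + i : ℤ) - s * (a + j : ℤ)) + 1 / 6) / 2 := by
    simp only [sq, Finset.sum_mul_sum]
    rw [intervalIntegral.integral_finsetSum fun i _ => by
      have := IntervalIntegrable.sum (Finset.range L) fun j _ =>
        intervalIntegrable_saw_mul_saw (s * (a + i : ℤ) + t) (s * (a + j : ℤ) + t) 0 1
      simpa only [Finset.sum_fn] using this]
    refine Finset.sum_congr rfl fun i _ => ?_
    rw [intervalIntegral.integral_finsetSum fun j _ => intervalIntegrable_saw_mul_saw _ _ _ _]
    refine Finset.sum_congr rfl fun j _ => ?_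
    rw [integral_saw_mul_saw, add_sub_add_right_eq_sub, sq]
  rw [h1]
  convert hasSum_sum fun i (_ : i ∈ Finset.range L) => hasSum_sum fun j (_ : j ∈ Finset.range L) =>
    hasSum_cos_div_sq (s * (a + i : ℤ) - s * (a + j : ℤ)) using 1
  ext m
  simp only [← Finset.mul_sum]
  congr 2
  rw [sq, sq, Finset.sum_mul_sum, Finset.sum_mul_sum, ← Finset.sum_add_distrib]
  refine Finset.sum_congr rfl fun i _ => ?_
  rw [← Finset.sum_add_distrib]
  refine Finset.sum_congr rfl fun j _ => ?_
  rw [← Real.cos_sub]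
  congr 1
  ring

theorem sum_inv_sq_le_two (F : Finset ℕ) : ∑ k ∈ F, 1 / (k : ℝ) ^ 2 ≤ 2 := by
  refine (sum_le_hasSum F (fun k _ => by positivity) hasSum_zeta_two).trans ?_
  nlinarith [Real.pi_pos, Real.pi_lt_d2]

theorem sum_le_of_separated_nonneg {ι : Type*} (T : Finset ι) {f z : ι → ℝ} {A δ : ℝ} (hA : 0 ≤ A)
    (hδ : 0 < δ) (hfA : ∀ m ∈ T, f m ≤ A) (hfz : ∀ m ∈ T, f m * (4 * z m ^ 2) ≤ 1)
    (hz : ∀ m ∈ T, 0 ≤ z m) (hsep : ∀ m ∈ T, ∀ m' ∈ T, m ≠ m' → δ ≤ |z m - z m'|) :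
    ∑ m ∈ T, f m ≤ A + 1 / (2 * δ ^ 2) := by
  classical
  let k : ι → ℕ := fun m => ⌊z m / δ⌋₊
  have hk1 : ∀ m ∈ T, k m * δ ≤ z m := fun m hm => by
    rw [← le_div_iff₀ hδ]; exact Nat.floor_le (div_nonneg (hz m hm) hδ.le)
  have hk2 : ∀ m, z m < (k m + 1) * δ := fun m => by
    rw [← div_lt_iff₀ hδ]; exact Nat.lt_floor_add_one _
  have hinj : Set.InjOn k T := fun m hm m' hm' h => by
    by_contra hne
    have h1 := hsep m hm m' hm' hne
    have a1 := hk1 m hm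
    have a2 := hk2 m
    have a3 := hk1 m' hm'
    have a4 := hk2 m'
    rw [h] at a1 a2
    have : |z m - z m'| < δ := abs_lt.2 ⟨by linarith, by linarith⟩
    linarith
  let w : ℕ → ℝ := fun k => (if k = 0 then A else 0) + 1 / (4 * δ ^ 2) * (1 / (k : ℝ) ^ 2)
  have hfw : ∀ m ∈ T, f m ≤ w (k m) := fun m hm => by
    by_cases h0 : k m = 0
    · simp [w, h0, hfA m hm]
    · simp only [w, if_neg h0, zero_add]
      have hkpos : (0 : ℝ) < k m := by exact_mod_cast Nat.pos_of_ne_zero h0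
      rw [div_mul_div_comm, one_mul, le_div_iff₀ (by positivity)]
      by_cases hf : f m ≤ 0
      · have : 0 ≤ 4 * δ ^ 2 * (k m : ℝ) ^ 2 := by positivity
        nlinarith
      · refine le_trans ?_ (hfz m hm)
        refine mul_le_mul_of_nonneg_left ?_ (not_le.1 hf).le
        have := pow_le_pow_left₀ (by positivity) (hk1 m hm) 2
        nlinarith
  calc ∑ m ∈ T, f m ≤ ∑ m ∈ T, w (k m) := Finset.sum_le_sum hfw
    _ = ∑ i ∈ T.image k, w i := (Finset.sum_image hinj).symm
    _ = ∑ i ∈ T.image k, (if i = 0 then A else 0) +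
        1 / (4 * δ ^ 2) * ∑ i ∈ T.image k, 1 / (i : ℝ) ^ 2 := by
      rw [Finset.sum_add_distrib, Finset.mul_sum]
    _ ≤ A + 1 / (4 * δ ^ 2) * 2 := by
      refine add_le_add ?_ (mul_le_mul_of_nonneg_left (sum_inv_sq_le_two _) (by positivity))
      rw [Finset.sum_ite_eq']
      split_ifs <;> simp [hA]
    _ = A + 1 / (2 * δ ^ 2) := by field_simp; ring

theorem sum_le_of_separated {ι : Type*} (T : Finset ι) {f y : ι → ℝ} {A δ : ℝ} (hA : 0 ≤ A)
    (hδ : 0 < δ) (hfA : ∀ m ∈ T, f m ≤ A) (hfy : ∀ m ∈ T, f m * (4 * y m ^ 2) ≤ 1)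
    (hsep : ∀ m ∈ T, ∀ m' ∈ T, m ≠ m' → δ ≤ |y m - y m'|) :
    ∑ m ∈ T, f m ≤ 2 * A + 1 / δ ^ 2 := by
  classical
  rw [← Finset.sum_filter_add_sum_filter_not T fun m => 0 ≤ y m]
  have h1 := sum_le_of_separated_nonneg (T.filter fun m => 0 ≤ y m) (f := f) (z := y) hA hδ
    (fun m hm => hfA m (Finset.mem_filter.1 hm).1) (fun m hm => hfy m (Finset.mem_filter.1 hm).1)
    (fun m hm => (Finset.mem_filter.1 hm).2)
    (fun m hm m' hm' => hsep m (Finset.mem_filter.1 hm).1 m' (Finset.mem_filter.1 hm').1)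
  have h2 := sum_le_of_separated_nonneg (T.filter fun m => ¬ 0 ≤ y m) (f := f)
    (z := fun m => - y m) hA hδ
    (fun m hm => hfA m (Finset.mem_filter.1 hm).1)
    (fun m hm => by rw [neg_sq]; exact hfy m (Finset.mem_filter.1 hm).1)
    (fun m hm => by have := (Finset.mem_filter.1 hm).2; linarith)
    (fun m hm m' hm' hne => by
      rw [neg_sub_neg, abs_sub_comm]
      exact hsep m (Finset.mem_filter.1 hm).1 m' (Finset.mem_filter.1 hm').1 hne)
  have h3 : 1 / δ ^ 2 = 1 / (2 * δ ^ 2) + 1 / (2 * δ ^ 2) := by field_simp; norm_num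
  linarith

/-- `q ‖q s‖ ≥ 1 / φ` for `1 ≤ q ≤ H`, where `‖·‖` is the distance to the nearest integer. -/
def IsBadlyApprox (φ : ℝ) (H : ℕ) (s : ℝ) : Prop :=
  ∀ q : ℕ, 1 ≤ q → q ≤ H → ∀ p : ℤ, 1 ≤ φ * q * |q * s - p|

theorem IsBadlyApprox.separated {φ s : ℝ} {H : ℕ} (h : IsBadlyApprox φ H s) (hφ : 0 < φ)
    {H' : ℕ} (hH' : H' ≤ H) {u m m' : ℕ} (hm : m ∈ Finset.Ico u (u + H'))
    (hm' : m' ∈ Finset.Ico u (u + H')) (hne : m ≠ m') :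
    1 / (φ * H') ≤ |(m * s - round (m * s)) - (m' * s - round (m' * s))| := by
  wlog hlt : m' < m generalizing m m'
  · rw [abs_sub_comm]
    exact this hm' hm hne.symm (lt_of_le_of_ne (not_lt.1 hlt) hne)
  rw [Finset.mem_Ico] at hm hm'
  obtain ⟨q, rfl⟩ := Nat.exists_eq_add_of_lt hlt
  have h1 := h (q + 1) (by omega) (by omega) (round ((m' + q + 1 : ℕ) * s) - round (m' * s))
  have hH : ((q + 1 : ℕ) : ℝ) ≤ H' := by exact_mod_cast (by omega : q + 1 ≤ H')
  have hH0 : (0 : ℝ) < H' := lt_of_lt_of_le (by positivity) hH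
  rw [div_le_iff₀ (by positivity)]
  have e : ((m' + q + 1 : ℕ) : ℝ) * s - round ((m' + q + 1 : ℕ) * s) - (m' * s - round (m' * s)) =
      ((q + 1 : ℕ) : ℝ) * s - ((round ((m' + q + 1 : ℕ) * s) - round (m' * s) : ℤ) : ℝ) := by
    push_cast; ring
  rw [e]
  refine h1.trans ?_
  rw [mul_comm]
  exact mul_le_mul_of_nonneg_left (mul_le_mul_of_nonneg_left hH hφ.le) (abs_nonneg _)

theorem IsBadlyApprox.sum_block_le {φ s : ℝ} {H : ℕ} (h : IsBadlyApprox φ H s) (hφ : 0 < φ)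
    {f : ℕ → ℝ} (hf : ∀ m, f m * (4 * (m * s - round (m * s)) ^ 2) ≤ 1) (hf0 : ∀ m, 0 ≤ f m)
    {H' u : ℕ} (hH' : H' ≤ H) (h0 : 1 ≤ H') (hu : 1 ≤ u) {A : ℝ} (hA : 0 ≤ A)
    (hfA : ∀ m ∈ Finset.Ico u (u + H'), f m ≤ A) :
    ∑ m ∈ Finset.Ico u (u + H'), 1 / (m : ℝ) ^ 2 * f m ≤
      1 / (u : ℝ) ^ 2 * (2 * A + φ ^ 2 * (H' : ℝ) ^ 2) := by
  have hH0 : (0 : ℝ) < H' := by exact_mod_cast h0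
  have hu0 : (0 : ℝ) < u := by exact_mod_cast hu
  have h1 := sum_le_of_separated (Finset.Ico u (u + H')) (f := f)
    (y := fun m => m * s - round (m * s)) hA (δ := 1 / (φ * H')) (by positivity) hfA
    (fun m _ => hf m) fun m hm m' hm' hne => h.separated hφ hH' hm hm' hne
  have e : 1 / (1 / (φ * (H' : ℝ))) ^ 2 = φ ^ 2 * (H' : ℝ) ^ 2 := by field_simp
  rw [e] at h1
  refine le_trans ?_ (mul_le_mul_of_nonneg_left h1 (by positivity))
  rw [Finset.mul_sum]
  refine Finset.sum_le_sum fun m hm => mul_le_mul_of_nonneg_right ?_ (hf0 m)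
  have : (u : ℝ) ≤ m := by exact_mod_cast (Finset.mem_Ico.1 hm).1
  gcongr

theorem four_pow_eq (j : ℕ) : (4 : ℝ) ^ j = (2 ^ j) ^ 2 := by
  rw [← pow_mul, mul_comm, pow_mul]; norm_num

theorem IsBadlyApprox.sum_le {φ s : ℝ} {J : ℕ} (h : IsBadlyApprox φ (2 ^ J) s) (hφ : 0 < φ)
    {f : ℕ → ℝ} (hf : ∀ m, f m * (4 * (m * s - round (m * s)) ^ 2) ≤ 1) (hf0 : ∀ m, 0 ≤ f m)
    {A : ℝ} (hfA : ∀ m, f m ≤ A) (X : ℕ) :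
    ∑ m ∈ Finset.range X, 1 / (m : ℝ) ^ 2 * f m ≤
      3 * J * φ ^ 2 + 4 * A / 4 ^ J + 2 * φ ^ 2 := by
  have hA : 0 ≤ A := (hf0 0).trans (hfA 0)
  have small : ∀ j ≤ J, ∑ m ∈ Finset.Ico (1 : ℕ) (2 ^ j), 1 / (m : ℝ) ^ 2 * f m ≤ 3 * j * φ ^ 2 := by
    intro j
    induction j with
    | zero => simp
    | succ j ih =>
      intro hj
      have h2 : (2 : ℕ) ^ (j + 1) = 2 ^ j + 2 ^ j := by ring
      have hj0 : 0 < (2 : ℕ) ^ j := Nat.two_pow_pos j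
      have hle : (2 : ℕ) ^ (j + 1) ≤ 2 ^ J := Nat.pow_le_pow_right (by norm_num) hj
      rw [← Finset.sum_Ico_consecutive _ Nat.one_le_two_pow (by omega : 2 ^ j ≤ 2 ^ (j + 1)), h2]
      have h3 := h.sum_block_le hφ hf hf0 (H' := 2 ^ j) (u := 2 ^ j) (by omega) Nat.one_le_two_pow
        Nat.one_le_two_pow (A := φ ^ 2 * 4 ^ j) (by positivity) (by
          intro m hm
          rw [Finset.mem_Ico] at hm
          have h5 := h m (Nat.one_le_two_pow.trans hm.1) (by omega) (round (m * s))
          have hm2 : (m : ℝ) ≤ 2 * 2 ^ j := by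
            have : m ≤ 2 * 2 ^ j := by omega
            exact_mod_cast this
          have h7 : 1 ≤ φ * (2 * 2 ^ j) * |m * s - round (m * s)| :=
            h5.trans (mul_le_mul_of_nonneg_right (mul_le_mul_of_nonneg_left hm2 hφ.le)
              (abs_nonneg _))
          have h8 : 1 ≤ φ ^ 2 * 4 ^ j * (4 * (m * s - round (m * s)) ^ 2) := by
            calc (1 : ℝ) ≤ (φ * (2 * 2 ^ j) * |m * s - round (m * s)|) ^ 2 := one_le_pow₀ h7
              _ = _ := by
                rw [mul_pow, sq_abs, four_pow_eq]
                ring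
          have h9 := mul_le_mul_of_nonneg_left h8 (hf0 m)
          have h10 := mul_le_mul_of_nonneg_right (hf m)
            (by positivity : (0 : ℝ) ≤ φ ^ 2 * 4 ^ j)
          linarith)
      have e : 1 / (((2 ^ j : ℕ) : ℝ)) ^ 2 * (2 * (φ ^ 2 * 4 ^ j) + φ ^ 2 * ((2 ^ j : ℕ) : ℝ) ^ 2) =
          3 * φ ^ 2 := by
        push_cast
        rw [four_pow_eq]
        field_simp
        ring
      rw [e] at h3
      have := ih (by omega)
      push_cast
      linarith
  have large : ∀ Y : ℕ, ∑ m ∈ Finset.Ico (2 ^ J) ((Y + 1) * 2 ^ J), 1 / (m : ℝ) ^ 2 * f m ≤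
      (2 * A / 4 ^ J + φ ^ 2) * ∑ k ∈ Finset.range (Y + 1), 1 / (k : ℝ) ^ 2 := by
    intro Y
    induction Y with
    | zero => simp
    | succ Y ih =>
      rw [Finset.sum_range_succ, mul_add]
      rw [← Finset.sum_Ico_consecutive _ (Nat.le_mul_of_pos_left _ (Nat.succ_pos Y) : 2 ^ J ≤ (Y + 1) * 2 ^ J)
        (Nat.mul_le_mul_right _ (Nat.le_succ _) : (Y + 1) * 2 ^ J ≤ (Y + 1 + 1) * 2 ^ J)]
      refine add_le_add ih ?_
      have h2 : (Y + 1 + 1) * 2 ^ J = (Y + 1) * 2 ^ J + 2 ^ J := by ring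
      rw [h2]
      refine (h.sum_block_le hφ hf hf0 le_rfl Nat.one_le_two_pow
        (Nat.mul_pos (Nat.succ_pos _) (by positivity)) hA fun m _ => hfA m).trans (le_of_eq ?_)
      push_cast
      rw [four_pow_eq]
      field_simp
  have hX : X ≤ (X + 1) * 2 ^ J := by nlinarith [Nat.one_le_two_pow (n := J)]
  have h0 : ∀ m : ℕ, 0 ≤ 1 / (m : ℝ) ^ 2 * f m := fun m => mul_nonneg (by positivity) (hf0 m)
  calc ∑ m ∈ Finset.range X, 1 / (m : ℝ) ^ 2 * f m
      ≤ ∑ m ∈ Finset.range ((X + 1) * 2 ^ J), 1 / (m : ℝ) ^ 2 * f m :=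
        Finset.sum_le_sum_of_subset_of_nonneg (Finset.range_mono hX) fun m _ _ => h0 m
    _ = ∑ m ∈ Finset.Ico (1 : ℕ) (2 ^ J), 1 / (m : ℝ) ^ 2 * f m +
        ∑ m ∈ Finset.Ico (2 ^ J) ((X + 1) * 2 ^ J), 1 / (m : ℝ) ^ 2 * f m := by
      rw [Finset.sum_Ico_consecutive _ Nat.one_le_two_pow
        (Nat.le_mul_of_pos_left _ (Nat.succ_pos X)), Finset.range_eq_Ico,
        ← Finset.sum_Ico_consecutive _ zero_le_one (by nlinarith [Nat.one_le_two_pow (n := J)] :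
          1 ≤ (X + 1) * 2 ^ J)]
      simp
    _ ≤ 3 * J * φ ^ 2 + (2 * A / 4 ^ J + φ ^ 2) * 2 :=
      add_le_add (small J le_rfl) ((large X).trans
        (mul_le_mul_of_nonneg_left (sum_inv_sq_le_two _) (by positivity)))
    _ = _ := by ring

theorem IsBadlyApprox.integral_saw_sum_sq_le {φ s : ℝ} {J : ℕ} (h : IsBadlyApprox φ (2 ^ J) s)
    (hφ : 0 < φ) (a : ℤ) (L : ℕ) (t : ℝ) :
    ∫ b in (0 : ℝ)..1, (∑ i ∈ Finset.range L, saw (s * (a + i : ℤ) + t + b)) ^ 2 ≤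
      3 * J * φ ^ 2 + 4 * (L : ℝ) ^ 2 / 4 ^ J + 2 * φ ^ 2 := by
  have hs := integral_saw_sum_sq (s := s) a L t
  rw [← hs.tsum_eq]
  refine Real.tsum_le_of_sum_range_le (fun m => by positivity) fun X => ?_
  let f : ℕ → ℝ := fun m =>
    (∑ i ∈ Finset.range L, Real.cos (2 * Real.pi * m * s * (a + i : ℤ))) ^ 2 +
        (∑ i ∈ Finset.range L, Real.sin (2 * Real.pi * m * s * (a + i : ℤ))) ^ 2
  have hf0 : ∀ m, 0 ≤ f m := fun m => by positivity
  have hf : ∀ m, f m * (4 * (m * s - round (m * s)) ^ 2) ≤ 1 := fun m => by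
    have h1 := geometric_trig_bound (2 * Real.pi * m * s) a L
    have h2 := four_mul_sq_le_sin_sq (m * s)
    rw [show 2 * Real.pi * m * s / 2 = Real.pi * (m * s) by ring] at h1
    refine le_trans ?_ h1
    rw [mul_comm]
    exact mul_le_mul_of_nonneg_right h2 (hf0 m)
  have hfA : ∀ m, f m ≤ (L : ℝ) ^ 2 := fun m => by
    have hc : ∀ x : ℝ, (∑ i ∈ Finset.range L, Real.cos (x * (a + i : ℤ))) ^ 2 ≤
        L * ∑ i ∈ Finset.range L, Real.cos (x * (a + i : ℤ)) ^ 2 := fun x => by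
      simpa using sq_sum_le_card_mul_sum_sq (s := Finset.range L)
        (f := fun i : ℕ => Real.cos (x * (a + i : ℤ)))
    have hsn : ∀ x : ℝ, (∑ i ∈ Finset.range L, Real.sin (x * (a + i : ℤ))) ^ 2 ≤
        L * ∑ i ∈ Finset.range L, Real.sin (x * (a + i : ℤ)) ^ 2 := fun x => by
      simpa using sq_sum_le_card_mul_sum_sq (s := Finset.range L)
        (f := fun i : ℕ => Real.sin (x * (a + i : ℤ)))
    refine (add_le_add (hc _) (hsn _)).trans (le_of_eq ?_)
    rw [← mul_add, ← Finset.sum_add_distrib]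
    simp only [Real.cos_sq_add_sin_sq]
    simp [sq]
  refine le_trans ?_ (h.sum_le hφ hf hf0 hfA X)
  refine Finset.sum_le_sum fun m _ => ?_
  refine mul_le_of_le_one_left (mul_nonneg (by positivity) (hf0 m)) ?_
  rw [div_le_one (by positivity)]
  nlinarith [Real.pi_gt_three]

theorem exists_range_of_ordConnected (T : Finset ℤ)
    (hT : ∀ x ∈ T, ∀ z ∈ T, ∀ y, x ≤ y → y ≤ z → y ∈ T) :
    ∃ a : ℤ, (∀ n, n ∈ T ↔ a ≤ n ∧ n < a + T.card) ∧
      ∀ f : ℤ → ℝ, ∑ n ∈ T, f n = ∑ i ∈ Finset.range T.card, f (a + i) := by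
  rcases T.eq_empty_or_nonempty with rfl | hne
  · exact ⟨0, fun n => by simp, fun f => by simp⟩
  have hIcc : T = Finset.Icc (T.min' hne) (T.max' hne) := by
    ext n
    rw [Finset.mem_Icc]
    exact ⟨fun h => ⟨T.min'_le n h, T.le_max' n h⟩,
      fun h => hT _ (T.min'_mem hne) _ (T.max'_mem hne) n h.1 h.2⟩
  generalize T.min' hne = a at hIcc
  generalize T.max' hne = b at hIcc
  have hab : a ≤ b := by
    rw [hIcc] at hne
    exact Finset.nonempty_Icc.1 hne
  have hcard : (T.card : ℤ) = b + 1 - a := by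
    rw [hIcc, Int.card_Icc, Int.toNat_of_nonneg (by omega)]
  refine ⟨a, fun n => ?_, fun f => ?_⟩
  · rw [hcard, hIcc, Finset.mem_Icc]; omega
  · have : T = (Finset.range T.card).image fun i : ℕ => a + i := by
      ext n
      rw [Finset.mem_image]
      constructor
      · intro h
        rw [hIcc, Finset.mem_Icc] at h
        exact ⟨(n - a).toNat, Finset.mem_range.2 (by omega), by omega⟩
      · rintro ⟨i, hi, rfl⟩
        rw [Finset.mem_range] at hi
        rw [hIcc, Finset.mem_Icc]; omega
    conv_lhs => rw [this]
    rw [Finset.sum_image]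
    intro i _ j _ h
    simpa using h

section Trapezoid

variable {h : ℝ → ℝ}

theorem ConcaveOn.le_of_convexComb (hc : ConcaveOn ℝ Set.univ h) (x z : ℝ) {s t : ℝ} (hs : 0 ≤ s)
    (ht : 0 ≤ t) (hst : s + t = 1) : s * h x + t * h z ≤ h (s * x + t * z) := by
  simpa using hc.2 (Set.mem_univ x) (Set.mem_univ z) hs ht hst

theorem integral_affine_cell (c d a : ℝ) : ∫ x in a..(a + 1), (c + d * (x - a)) = c + d / 2 := by
  rw [intervalIntegral.integral_add intervalIntegrable_const (Continuous.intervalIntegrable (by fun_prop) _ _),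
    intervalIntegral.integral_const_mul, intervalIntegral.integral_sub
      (Continuous.intervalIntegrable (by fun_prop) _ _) intervalIntegrable_const, integral_id]
  simp
  ring

theorem ConcaveOn.trapezoid_le_integral (hc : ConcaveOn ℝ Set.univ h) (hcont : Continuous h)
    (a : ℝ) : (h a + h (a + 1)) / 2 ≤ ∫ x in a..(a + 1), h x := by
  have h1 := integral_affine_cell (h a) (h (a + 1) - h a) a
  calc (h a + h (a + 1)) / 2 = ∫ x in a..(a + 1), (h a + (h (a + 1) - h a) * (x - a)) := by
        rw [h1]; ring
    _ ≤ ∫ x in a..(a + 1), h x := by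
      refine intervalIntegral.integral_mono_on (by linarith)
        (Continuous.intervalIntegrable (by fun_prop) _ _) (hcont.intervalIntegrable _ _)
        fun x hx => ?_
      have := hc.le_of_convexComb a (a + 1) (s := 1 - (x - a)) (t := x - a) (by linarith [hx.2])
        (by linarith [hx.1]) (by ring)
      rw [show (1 - (x - a)) * a + (x - a) * (a + 1) = x by ring] at this
      linarith

theorem ConcaveOn.integral_le_trapezoid (hc : ConcaveOn ℝ Set.univ h) (hcont : Continuous h)
    (a : ℝ) : ∫ x in a..(a + 1), h x ≤
      (h a + h (a + 1)) / 2 + ((h a - h (a - 1)) - (h (a + 1) - h a)) / 2 := by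
  have h1 := integral_affine_cell (h a) (h a - h (a - 1)) a
  calc ∫ x in a..(a + 1), h x ≤ ∫ x in a..(a + 1), (h a + (h a - h (a - 1)) * (x - a)) := by
        refine intervalIntegral.integral_mono_on (by linarith) (hcont.intervalIntegrable _ _)
          (Continuous.intervalIntegrable (by fun_prop) _ _) fun x hx => ?_
        have hp : 0 < 1 + (x - a) := by linarith [hx.1]
        have := hc.le_of_convexComb (a - 1) x (s := (x - a) / (1 + (x - a)))
          (t := 1 / (1 + (x - a))) (div_nonneg (by linarith [hx.1]) hp.le) (by positivity)
          (by field_simp; ring)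
        rw [show (x - a) / (1 + (x - a)) * (a - 1) + 1 / (1 + (x - a)) * x = a by
          field_simp; ring] at this
        have h2 := mul_le_mul_of_nonneg_right this hp.le
        have h3 : ((x - a) / (1 + (x - a)) * h (a - 1) + 1 / (1 + (x - a)) * h x) *
            (1 + (x - a)) = (x - a) * h (a - 1) + h x := by field_simp
        rw [h3] at h2
        linarith
    _ = _ := by rw [h1]; ring

theorem ConcaveOn.trapezoid_sum (hc : ConcaveOn ℝ Set.univ h) (hcont : Continuous h)
    (a : ℝ) (q : ℕ) :
    (∑ i ∈ Finset.range (q + 1), h (a + i)) - (h a + h (a + q)) / 2 ≤ ∫ x in a..(a + q), h x ∧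
    ∫ x in a..(a + q), h x ≤ (∑ i ∈ Finset.range (q + 1), h (a + i)) - (h a + h (a + q)) / 2 +
      ((h a - h (a - 1)) - (h (a + q) - h (a + q - 1))) / 2 := by
  induction q with
  | zero => simp
  | succ q ih =>
    have h1 := hc.trapezoid_le_integral hcont (a + q)
    have h2 := hc.integral_le_trapezoid hcont (a + q)
    rw [← intervalIntegral.integral_add_adjacent_intervals (hcont.intervalIntegrable a (a + q))
      (hcont.intervalIntegrable (a + q) (a + (q + 1 : ℕ))), Finset.sum_range_succ]
    have e1 : a + ((q + 1 : ℕ) : ℝ) = a + q + 1 := by push_cast; ring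
    have e2 : a + (q : ℝ) + 1 - 1 = a + q := by ring
    rw [e1, e2]
    exact ⟨by linarith [ih.1], by linarith [ih.2]⟩

/-- The sum of a concave function over the integers at which it is nonnegative is close to the
integral of its positive part. -/
theorem ConcaveOn.abs_sum_sub_integral_le (hc : ConcaveOn ℝ Set.univ h) {K : ℝ}
    (hK : ∀ x y, |h x - h y| ≤ K * |x - y|) (T : Finset ℤ) (hT : ∀ n : ℤ, n ∈ T ↔ 0 ≤ h n) :
    |∑ n ∈ T, h n - ∫ x, max (h x) 0| ≤ 4 * K := by
  have hK0 : 0 ≤ K := by have := (abs_nonneg _).trans (hK 1 0); simpa using this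
  have hcont : Continuous h :=
    (LipschitzWith.of_dist_le_mul (K := ⟨K, hK0⟩) fun x y => by
      rw [Real.dist_eq, Real.dist_eq]; exact hK x y).continuous
  have hconv : {x | 0 ≤ h x}.OrdConnected := by
    simpa using (hc.convex_ge 0).ordConnected
  have out : ∀ u v x : ℝ, h u < 0 → 0 ≤ h v → (x ≤ u ∧ u ≤ v ∨ v ≤ u ∧ u ≤ x) → h x < 0 := by
    intro u v x hu hv hx
    by_contra hxn
    rcases hx with hx | hx
    · exact absurd (hconv.out (not_lt.1 hxn) hv ⟨hx.1, hx.2⟩ : 0 ≤ h u) (not_le.2 hu)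
    · exact absurd (hconv.out hv (not_lt.1 hxn) ⟨hx.1, hx.2⟩ : 0 ≤ h u) (not_le.2 hu)
  have cell : ∀ u v : ℝ, v = u + 1 → (h u < 0 ∨ h v < 0) →
      0 ≤ ∫ x in u..v, max (h x) 0 ∧ ∫ x in u..v, max (h x) 0 ≤ K := by
    rintro u v rfl huv
    refine ⟨intervalIntegral.integral_nonneg (by linarith) fun x _ => le_max_right _ _, ?_⟩
    calc ∫ x in u..(u + 1), max (h x) 0 ≤ ∫ x in u..(u + 1), K := by
          refine intervalIntegral.integral_mono_on (by linarith)
            ((hcont.max continuous_const).intervalIntegrable _ _) (by simp) fun x hx => ?_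
          refine max_le ?_ hK0
          rcases huv with hu | hu
          · have h1 := (le_abs_self _).trans (hK x u)
            rw [abs_of_nonneg (by linarith [hx.1])] at h1
            nlinarith [hx.2]
          · have h1 := (le_abs_self _).trans (hK x (u + 1))
            rw [abs_of_nonpos (by linarith [hx.2])] at h1
            nlinarith [hx.1]
      _ = K := by simp
  have supp : ∀ u v w : ℝ, h u < 0 → h v < 0 → 0 ≤ h w → u ≤ w → w ≤ v →
      ∫ x, max (h x) 0 = ∫ x in u..v, max (h x) 0 := by
    intro u v w hu hv hw huw hwv
    refine (intervalIntegral.integral_eq_integral_of_support_subset fun x hx => ?_).symm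
    have hx' : ¬ h x < 0 := fun hlt => hx (max_eq_right hlt.le)
    constructor
    · by_contra hc'
      exact hx' (out u w x hu hw (Or.inl ⟨not_lt.1 hc', huw⟩))
    · by_contra hc'
      exact hx' (out v w x hv hw (Or.inr ⟨hwv, (not_le.1 hc').le⟩))
  obtain ⟨a, ha, hsum⟩ := exists_range_of_ordConnected T fun x hx z hz y hxy hyz => by
    rw [hT] at hx hz ⊢
    exact hconv.out hx hz ⟨by exact_mod_cast hxy, by exact_mod_cast hyz⟩
  rw [hsum]
  rcases Nat.eq_zero_or_pos T.card with h0 | hpos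
  · rw [h0]
    have hempty : ∀ n : ℤ, h n < 0 := fun n => by
      by_contra hn
      have := (hT n).2 (not_lt.1 hn)
      rw [Finset.card_eq_zero.1 h0] at this
      simp at this
    simp only [Finset.range_zero, Finset.sum_empty, zero_sub, abs_neg]
    by_cases hex : ∃ w, 0 ≤ h w
    · obtain ⟨w, hw⟩ := hex
      rw [supp ⌊w⌋ (⌊w⌋ + 1) w (hempty _) (by exact_mod_cast hempty (⌊w⌋ + 1)) hw
        (Int.floor_le w) (Int.lt_floor_add_one w).le]
      have := cell ⌊w⌋ (⌊w⌋ + 1) rfl (Or.inl (hempty _))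
      rw [abs_of_nonneg this.1]
      linarith
    · push Not at hex
      have : (fun x => max (h x) 0) = fun _ => 0 := funext fun x => max_eq_right (hex x).le
      rw [this]
      simp [hK0]
  · obtain ⟨q, hq⟩ := Nat.exists_eq_succ_of_ne_zero hpos.ne'
    rw [hq] at ha ⊢
    have hA : 0 ≤ h a := (hT a).1 ((ha a).2 ⟨le_rfl, by omega⟩)
    have hB : 0 ≤ h (a + q) := by
      have := (hT (a + q)).1 ((ha _).2 ⟨by omega, by push_cast; omega⟩)
      exact_mod_cast this
    have hA' : h (a - 1) < 0 := by
      by_contra hn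
      have := ((ha _).1 ((hT (a - 1)).2 (by push_cast; exact not_lt.1 hn))).1
      omega
    have hB' : h (a + q + 1) < 0 := by
      by_contra hn
      have := ((ha _).1 ((hT (a + q + 1)).2 (by push_cast; exact not_lt.1 hn))).2
      push_cast at this
      omega
    have hq0 : (0 : ℝ) ≤ q := Nat.cast_nonneg q
    rw [supp (a - 1) (a + q + 1) a hA' hB' hA (by linarith) (by linarith)]
    have hint : ∀ u v : ℝ, IntervalIntegrable (fun x => max (h x) 0) volume u v := fun u v =>
      (hcont.max continuous_const).intervalIntegrable _ _
    rw [← intervalIntegral.integral_add_adjacent_intervals (hint (a - 1) a) (hint a (a + q + 1)),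
      ← intervalIntegral.integral_add_adjacent_intervals (hint a (a + q)) (hint (a + q) (a + q + 1))]
    have hmid : ∫ x in (a : ℝ)..(a + q), max (h x) 0 = ∫ x in (a : ℝ)..(a + q), h x := by
      refine intervalIntegral.integral_congr fun x hx => ?_
      rw [Set.uIcc_of_le (by linarith)] at hx
      exact max_eq_left (hconv.out hA hB hx)
    rw [hmid]
    have c1 := cell (a - 1) a (by ring) (Or.inl hA')
    have c2 := cell (a + q) (a + q + 1) rfl (Or.inr hB')
    have ht := hc.trapezoid_sum hcont a q
    have l1 := abs_le.1 (hK a (a - 1))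
    have l2 := abs_le.1 (hK (a + q) (a + q - 1))
    have l3 := abs_le.1 (hK (a + q) (a + q + 1))
    rw [show (a : ℝ) - (a - 1) = 1 by ring, abs_one] at l1
    rw [show (a : ℝ) + q - (a + q - 1) = 1 by ring, abs_one] at l2
    rw [show (a : ℝ) + q - (a + q + 1) = -1 by ring, abs_neg, abs_one] at l3
    have es : ∑ i ∈ Finset.range (q + 1), h ((a + i : ℤ) : ℝ) =
        ∑ i ∈ Finset.range (q + 1), h (a + i) := by push_cast; rfl
    rw [Nat.succ_eq_add_one, es]
    rw [abs_le]
    constructor <;> linarith [ht.1, ht.2, c1.1, c1.2, c2.1, c2.2]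

end Trapezoid

/-- The lower envelope of the lines `y = s i * x + t i`, `i ∈ U`. -/
noncomputable def lowerEnvelope {ι : Type*} (U : Finset ι) (hU : U.Nonempty) (s t : ι → ℝ)
    (x : ℝ) : ℝ :=
  U.inf' hU fun i => s i * x + t i

section LowerEnvelope

variable {ι : Type*} {U : Finset ι} {hU : U.Nonempty} {s t : ι → ℝ}

theorem le_lowerEnvelope_iff {x y : ℝ} :
    y ≤ lowerEnvelope U hU s t x ↔ ∀ i ∈ U, y ≤ s i * x + t i :=
  Finset.le_inf'_iff hU _

theorem lowerEnvelope_le {i : ι} (hi : i ∈ U) (x : ℝ) :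
    lowerEnvelope U hU s t x ≤ s i * x + t i :=
  Finset.inf'_le _ hi

theorem exists_lowerEnvelope_eq (U : Finset ι) (hU : U.Nonempty) (s t : ι → ℝ) (x : ℝ) :
    ∃ i ∈ U, lowerEnvelope U hU s t x = s i * x + t i :=
  Finset.exists_mem_eq_inf' hU _

theorem concaveOn_lowerEnvelope : ConcaveOn ℝ Set.univ (lowerEnvelope U hU s t) := by
  refine ⟨convex_univ, fun x _ z _ a b ha hb hab => ?_⟩
  rw [le_lowerEnvelope_iff]
  intro i hi
  have h1 := mul_le_mul_of_nonneg_left (lowerEnvelope_le (hU := hU) (s := s) (t := t) hi x) ha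
  have h2 := mul_le_mul_of_nonneg_left (lowerEnvelope_le (hU := hU) (s := s) (t := t) hi z) hb
  simp only [smul_eq_mul]
  have e : s i * (a * x + b * z) + t i = a * (s i * x + t i) + b * (s i * z + t i) := by
    linear_combination (-t i) * hab
  rw [e]
  exact add_le_add h1 h2

theorem lowerEnvelope_lipschitz {S : ℝ} (hS : ∀ i ∈ U, |s i| ≤ S) (x y : ℝ) :
    |lowerEnvelope U hU s t x - lowerEnvelope U hU s t y| ≤ S * |x - y| := by
  have key : ∀ x y : ℝ, lowerEnvelope U hU s t x ≤ lowerEnvelope U hU s t y + S * |x - y| := by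
    intro x y
    obtain ⟨i, hi, he⟩ := exists_lowerEnvelope_eq U hU s t y
    have h1 := lowerEnvelope_le (hU := hU) (s := s) (t := t) hi x
    have h2 : s i * (x - y) ≤ S * |x - y| := (le_abs_self _).trans (by
      rw [abs_mul]; exact mul_le_mul_of_nonneg_right (hS i hi) (abs_nonneg _))
    rw [he]
    linarith
  have h1 := key x y
  have h2 := key y x
  rw [abs_sub_comm y x] at h2
  exact abs_le.2 ⟨by linarith, by linarith⟩

theorem intervalIntegrable_sum_saw_sq {κ : Type*} (T : Finset κ) (g : κ → ℝ) (a b : ℝ) :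
    IntervalIntegrable (fun x => (∑ n ∈ T, saw (g n + x)) ^ 2) volume a b := by
  refine intervalIntegrable_of_measurable_of_abs_le (K := (T.card * (1 / 2)) ^ 2)
    ((Finset.measurable_sum _ fun n _ =>
      measurable_saw.comp (measurable_const_add (g n))).pow_const 2) (fun x => ?_) a b
  rw [abs_pow]
  refine pow_le_pow_left₀ (abs_nonneg _) ((Finset.abs_sum_le_sum_abs _ _).trans ?_) 2
  simpa using Finset.sum_le_card_nsmul T _ _ fun n _ => abs_saw_le (g n + x)

theorem integral_sum_saw_lowerEnvelope_sq_le [LinearOrder ι] {φ : ℝ} {J L : ℕ} (hφ : 0 < φ)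
    (hs : ∀ i ∈ U, IsBadlyApprox φ (2 ^ J) (s i)) (T : Finset ℤ)
    (hT : ∀ x ∈ T, ∀ z ∈ T, ∀ y, x ≤ y → y ≤ z → y ∈ T) (hL : T.card ≤ L) :
    ∫ b in (0 : ℝ)..1, (∑ n ∈ T, saw (lowerEnvelope U hU s t n + b)) ^ 2 ≤
      (U.card : ℝ) ^ 2 * (3 * J * φ ^ 2 + 4 * (L : ℝ) ^ 2 / 4 ^ J + 2 * φ ^ 2) := by
  classical
  set W := 3 * J * φ ^ 2 + 4 * (L : ℝ) ^ 2 / 4 ^ J + 2 * φ ^ 2 with hW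
  let P : ι → ℤ → Prop := fun i n => i ∈ U ∧
    ∀ j ∈ U, s i * n + t i ≤ s j * n + t j ∧ (j < i → s i * n + t i < s j * n + t j)
  have hex : ∀ n : ℤ, ∃ i ∈ U, P i n := by
    intro n
    obtain ⟨i₀, hi₀, he⟩ := exists_lowerEnvelope_eq U hU s t n
    have hne : (U.filter fun i => ∀ j ∈ U, s i * n + t i ≤ s j * n + t j).Nonempty :=
      ⟨i₀, Finset.mem_filter.2 ⟨hi₀, fun j hj => he ▸ lowerEnvelope_le hj _⟩⟩
    have hm := Finset.min'_mem _ hne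
    rw [Finset.mem_filter] at hm
    refine ⟨_, hm.1, hm.1, fun j hj => ⟨hm.2 j hj, fun hlt => ?_⟩⟩
    by_contra hge
    refine absurd (Finset.min'_le _ j (Finset.mem_filter.2 ⟨hj, fun l hl => ?_⟩)) (not_le.2 hlt)
    exact (not_lt.1 hge).trans (hm.2 l hl)
  have huniq : ∀ n i j, P i n → P j n → i = j := by
    intro n i j hi hj
    rcases lt_trichotomy i j with h | h | h
    · exact absurd ((hj.2 i hi.1).2 h) (not_lt.2 (hi.2 j hj.1).1)
    · exact h
    · exact absurd ((hi.2 j hj.1).2 h) (not_lt.2 (hj.2 i hi.1).1)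
  have hval : ∀ n i, P i n → lowerEnvelope U hU s t n = s i * n + t i := fun n i h =>
    le_antisymm (lowerEnvelope_le h.1 _) (le_lowerEnvelope_iff.2 fun j hj => (h.2 j hj).1)
  have hdecomp : ∀ b : ℝ, ∑ n ∈ T, saw (lowerEnvelope U hU s t n + b) =
      ∑ i ∈ U, ∑ n ∈ T.filter (P i), saw (s i * n + t i + b) := by
    intro b
    simp only [Finset.sum_filter]
    rw [Finset.sum_comm]
    refine Finset.sum_congr rfl fun n _ => ?_
    obtain ⟨i, hi, hPi⟩ := hex n
    rw [Finset.sum_eq_single i, if_pos hPi, hval n i hPi]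
    · intro j _ hne
      exact if_neg fun hPj => hne (huniq n j i hPj hPi)
    · exact fun h => absurd hi h
  have hconv : ∀ i, ∀ x ∈ T.filter (P i), ∀ z ∈ T.filter (P i), ∀ y, x ≤ y → y ≤ z →
      y ∈ T.filter (P i) := by
    intro i x hx z hz y hxy hyz
    rw [Finset.mem_filter] at hx hz ⊢
    have hx' : (x : ℝ) ≤ y := by exact_mod_cast hxy
    have hz' : (y : ℝ) ≤ z := by exact_mod_cast hyz
    refine ⟨hT x hx.1 z hz.1 y hxy hyz, hx.2.1, fun j hj => ?_⟩
    obtain ⟨h1, h1'⟩ := hx.2.2 j hj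
    obtain ⟨h2, h2'⟩ := hz.2.2 j hj
    rcases le_total (s i) (s j) with hij | hij
    · have := mul_le_mul_of_nonneg_left hx' (sub_nonneg.2 hij)
      exact ⟨by linarith, fun hlt => by linarith [h1' hlt]⟩
    · have := mul_le_mul_of_nonneg_left hz' (sub_nonneg.2 hij)
      exact ⟨by linarith, fun hlt => by linarith [h2' hlt]⟩
  have hpiece : ∀ i ∈ U,
      ∫ b in (0 : ℝ)..1, (∑ n ∈ T.filter (P i), saw (s i * n + t i + b)) ^ 2 ≤ W := by
    intro i hi
    obtain ⟨a, -, hsum⟩ := exists_range_of_ordConnected _ (hconv i)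
    have h1 := (hs i hi).integral_saw_sum_sq_le hφ a (T.filter (P i)).card (t i)
    simp only [hsum]
    refine h1.trans ?_
    have : ((T.filter (P i)).card : ℝ) ≤ L := by
      exact_mod_cast (Finset.card_filter_le _ _).trans hL
    rw [hW]
    gcongr
  have hint : ∀ i ∈ U, IntervalIntegrable
      (fun b => (∑ n ∈ T.filter (P i), saw (s i * n + t i + b)) ^ 2) volume 0 1 := fun i _ =>
    intervalIntegrable_sum_saw_sq _ (fun n : ℤ => s i * n + t i) _ _
  calc ∫ b in (0 : ℝ)..1, (∑ n ∈ T, saw (lowerEnvelope U hU s t n + b)) ^ 2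
      ≤ ∫ b in (0 : ℝ)..1,
        U.card * ∑ i ∈ U, (∑ n ∈ T.filter (P i), saw (s i * n + t i + b)) ^ 2 := by
        refine intervalIntegral.integral_mono_on zero_le_one
          (intervalIntegrable_sum_saw_sq T (fun n : ℤ => lowerEnvelope U hU s t n) _ _) ?_
          fun b _ => ?_
        · have := (IntervalIntegrable.sum U hint).const_mul (U.card : ℝ)
          simpa only [Finset.sum_fn] using this
        · rw [hdecomp]
          exact sq_sum_le_card_mul_sum_sq
    _ = U.card * ∑ i ∈ U,
        ∫ b in (0 : ℝ)..1, (∑ n ∈ T.filter (P i), saw (s i * n + t i + b)) ^ 2 := by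
        rw [intervalIntegral.integral_const_mul, intervalIntegral.integral_finsetSum hint]
    _ ≤ U.card * (U.card * W) := by
        refine mul_le_mul_of_nonneg_left ?_ (Nat.cast_nonneg _)
        rw [← nsmul_eq_mul]
        exact Finset.sum_le_card_nsmul _ _ _ hpiece
    _ = (U.card : ℝ) ^ 2 * W := by ring

end LowerEnvelope

theorem IsBadlyApprox.neg {φ s : ℝ} {H : ℕ} (h : IsBadlyApprox φ H s) : IsBadlyApprox φ H (-s) :=
  fun q h1 h2 p => by
    have := h q h1 h2 (-p)
    rw [← abs_neg] at this
    convert this using 3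
    push_cast
    ring

theorem integral_sum_saw_sub_sq {κ : Type*} (T : Finset κ) (g : κ → ℝ) :
    ∫ b in (0 : ℝ)..1, (∑ n ∈ T, saw (g n - b)) ^ 2 =
      ∫ b in (0 : ℝ)..1, (∑ n ∈ T, saw (g n + b)) ^ 2 := by
  have hper : Function.Periodic (fun b => (∑ n ∈ T, saw (g n + b)) ^ 2) 1 := fun b => by
    have h := fun z : ℝ => saw_add_int z 1
    push_cast at h
    simp only [← add_assoc, h]
  have h1 := hper.intervalIntegral_add_eq (-1) 0
  rw [neg_add_cancel, zero_add] at h1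
  rw [← h1]
  have := intervalIntegral.integral_comp_neg (a := 0) (b := 1)
    (fun b => (∑ n ∈ T, saw (g n + b)) ^ 2)
  rw [neg_zero] at this
  rw [← this]
  simp only [sub_eq_add_neg]

/-- The intersection of the half-planes `v i ⬝ p ≤ c i`. -/
def halfPlanes {ι : Type*} (v : ι → ℝ × ℝ) (c : ι → ℝ) : Set (ℝ × ℝ) :=
  {p | ∀ i, (v i).1 * p.1 + (v i).2 * p.2 ≤ c i}

theorem isClosed_halfPlanes {ι : Type*} (v : ι → ℝ × ℝ) (c : ι → ℝ) :
    IsClosed (halfPlanes v c) := by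
  simp only [halfPlanes, Set.ofPred_forall]
  exact isClosed_iInter fun i => isClosed_le (by fun_prop) continuous_const

theorem floor_sub_add_floor_add (f g b : ℝ) :
    ((⌊f - b⌋ + ⌊g + b⌋ + 1 : ℤ) : ℝ) = f + g + (saw (f - b) + saw (g + b)) := by
  push_cast
  rw [saw, saw, Int.fract, Int.fract]
  ring

/-- The column structure of a bounded polygon without vertical sides: it lies below the envelope
`f` and above the envelope `-g`. -/
theorem exists_envelopes {k : ℕ} {v : Fin k → ℝ × ℝ} {c : Fin k → ℝ} {R : ℝ}
    (hv : ∀ i, (v i).2 ≠ 0) (hne : (halfPlanes v c).Nonempty)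
    (hR : ∀ p ∈ halfPlanes v c, |p.1| ≤ R ∧ |p.2| ≤ R) :
    ∃ (U V : Finset (Fin k)) (hU : U.Nonempty) (hV : V.Nonempty), ∀ x y : ℝ,
      (x, y) ∈ halfPlanes v c ↔
        y ≤ lowerEnvelope U hU (fun i => -((v i).1 / (v i).2)) (fun i => c i / (v i).2) x ∧
        -y ≤ lowerEnvelope V hV (fun i => (v i).1 / (v i).2) (fun i => -(c i / (v i).2)) x := by
  obtain ⟨p, hp⟩ := hne
  have hpos : ∀ i, 0 < (v i).2 → ∀ x y : ℝ, (v i).1 * x + (v i).2 * y ≤ c i ↔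
      y ≤ -((v i).1 / (v i).2) * x + c i / (v i).2 := fun i hi x y => by
    rw [show -((v i).1 / (v i).2) * x + c i / (v i).2 = (c i - (v i).1 * x) / (v i).2 by
      field_simp; ring, le_div_iff₀ hi]
    constructor <;> intro h <;> linarith
  have hneg : ∀ i, (v i).2 < 0 → ∀ x y : ℝ, (v i).1 * x + (v i).2 * y ≤ c i ↔
      -y ≤ (v i).1 / (v i).2 * x + -(c i / (v i).2) := fun i hi x y => by
    rw [show (v i).1 / (v i).2 * x + -(c i / (v i).2) = ((v i).1 * x - c i) / (v i).2 by
      field_simp; ring, le_div_iff_of_neg hi]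
    constructor <;> intro h <;> linarith
  have hU : (Finset.univ.filter fun i => 0 < (v i).2).Nonempty := by
    by_contra hempty
    rw [Finset.not_nonempty_iff_eq_empty, Finset.filter_eq_empty_iff] at hempty
    have hmem : (p.1, p.2 + (2 * |R| + 1)) ∈ halfPlanes v c := fun i => by
      have h1 := hp i
      have h2 : (v i).2 ≤ 0 := not_lt.1 (hempty (Finset.mem_univ i))
      have : (v i).2 * (2 * |R| + 1) ≤ 0 := mul_nonpos_of_nonpos_of_nonneg h2 (by positivity)
      simp only
      linarith
    have h1 := abs_le.1 (hR p hp).2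
    have h2 := abs_le.1 (hR _ hmem).2
    simp only at h2
    linarith [le_abs_self R]
  have hV : (Finset.univ.filter fun i => (v i).2 < 0).Nonempty := by
    by_contra hempty
    rw [Finset.not_nonempty_iff_eq_empty, Finset.filter_eq_empty_iff] at hempty
    have hmem : (p.1, p.2 - (2 * |R| + 1)) ∈ halfPlanes v c := fun i => by
      have h1 := hp i
      have h2 : 0 ≤ (v i).2 := not_lt.1 (hempty (Finset.mem_univ i))
      have : 0 ≤ (v i).2 * (2 * |R| + 1) := mul_nonneg h2 (by positivity)
      simp only
      linarith
    have h1 := abs_le.1 (hR p hp).2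
    have h2 := abs_le.1 (hR _ hmem).2
    simp only at h2
    linarith [le_abs_self R]
  refine ⟨_, _, hU, hV, fun x y => ?_⟩
  rw [le_lowerEnvelope_iff, le_lowerEnvelope_iff]
  simp only [Finset.mem_filter, Finset.mem_univ, true_and]
  constructor
  · exact fun h => ⟨fun i hi => (hpos i hi x y).1 (h i), fun i hi => (hneg i hi x y).1 (h i)⟩
  · intro h i
    rcases lt_or_gt_of_ne (hv i) with hi | hi
    · exact (hneg i hi x y).2 (h.2 i hi)
    · exact (hpos i hi x y).2 (h.1 i hi)

/-- The number of points of the lattice `ℤ × (ℤ + b)` in `B`. -/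
noncomputable def latticeCount (B : Set (ℝ × ℝ)) (b : ℝ) : ℝ :=
  ({q : ℤ × ℤ | ((q.1 : ℝ), (q.2 : ℝ) + b) ∈ B}.ncard : ℝ)

theorem latticeCount_eq {B : Set (ℝ × ℝ)} {f g : ℝ → ℝ}
    (hB : ∀ x y : ℝ, (x, y) ∈ B ↔ y ≤ f x ∧ -y ≤ g x) (T : Finset ℤ)
    (hT : ∀ n : ℤ, n ∈ T ↔ 0 ≤ f n + g n) (b : ℝ) :
    latticeCount B b =
      ∑ n ∈ T, (f n + g n) + (∑ n ∈ T, saw (f n - b) + ∑ n ∈ T, saw (g n + b)) := by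
  have hset : {q : ℤ × ℤ | ((q.1 : ℝ), (q.2 : ℝ) + b) ∈ B} =
      ((T.sigma fun n => Finset.Icc (-⌊g n + b⌋) ⌊f n - b⌋).map
        (Equiv.sigmaEquivProd ℤ ℤ).toEmbedding : Finset (ℤ × ℤ)) := by
    ext ⟨n, m⟩
    simp only [Set.mem_ofPred_eq, hB, Finset.coe_map, Set.mem_image, Finset.mem_coe,
      Finset.mem_sigma, Finset.mem_Icc, Equiv.coe_toEmbedding]
    have h1 : (m : ℝ) + b ≤ f n ↔ m ≤ ⌊f n - b⌋ := by
      rw [Int.le_floor]; constructor <;> intro h <;> linarith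
    have h2 : -((m : ℝ) + b) ≤ g n ↔ -⌊g n + b⌋ ≤ m := by
      have e : -⌊g n + b⌋ ≤ m ↔ -m ≤ ⌊g n + b⌋ := neg_le
      rw [e, Int.le_floor]; push_cast; constructor <;> intro h <;> linarith
    constructor
    · intro h
      exact ⟨⟨n, m⟩, ⟨(hT n).2 (by linarith [h.1, h.2]), h2.1 h.2, h1.1 h.1⟩, rfl⟩
    · rintro ⟨⟨n', m'⟩, ⟨-, ha, hb⟩, he⟩
      obtain ⟨rfl, rfl⟩ := Prod.mk.inj he
      exact ⟨h1.2 hb, h2.2 ha⟩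
  rw [latticeCount, hset, Set.ncard_coe_finset, Finset.card_map, Finset.card_sigma]
  push_cast
  rw [← Finset.sum_add_distrib, ← Finset.sum_add_distrib]
  refine Finset.sum_congr rfl fun n hn => ?_
  rw [← floor_sub_add_floor_add, Int.card_Icc]
  have h0 : 0 ≤ ⌊f n - b⌋ + 1 - -⌊g n + b⌋ := by
    have h1 := Int.lt_floor_add_one (f n - b)
    have h2 := Int.lt_floor_add_one (g n + b)
    have h3 : (-1 : ℝ) < (⌊f n - b⌋ + 1 - -⌊g n + b⌋ : ℤ) := by
      push_cast
      linarith [(hT n).1 hn]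
    have h4 : (-1 : ℤ) < ⌊f n - b⌋ + 1 - -⌊g n + b⌋ := by exact_mod_cast h3
    omega
  have h5 : ((⌊f n - b⌋ + 1 - -⌊g n + b⌋).toNat : ℤ) = ⌊f n - b⌋ + ⌊g n + b⌋ + 1 := by
    rw [Int.toNat_of_nonneg h0]; ring
  exact_mod_cast h5

theorem volume_toReal_eq_integral {B : Set (ℝ × ℝ)} (hmeas : MeasurableSet B) {f g : ℝ → ℝ}
    (hf : Continuous f) (hg : Continuous g)
    (hB : ∀ x y : ℝ, (x, y) ∈ B ↔ y ≤ f x ∧ -y ≤ g x) :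
    (volume B).toReal = ∫ x, max (f x + g x) 0 := by
  rw [integral_eq_lintegral_of_nonneg_ae (f := fun x => max (f x + g x) 0) (Filter.Eventually.of_forall fun x => le_max_right _ _)
    (((hf.add hg).max continuous_const).aestronglyMeasurable), Measure.volume_eq_prod,
    Measure.prod_apply hmeas]
  congr 1
  refine lintegral_congr fun x => ?_
  have : Prod.mk x ⁻¹' B = Set.Icc (-g x) (f x) := by
    ext y
    rw [Set.mem_preimage, hB, Set.mem_Icc, neg_le, and_comm]
  rw [this, Real.volume_Icc, sub_neg_eq_add]
  rcases le_total 0 (f x + g x) with h | h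
  · rw [max_eq_left h]
  · rw [max_eq_right h, ENNReal.ofReal_of_nonpos h, ENNReal.ofReal_zero]

theorem lintegral_latticeCount_sub_sq_le {k : ℕ} {v : Fin k → ℝ × ℝ} {c : Fin k → ℝ}
    {R S φ : ℝ} {J : ℕ} (hR0 : 0 ≤ R) (hv : ∀ i, (v i).2 ≠ 0)
    (hS : ∀ i, |(v i).1 / (v i).2| ≤ S) (hφ : 0 < φ)
    (hφs : ∀ i, IsBadlyApprox φ (2 ^ J) ((v i).1 / (v i).2)) (hne : (halfPlanes v c).Nonempty)
    (hR : ∀ p ∈ halfPlanes v c, |p.1| ≤ R ∧ |p.2| ≤ R) :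
    ∫⁻ b in Set.Ioc (0 : ℝ) 1, ENNReal.ofReal
      ((latticeCount (halfPlanes v c) b - (volume (halfPlanes v c)).toReal) ^ 2) ≤
      ENNReal.ofReal (192 * S ^ 2 +
        6 * k ^ 2 * (3 * J * φ ^ 2 + 4 * (2 * R + 1) ^ 2 / 4 ^ J + 2 * φ ^ 2)) := by
  classical
  obtain ⟨U, V, hU, hV, hB⟩ := exists_envelopes hv hne hR
  set f := lowerEnvelope U hU (fun i => -((v i).1 / (v i).2)) (fun i => c i / (v i).2) with hf
  set g := lowerEnvelope V hV (fun i => (v i).1 / (v i).2) (fun i => -(c i / (v i).2)) with hg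
  have hlf : ∀ x y, |f x - f y| ≤ S * |x - y| :=
    lowerEnvelope_lipschitz fun i _ => by rw [abs_neg]; exact hS i
  have hlg : ∀ x y, |g x - g y| ≤ S * |x - y| := lowerEnvelope_lipschitz fun i _ => hS i
  have hS0 : 0 ≤ S := by have := (abs_nonneg _).trans (hlf 1 0); simpa using this
  have cont : ∀ w : ℝ → ℝ, (∀ x y, |w x - w y| ≤ S * |x - y|) → Continuous w := fun w hw =>
    (LipschitzWith.of_dist_le_mul (K := ⟨S, hS0⟩) fun x y => by
      rw [Real.dist_eq, Real.dist_eq]; exact hw x y).continuous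
  have hconc : ConcaveOn ℝ Set.univ fun x => f x + g x :=
    concaveOn_lowerEnvelope.add concaveOn_lowerEnvelope
  let T : Finset ℤ := (Finset.Icc (-⌈R⌉) ⌈R⌉).filter fun n => 0 ≤ f n + g n
  have habs : ∀ n : ℤ, 0 ≤ f n + g n → |(n : ℝ)| ≤ R := fun n hn =>
    (hR (n, f n) ((hB _ _).2 ⟨le_rfl, by linarith⟩)).1
  have hT : ∀ n : ℤ, n ∈ T ↔ 0 ≤ f n + g n := fun n => by
    rw [Finset.mem_filter, Finset.mem_Icc, and_iff_right_iff_imp]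
    intro hn
    have h1 := abs_le.1 (habs n hn)
    have h2 := Int.le_ceil R
    exact ⟨by exact_mod_cast (by linarith : (-(⌈R⌉ : ℝ)) ≤ n),
      by exact_mod_cast (by linarith : (n : ℝ) ≤ ⌈R⌉)⟩
  have hTconn : ∀ x ∈ T, ∀ z ∈ T, ∀ y, x ≤ y → y ≤ z → y ∈ T := fun x hx z hz y hxy hyz => by
    rw [hT] at hx hz ⊢
    have : {x | (0 : ℝ) ≤ f x + g x}.OrdConnected := by simpa using (hconc.convex_ge 0).ordConnected
    exact this.out hx hz ⟨by exact_mod_cast hxy, by exact_mod_cast hyz⟩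
  have hcard : (T.card : ℝ) ≤ 2 * R + 1 := by
    obtain ⟨a, ha, -⟩ := exists_range_of_ordConnected T hTconn
    rcases Nat.eq_zero_or_pos T.card with h0 | hpos
    · rw [h0]; push_cast; linarith
    · have h1 := abs_le.1 (habs _ ((hT a).1 ((ha a).2 ⟨le_rfl, by omega⟩)))
      have h2 := abs_le.1 (habs _ ((hT (a + T.card - 1)).1 ((ha _).2 ⟨by omega, by omega⟩)))
      push_cast at h2
      linarith
  set E := ∑ n ∈ T, (f n + g n) - (volume (halfPlanes v c)).toReal with hE
  have hE8 : |E| ≤ 4 * (2 * S) := by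
    rw [hE, volume_toReal_eq_integral (isClosed_halfPlanes v c).measurableSet (cont f hlf)
      (cont g hlg) hB]
    refine hconc.abs_sum_sub_integral_le (fun x y => ?_) T hT
    have := abs_add_le (f x - f y) (g x - g y)
    rw [show f x + g x - (f y + g y) = f x - f y + (g x - g y) by ring]
    linarith [hlf x y, hlg x y]
  set W := 3 * J * φ ^ 2 + 4 * (2 * R + 1) ^ 2 / 4 ^ J + 2 * φ ^ 2 with hW
  have hW0 : 0 ≤ W := by positivity
  have hWle : ∀ X : Finset (Fin k), (X.card : ℝ) ^ 2 *
      (3 * J * φ ^ 2 + 4 * (T.card : ℝ) ^ 2 / 4 ^ J + 2 * φ ^ 2) ≤ k ^ 2 * W := fun X => by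
    have : (X.card : ℝ) ≤ k := by
      exact_mod_cast (Finset.card_le_univ X).trans (by simp)
    rw [hW]
    gcongr
  have hIf : ∫ b in (0 : ℝ)..1, (∑ n ∈ T, saw (f n - b)) ^ 2 ≤ k ^ 2 * W := by
    rw [integral_sum_saw_sub_sq T fun n : ℤ => f n]
    exact (integral_sum_saw_lowerEnvelope_sq_le hφ (fun i _ => (hφs i).neg) T hTconn
      le_rfl).trans (hWle U)
  have hIg : ∫ b in (0 : ℝ)..1, (∑ n ∈ T, saw (g n + b)) ^ 2 ≤ k ^ 2 * W :=
    (integral_sum_saw_lowerEnvelope_sq_le hφ (fun i _ => hφs i) T hTconn le_rfl).trans (hWle V)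
  have hintf : IntervalIntegrable (fun b => (∑ n ∈ T, saw (f n - b)) ^ 2) volume 0 1 := by
    have := intervalIntegrable_sum_saw_sq T (fun n : ℤ => f n) 0 (-1)
    rw [IntervalIntegrable.iff_comp_neg] at this
    simpa [sub_eq_add_neg] using this
  have hintg := intervalIntegrable_sum_saw_sq T (fun n : ℤ => g n) 0 1
  have hint : IntervalIntegrable (fun b => 3 * E ^ 2 + 3 * (∑ n ∈ T, saw (f n - b)) ^ 2 +
      3 * (∑ n ∈ T, saw (g n + b)) ^ 2) volume 0 1 :=
    (intervalIntegrable_const.add (hintf.const_mul 3)).add (hintg.const_mul 3)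
  calc ∫⁻ b in Set.Ioc (0 : ℝ) 1, ENNReal.ofReal
        ((latticeCount (halfPlanes v c) b - (volume (halfPlanes v c)).toReal) ^ 2)
      ≤ ∫⁻ b in Set.Ioc (0 : ℝ) 1, ENNReal.ofReal (3 * E ^ 2 +
          3 * (∑ n ∈ T, saw (f n - b)) ^ 2 + 3 * (∑ n ∈ T, saw (g n + b)) ^ 2) := by
        refine lintegral_mono fun b => ENNReal.ofReal_le_ofReal ?_
        rw [latticeCount_eq hB T hT b, add_sub_right_comm, ← hE]
        generalize ∑ n ∈ T, saw (f n - b) = x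
        generalize ∑ n ∈ T, saw (g n + b) = y
        nlinarith [sq_nonneg (E - x), sq_nonneg (E - y), sq_nonneg (x - y)]
    _ = ENNReal.ofReal (∫ b in (0 : ℝ)..1, (3 * E ^ 2 +
          3 * (∑ n ∈ T, saw (f n - b)) ^ 2 + 3 * (∑ n ∈ T, saw (g n + b)) ^ 2)) := by
        rw [intervalIntegral.integral_of_le zero_le_one, ofReal_integral_eq_lintegral_ofReal]
        · exact (intervalIntegrable_iff_integrableOn_Ioc_of_le zero_le_one).1 hint
        · exact Filter.Eventually.of_forall fun b => by positivity
    _ ≤ ENNReal.ofReal (192 * S ^ 2 + 6 * k ^ 2 * W) := by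
        refine ENNReal.ofReal_le_ofReal ?_
        rw [intervalIntegral.integral_add (intervalIntegrable_const.add (hintf.const_mul 3))
          (hintg.const_mul 3), intervalIntegral.integral_add intervalIntegrable_const
          (hintf.const_mul 3), intervalIntegral.integral_const, intervalIntegral.integral_const_mul,
          intervalIntegral.integral_const_mul]
        have : E ^ 2 ≤ (4 * (2 * S)) ^ 2 := by
          rw [← sq_abs]; exact pow_le_pow_left₀ (abs_nonneg _) hE8 2
        simp only [sub_zero, one_smul]
        nlinarith

/-- The rotation by `α` followed by the dilation with factor `r`. -/
noncomputable def rotationDilation (r α : ℝ) : ℝ × ℝ →ₗ[ℝ] ℝ × ℝ :=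
  Matrix.toLin (Module.Basis.finTwoProd ℝ) (Module.Basis.finTwoProd ℝ)
    !![r * Real.cos α, -(r * Real.sin α); r * Real.sin α, r * Real.cos α]

theorem rotationDilation_apply (r α : ℝ) (p : ℝ × ℝ) :
    rotationDilation r α p = (r * Real.cos α * p.1 + -(r * Real.sin α) * p.2,
      r * Real.sin α * p.1 + r * Real.cos α * p.2) :=
  Matrix.toLin_finTwoProd_apply _ _ _ _ p

theorem det_rotationDilation (r α : ℝ) : LinearMap.det (rotationDilation r α) = r ^ 2 := by
  rw [rotationDilation, LinearMap.det_toLin, Matrix.det_fin_two_of]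
  linear_combination r ^ 2 * Real.cos_sq_add_sin_sq α

theorem sq_add_sq_rotationDilation (r α : ℝ) (p : ℝ × ℝ) :
    (rotationDilation r α p).1 ^ 2 + (rotationDilation r α p).2 ^ 2 =
      r ^ 2 * (p.1 ^ 2 + p.2 ^ 2) := by
  rw [rotationDilation_apply]
  linear_combination r ^ 2 * (p.1 ^ 2 + p.2 ^ 2) * Real.cos_sq_add_sin_sq α

theorem volume_preimage_rotationDilation {r : ℝ} (hr : r ≠ 0) (α : ℝ) (B : Set (ℝ × ℝ)) :
    (volume (rotationDilation r α ⁻¹' B)).toReal = (r ^ 2)⁻¹ * (volume B).toReal := by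
  have hdet : LinearMap.det (rotationDilation r α) ≠ 0 := by
    rw [det_rotationDilation]; positivity
  rw [Measure.addHaar_preimage_linearMap _ hdet, det_rotationDilation, ENNReal.toReal_mul,
    ENNReal.toReal_ofReal (abs_nonneg _), abs_of_nonneg (by positivity)]

theorem rotationDilation_injective {r : ℝ} (hr : r ≠ 0) (α : ℝ) :
    Function.Injective (rotationDilation r α) := by
  refine (injective_iff_map_eq_zero _).2 fun p hp => ?_
  have h := sq_add_sq_rotationDilation r α p
  rw [hp] at h
  have h2 : p.1 ^ 2 + p.2 ^ 2 = 0 := by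
    have hr2 : r ^ 2 ≠ 0 := pow_ne_zero 2 hr
    have : r ^ 2 * (p.1 ^ 2 + p.2 ^ 2) = 0 := by rw [← h]; simp
    exact (mul_eq_zero.1 this).resolve_left hr2
  have h3 : p.1 = 0 := by nlinarith [sq_nonneg p.1, sq_nonneg p.2]
  have h4 : p.2 = 0 := by nlinarith [sq_nonneg p.1, sq_nonneg p.2]
  exact Prod.ext h3 h4

theorem unitSquare_mem_convexPolygons {Ω : Set ℝ} (h0 : 0 ∈ Ω) (h1 : Real.pi / 2 ∈ Ω) :
    unitSquare ∈ convexPolygons Ω 4 := by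
  refine ⟨subset_rfl, ?_, 4, le_rfl, ![(1, 0), (-1, 0), (0, 1), (0, -1)], ![1, 0, 1, 0], ?_, ?_⟩
  · rw [unitSquare, interior_prod_eq, interior_Icc]
    exact ⟨(1 / 2, 1 / 2), by constructor <;> constructor <;> norm_num⟩
  · intro i
    fin_cases i
    · exact ⟨0, h0, by simp⟩
    · exact ⟨0, h0, by simp⟩
    · exact ⟨_, h1, by simp⟩
    · exact ⟨_, h1, by simp⟩
  · ext p
    simp only [unitSquare, Set.mem_prod, Set.mem_Icc, Set.mem_ofPred_eq, Fin.forall_fin_succ]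
    simp
    constructor
    · rintro ⟨⟨a, b⟩, c, d⟩; exact ⟨b, a, d, c⟩
    · rintro ⟨a, b, c, d⟩; exact ⟨⟨b, a⟩, d, c⟩

theorem isClosed_of_mem_convexPolygons {Ω : Set ℝ} {k : ℕ} {B : Set (ℝ × ℝ)}
    (hB : B ∈ convexPolygons Ω k) : IsClosed B := by
  obtain ⟨-, -, m, -, u, c, -, rfl⟩ := hB
  exact isClosed_halfPlanes u c

theorem convex_of_mem_convexPolygons {Ω : Set ℝ} {k : ℕ} {B : Set (ℝ × ℝ)}
    (hB : B ∈ convexPolygons Ω k) : Convex ℝ B := by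
  obtain ⟨-, -, m, -, u, c, -, rfl⟩ := hB
  intro p hp q hq a b ha hb hab i
  have h1 := mul_le_mul_of_nonneg_left (hp i) ha
  have h2 := mul_le_mul_of_nonneg_left (hq i) hb
  simp only [Prod.fst_add, Prod.snd_add, Prod.smul_fst, Prod.smul_snd, smul_eq_mul]
  have h3 : a * c i + b * c i = c i := by rw [← add_mul, hab, one_mul]
  linarith

theorem volume_toReal_le_one_of_subset {B : Set (ℝ × ℝ)} (hB : B ⊆ unitSquare) :
    (volume B).toReal ≤ 1 := by
  have h1 : volume unitSquare = 1 := by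
    rw [unitSquare, Measure.volume_eq_prod, Measure.prod_prod]; simp
  have h2 := ENNReal.toReal_mono (by rw [h1]; simp) (measure_mono (μ := volume) hB)
  rwa [h1, ENNReal.toReal_one] at h2

/-- The bound for the mean square discrepancy of a randomly translated lattice. -/
noncomputable def meanSquareBound (S : ℝ) (k N J : ℕ) (φ : ℝ) : ℝ :=
  192 * S ^ 2 + 6 * k ^ 2 * (3 * J * φ ^ 2 + 100 * N / 4 ^ J + 2 * φ ^ 2)

/-- The angle `α` makes the slopes of all lines with normal angle `θ - α`, `θ ∈ Ω`, bounded. -/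
structure IsGoodAngle (Ω : Set ℝ) (α S : ℝ) : Prop where
  sin_ne_zero : ∀ θ ∈ Ω, Real.sin (θ - α) ≠ 0
  abs_le : ∀ θ ∈ Ω, |Real.cos (θ - α) / Real.sin (θ - α)| ≤ S

theorem IsGoodAngle.mono {Ω Ω' : Set ℝ} {α S : ℝ} (h : IsGoodAngle Ω' α S) (hΩ : Ω ⊆ Ω') :
    IsGoodAngle Ω α S :=
  ⟨fun θ hθ => h.1 θ (hΩ hθ), fun θ hθ => h.2 θ (hΩ hθ)⟩

/-- All slopes of lines with normal angle `θ - α`, `θ ∈ Ω`, are badly approximable. -/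
def SlopesBadlyApprox (Ω : Set ℝ) (α φ : ℝ) (J : ℕ) : Prop :=
  ∀ θ ∈ Ω, IsBadlyApprox φ (2 ^ J) (Real.cos (θ - α) / Real.sin (θ - α))

theorem abs_le_of_rotationDilation_mem {N : ℕ} (hN : 1 ≤ N) {α : ℝ} {p : ℝ × ℝ}
    (hp : rotationDilation (1 / Real.sqrt N) α p ∈ unitSquare) :
    |p.1| ≤ 2 * Real.sqrt N ∧ |p.2| ≤ 2 * Real.sqrt N := by
  have hN0 : (0 : ℝ) < N := by exact_mod_cast hN
  have h := sq_add_sq_rotationDilation (1 / Real.sqrt N) α p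
  obtain ⟨⟨a1, a2⟩, b1, b2⟩ := hp
  rw [div_pow, Real.sq_sqrt hN0.le, one_pow] at h
  have h1 : p.1 ^ 2 + p.2 ^ 2 ≤ 4 * N := by
    have h2 : 1 / (N : ℝ) * (p.1 ^ 2 + p.2 ^ 2) ≤ 2 := by rw [← h]; nlinarith
    rw [one_div, inv_mul_le_iff₀ hN0] at h2
    linarith
  have h3 : (2 * Real.sqrt N) ^ 2 = 4 * N := by
    rw [mul_pow, Real.sq_sqrt hN0.le]; norm_num
  exact ⟨abs_le_of_sq_le_sq (by rw [h3]; linarith [sq_nonneg p.2]) (by positivity),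
    abs_le_of_sq_le_sq (by rw [h3]; linarith [sq_nonneg p.1]) (by positivity)⟩

theorem IsGoodAngle.lintegral_le {Ω : Set ℝ} {α S : ℝ} (h : IsGoodAngle Ω α S)
    {N : ℕ} (hN : 1 ≤ N) {k : ℕ} {B : Set (ℝ × ℝ)} (hB : B ∈ convexPolygons Ω k) {J : ℕ} {φ : ℝ}
    (hφ : 0 < φ) (hJ : SlopesBadlyApprox Ω α φ J) :
    ∫⁻ b in Set.Ioc (0 : ℝ) 1, ENNReal.ofReal
      ((latticeCount (rotationDilation (1 / Real.sqrt N) α ⁻¹' B) b -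
        N * (volume B).toReal) ^ 2) ≤ ENNReal.ofReal (meanSquareBound S k N J φ) := by
  have hN0 : (0 : ℝ) < N := by exact_mod_cast hN
  have hN1 : (1 : ℝ) ≤ N := by exact_mod_cast hN
  have hsq : 0 < Real.sqrt N := Real.sqrt_pos.2 hN0
  have hr : 1 / Real.sqrt N ≠ 0 := (by positivity : 0 < 1 / Real.sqrt N).ne'
  have hvol : (N : ℝ) * (volume B).toReal =
      (volume (rotationDilation (1 / Real.sqrt N) α ⁻¹' B)).toReal := by
    rw [volume_preimage_rotationDilation hr, div_pow, Real.sq_sqrt hN0.le]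
    simp
  obtain ⟨hBsq, hint, m, hm, u, c, hu, rfl⟩ := hB
  rw [hvol]
  set r := 1 / Real.sqrt N with hr_def
  have hmain : ∀ i, ∃ θ ∈ Ω, ∃ ρ : ℝ, ρ ≠ 0 ∧ ∀ p : ℝ × ℝ,
      (u i).1 * (rotationDilation r α p).1 + (u i).2 * (rotationDilation r α p).2 =
        ρ * Real.cos (θ - α) * p.1 + ρ * Real.sin (θ - α) * p.2 := by
    intro i
    obtain ⟨θ, hθ, hui | hui⟩ := hu i
    · refine ⟨θ, hθ, r, hr, fun p => ?_⟩
      rw [rotationDilation_apply, hui, Real.cos_sub, Real.sin_sub]; ring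
    · refine ⟨θ, hθ, -r, neg_ne_zero.2 hr, fun p => ?_⟩
      rw [rotationDilation_apply, hui, Real.cos_sub, Real.sin_sub]; ring
  choose θ hθ ρ hρ hform using hmain
  have hpre : rotationDilation r α ⁻¹' {p | ∀ i, (u i).1 * p.1 + (u i).2 * p.2 ≤ c i} =
      halfPlanes (fun i => (ρ i * Real.cos (θ i - α), ρ i * Real.sin (θ i - α))) c := by
    ext p
    simp only [Set.mem_preimage, halfPlanes, Set.mem_ofPred_eq, hform]
  rw [hpre]
  have hR : ∀ p ∈ halfPlanes (fun i => (ρ i * Real.cos (θ i - α), ρ i * Real.sin (θ i - α))) c,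
      |p.1| ≤ 2 * Real.sqrt N ∧ |p.2| ≤ 2 * Real.sqrt N := by
    intro p hp
    rw [← hpre] at hp
    exact abs_le_of_rotationDilation_mem hN (hBsq hp)
  have hne : (halfPlanes (fun i => (ρ i * Real.cos (θ i - α),
      ρ i * Real.sin (θ i - α))) c).Nonempty := by
    obtain ⟨p, hp⟩ := hint
    have hsurj : Function.Surjective (rotationDilation r α) :=
      LinearMap.injective_iff_surjective.1 (rotationDilation_injective hr α)
    have hp' := interior_subset hp
    obtain ⟨q, rfl⟩ := hsurj p
    exact ⟨q, by rw [← hpre]; exact hp'⟩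
  have hslope : ∀ i, ρ i * Real.cos (θ i - α) / (ρ i * Real.sin (θ i - α)) =
      Real.cos (θ i - α) / Real.sin (θ i - α) := fun i => mul_div_mul_left _ _ (hρ i)
  refine (lintegral_latticeCount_sub_sq_le (by positivity)
    (fun i => mul_ne_zero (hρ i) (h.sin_ne_zero _ (hθ i)))
    (fun i => by rw [hslope]; exact h.abs_le _ (hθ i)) hφ
    (fun i => by rw [hslope]; exact hJ _ (hθ i)) hne hR).trans ?_
  refine ENNReal.ofReal_le_ofReal ?_
  rw [meanSquareBound]
  have hmk : (m : ℝ) ≤ k := by exact_mod_cast hm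
  have h1 : 4 * (2 * (2 * Real.sqrt N) + 1) ^ 2 ≤ 100 * (N : ℝ) := by
    have h2 : 1 ≤ Real.sqrt N := by rw [← Real.sqrt_one]; exact Real.sqrt_le_sqrt hN1
    have h3 := Real.sq_sqrt hN0.le
    nlinarith
  gcongr

section Measurability

variable {Ω : Set ℝ} {k : ℕ} [MeasurableSpace (convexPolygons Ω k)]

theorem measurableSet_mem_polygon
    (hm : ∀ p : ℝ × ℝ, MeasurableSet {B : convexPolygons Ω k | p ∈ (B : Set (ℝ × ℝ))}) :
    MeasurableSet {z : (ℝ × ℝ) × convexPolygons Ω k | z.1 ∈ (z.2 : Set (ℝ × ℝ))} := by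
  have hset : {z : (ℝ × ℝ) × convexPolygons Ω k | z.1 ∈ (z.2 : Set (ℝ × ℝ))} =
      ⋂ n : ℕ, ⋃ j : ℕ, Metric.ball (TopologicalSpace.denseSeq (ℝ × ℝ) j) (1 / ((n : ℝ) + 1)) ×ˢ
        {B : convexPolygons Ω k | TopologicalSpace.denseSeq (ℝ × ℝ) j ∈ (B : Set (ℝ × ℝ))} := by
    ext ⟨x, B⟩
    simp only [Set.mem_ofPred_eq, Set.mem_iInter, Set.mem_iUnion, Set.mem_prod, Metric.mem_ball]
    have hcl := isClosed_of_mem_convexPolygons B.2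
    constructor
    · intro hx n
      have hx' : x ∈ closure (interior (B : Set (ℝ × ℝ))) := by
        rw [(convex_of_mem_convexPolygons B.2).closure_interior_eq_closure_of_nonempty_interior
          B.2.2.1]
        exact subset_closure hx
      obtain ⟨y, hy, hxy⟩ := Metric.mem_closure_iff.1 hx' (1 / ((n : ℝ) + 1)) (by positivity)
      obtain ⟨z, ⟨hz1, hz2⟩, j, rfl⟩ :=
        (TopologicalSpace.denseRange_denseSeq (ℝ × ℝ)).inter_open_nonempty
          (interior (B : Set (ℝ × ℝ)) ∩ Metric.ball x (1 / ((n : ℝ) + 1)))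
          (isOpen_interior.inter Metric.isOpen_ball)
          ⟨y, hy, by rw [Metric.mem_ball, dist_comm]; exact hxy⟩
      refine ⟨j, ?_, interior_subset hz1⟩
      rw [dist_comm]
      exact hz2
    · intro h
      rw [← hcl.closure_eq, Metric.mem_closure_iff]
      intro ε hε
      obtain ⟨n, hn⟩ := exists_nat_one_div_lt hε
      obtain ⟨j, hj1, hj2⟩ := h n
      exact ⟨_, hj2, hj1.trans hn⟩
  rw [hset]
  exact MeasurableSet.iInter fun n => MeasurableSet.iUnion fun j =>
    Metric.isOpen_ball.measurableSet.prod (hm _)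

theorem measurable_volume_polygon
    (hm : ∀ p : ℝ × ℝ, MeasurableSet {B : convexPolygons Ω k | p ∈ (B : Set (ℝ × ℝ))}) :
    Measurable fun B : convexPolygons Ω k => (volume (B : Set (ℝ × ℝ))).toReal :=
  (measurable_measure_prodMk_right (measurableSet_mem_polygon hm)).ennreal_toReal

theorem latticeCount_eq_tsum (B : Set (ℝ × ℝ)) (b : ℝ) :
    latticeCount B b = (∑' q : ℤ × ℤ,
      Set.indicator B (fun _ => (1 : ENNReal)) ((q.1 : ℝ), (q.2 : ℝ) + b)).toReal := by
  have h : ∀ s : Set (ℤ × ℤ), ((s.ncard : ℕ) : ℝ) =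
      (∑' q, Set.indicator s (fun _ => (1 : ENNReal)) q).toReal := fun s => by
    rw [← tsum_subtype, ENNReal.tsum_set_one]
    rcases s.finite_or_infinite with hs | hs
    · rw [← hs.cast_ncard_eq]; simp
    · rw [hs.encard_eq, hs.ncard]; simp
  rw [latticeCount, h]
  rfl

theorem measurable_latticeCount_polygon
    (hm : ∀ p : ℝ × ℝ, MeasurableSet {B : convexPolygons Ω k | p ∈ (B : Set (ℝ × ℝ))})
    (r α : ℝ) :
    Measurable fun z : ℝ × convexPolygons Ω k =>
      latticeCount (rotationDilation r α ⁻¹' (z.2 : Set (ℝ × ℝ))) z.1 := by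
  simp only [latticeCount_eq_tsum]
  refine (Measurable.tsum fun q => ?_).ennreal_toReal
  have hf : Measurable fun z : ℝ × convexPolygons Ω k =>
      (rotationDilation r α ((q.1 : ℝ), (q.2 : ℝ) + z.1), z.2) := by
    simp only [rotationDilation_apply]
    fun_prop
  exact (measurable_const.indicator (measurableSet_mem_polygon hm)).comp hf

theorem measurable_discrepancy
    (hm : ∀ p : ℝ × ℝ, MeasurableSet {B : convexPolygons Ω k | p ∈ (B : Set (ℝ × ℝ))})
    (P : Finset (ℝ × ℝ)) : Measurable fun B : convexPolygons Ω k => discrepancy P B := by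
  classical
  have hcount : ∀ B : Set (ℝ × ℝ), ((((P : Set (ℝ × ℝ)) ∩ B).ncard : ℕ) : ℝ) =
      ∑ p ∈ P, Set.indicator B (fun _ => (1 : ℝ)) p := fun B => by
    have : (P : Set (ℝ × ℝ)) ∩ B = (P.filter (· ∈ B) : Finset (ℝ × ℝ)) := by ext; simp
    rw [this, Set.ncard_coe_finset, Finset.card_filter]
    push_cast
    rfl
  unfold discrepancy
  simp only [hcount]
  refine Measurable.abs (Measurable.sub ?_ ((measurable_volume_polygon hm).const_mul _))
  refine Finset.measurable_sum _ fun p _ => ?_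
  exact measurable_const.indicator (hm p)

end Measurability

open Classical in
theorem exists_finset_subset_or_superset {α : Type*} {t : Set α} (ht : t.Infinite) (Q : Finset α)
    (hQ : (Q : Set α) ⊆ t) (N : ℕ) :
    ∃ P : Finset α, (P : Set α) ⊆ t ∧ P.card = N ∧ (P ⊆ Q ∨ Q ⊆ P) := by
  rcases le_total N Q.card with h | h
  · obtain ⟨P, hP, hc⟩ := Finset.exists_subset_card_eq h
    exact ⟨P, (Finset.coe_subset.2 hP).trans hQ, hc, Or.inl hP⟩
  · obtain ⟨R, hR, hc⟩ := (ht.sdiff Q.finite_toSet).exists_subset_card_eq (N - Q.card)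
    have hdisj : Disjoint Q R := Finset.disjoint_left.2 fun x hx hxR =>
      (hR (Finset.mem_coe.2 hxR)).2 (Finset.mem_coe.2 hx)
    refine ⟨Q ∪ R, ?_, ?_, Or.inr Finset.subset_union_left⟩
    · rw [Finset.coe_union]
      exact Set.union_subset hQ (hR.trans Set.sdiff_subset)
    · rw [Finset.card_union_of_disjoint hdisj, hc]
      omega

theorem abs_ncard_inter_sub_le {α : Type*} {P Q : Finset α} (h : P ⊆ Q) (B : Set α) :
    |(((P : Set α) ∩ B).ncard : ℝ) - ((Q : Set α) ∩ B).ncard| ≤ |(P.card : ℝ) - Q.card| := by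
  classical
  have e : ∀ X : Finset α, (X : Set α) ∩ B = (X.filter (· ∈ B) : Finset α) := fun X => by ext; simp
  have hc : ∀ X : Finset α, (X.filter (· ∈ B)).card + (X.filter fun x => ¬ x ∈ B).card = X.card :=
    fun X => Finset.card_filter_add_card_filter_not _
  rw [e, e, Set.ncard_coe_finset, Set.ncard_coe_finset]
  have h1 := Finset.card_le_card (Finset.filter_subset_filter (· ∈ B) h)
  have h2 := Finset.card_le_card (Finset.filter_subset_filter (fun x => ¬ x ∈ B) h)
  have h3 := Finset.card_le_card h
  rw [abs_sub_comm, abs_sub_comm (P.card : ℝ), abs_of_nonneg (by simpa using h1),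
    abs_of_nonneg (by simpa using h3), ← hc P, ← hc Q]
  push_cast
  have h2' : (((P.filter fun x => ¬ x ∈ B).card : ℕ) : ℝ) ≤ (Q.filter fun x => ¬ x ∈ B).card := by
    exact_mod_cast h2
  linarith

theorem discrepancy_le {P Q : Finset (ℝ × ℝ)} (h : P ⊆ Q ∨ Q ⊆ P) (B : Set (ℝ × ℝ)) :
    discrepancy P B ≤ |(((Q : Set (ℝ × ℝ)) ∩ B).ncard : ℝ) - P.card * (volume B).toReal| +
      |(Q.card : ℝ) - P.card| := by
  have h1 : |(((P : Set (ℝ × ℝ)) ∩ B).ncard : ℝ) - ((Q : Set (ℝ × ℝ)) ∩ B).ncard| ≤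
      |(Q.card : ℝ) - P.card| := by
    rcases h with h | h
    · rw [abs_sub_comm (Q.card : ℝ)]; exact abs_ncard_inter_sub_le h B
    · rw [abs_sub_comm]; exact abs_ncard_inter_sub_le h B
  have h2 := abs_add_le ((((P : Set (ℝ × ℝ)) ∩ B).ncard : ℝ) - ((Q : Set (ℝ × ℝ)) ∩ B).ncard)
    ((((Q : Set (ℝ × ℝ)) ∩ B).ncard : ℝ) - P.card * (volume B).toReal)
  rw [sub_add_sub_cancel] at h2
  unfold discrepancy
  linarith

theorem exists_finset_latticeCount {N : ℕ} (hN : 1 ≤ N) (α b : ℝ) :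
    ∃ Q : Finset (ℝ × ℝ), (Q : Set (ℝ × ℝ)) ⊆ unitSquare ∧ ∀ B ⊆ unitSquare,
      (((Q : Set (ℝ × ℝ)) ∩ B).ncard : ℝ) =
        latticeCount (rotationDilation (1 / Real.sqrt N) α ⁻¹' B) b := by
  have hN0 : (0 : ℝ) < N := by exact_mod_cast hN
  have hr : 1 / Real.sqrt N ≠ 0 := (by positivity : 0 < 1 / Real.sqrt N).ne'
  let Ψ : ℤ × ℤ → ℝ × ℝ := fun q => rotationDilation (1 / Real.sqrt N) α (q.1, q.2 + b)
  have hΨ : Function.Injective Ψ := fun q q' h => by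
    have h1 := rotationDilation_injective hr α h
    obtain ⟨h2, h3⟩ := Prod.mk.inj h1
    exact Prod.ext (by exact_mod_cast h2) (by exact_mod_cast add_right_cancel h3)
  have hfin : (Ψ ⁻¹' unitSquare).Finite := by
    refine ((Set.finite_Icc (-⌈2 * Real.sqrt N⌉) ⌈2 * Real.sqrt N⌉).prod
      (Set.finite_Icc (-⌈2 * Real.sqrt N + |b|⌉) ⌈2 * Real.sqrt N + |b|⌉)).subset ?_
    intro q hq
    obtain ⟨h1, h2⟩ := abs_le_of_rotationDilation_mem hN hq
    rw [abs_le] at h1 h2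
    simp only at h1 h2
    have c1 := Int.le_ceil (2 * Real.sqrt N)
    have c2 := Int.le_ceil (2 * Real.sqrt N + |b|)
    have b1 := le_abs_self b
    have b2 := neg_abs_le b
    refine ⟨⟨?_, ?_⟩, ?_, ?_⟩
    · exact_mod_cast (by linarith : (-(⌈2 * Real.sqrt N⌉ : ℝ)) ≤ q.1)
    · exact_mod_cast (by linarith : (q.1 : ℝ) ≤ ⌈2 * Real.sqrt N⌉)
    · exact_mod_cast (by linarith : (-(⌈2 * Real.sqrt N + |b|⌉ : ℝ)) ≤ q.2)
    · exact_mod_cast (by linarith : (q.2 : ℝ) ≤ ⌈2 * Real.sqrt N + |b|⌉)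
  refine ⟨(hfin.image Ψ).toFinset, ?_, fun B hB => ?_⟩
  · rw [Set.Finite.coe_toFinset]
    exact Set.image_preimage_subset _ _
  · have : ((hfin.image Ψ).toFinset : Set (ℝ × ℝ)) ∩ B = Ψ '' (Ψ ⁻¹' B) := by
      rw [Set.Finite.coe_toFinset]
      ext p
      constructor
      · rintro ⟨⟨q, -, rfl⟩, hp⟩
        exact ⟨q, hp, rfl⟩
      · rintro ⟨q, hq, rfl⟩
        exact ⟨⟨q, hB hq, rfl⟩, hq⟩
    rw [this, Set.ncard_image_of_injective _ hΨ]
    rfl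

theorem integrable_discrepancy_sq {Ω : Set ℝ} {k : ℕ} [MeasurableSpace (convexPolygons Ω k)]
    (hm : ∀ p : ℝ × ℝ, MeasurableSet {B : convexPolygons Ω k | p ∈ (B : Set (ℝ × ℝ))})
    (σ : Measure (convexPolygons Ω k)) [IsProbabilityMeasure σ] (P : Finset (ℝ × ℝ)) :
    Integrable (fun B : convexPolygons Ω k => discrepancy P B ^ 2) σ := by
  refine Integrable.of_bound ((measurable_discrepancy hm P).pow_const 2).aestronglyMeasurable
    ((P.card : ℝ) ^ 2) (Filter.Eventually.of_forall fun B => ?_)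
  rw [Real.norm_of_nonneg (sq_nonneg _)]
  refine pow_le_pow_left₀ (abs_nonneg _) ?_ 2
  have h1 : ((((P : Set (ℝ × ℝ)) ∩ B).ncard : ℕ) : ℝ) ≤ P.card := by
    have := Set.ncard_le_ncard (Set.inter_subset_left (s := (P : Set (ℝ × ℝ))) (t := B))
      P.finite_toSet
    rw [Set.ncard_coe_finset] at this
    exact_mod_cast this
  have h2 := volume_toReal_le_one_of_subset B.2.1
  have h3 : 0 ≤ (volume (B : Set (ℝ × ℝ))).toReal := ENNReal.toReal_nonneg
  have h4 : (0 : ℝ) ≤ P.card := Nat.cast_nonneg _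
  have h5 : (0 : ℝ) ≤ (((P : Set (ℝ × ℝ)) ∩ B).ncard : ℕ) := Nat.cast_nonneg _
  exact abs_le.2 ⟨by nlinarith, by nlinarith⟩

theorem meanSquareBound_nonneg (S : ℝ) (k N J : ℕ) (φ : ℝ) : 0 ≤ meanSquareBound S k N J φ := by
  unfold meanSquareBound; positivity

theorem IsGoodAngle.exists_finset {Ω Ω' : Set ℝ} (hΩ : Ω ⊆ Ω') (h0 : 0 ∈ Ω')
    (h1 : Real.pi / 2 ∈ Ω') {α S : ℝ} (h : IsGoodAngle Ω' α S) {k N : ℕ} (hN : 1 ≤ N)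
    [MeasurableSpace (convexPolygons Ω k)]
    (hm : ∀ p : ℝ × ℝ, MeasurableSet {B : convexPolygons Ω k | p ∈ (B : Set (ℝ × ℝ))})
    (σ : Measure (convexPolygons Ω k)) [IsProbabilityMeasure σ] :
    ∃ P : Finset (ℝ × ℝ), (P : Set (ℝ × ℝ)) ⊆ unitSquare ∧ P.card = N ∧
      Integrable (fun B : convexPolygons Ω k => discrepancy P B ^ 2) σ ∧
      ∀ (J : ℕ) (φ : ℝ), 0 < φ → SlopesBadlyApprox Ω' α φ J →
        ∫ B : convexPolygons Ω k, discrepancy P B ^ 2 ∂σ ≤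
          2 * (meanSquareBound S k N J φ + meanSquareBound S 4 N J φ) := by
  set r := 1 / Real.sqrt N with hr
  let X : ℝ → Set (ℝ × ℝ) → ℝ := fun b B =>
    latticeCount (rotationDilation r α ⁻¹' B) b - N * (volume B).toReal
  let G : ℝ → ENNReal := fun b =>
    ∫⁻ B : convexPolygons Ω k, ENNReal.ofReal (X b B ^ 2) ∂σ + ENNReal.ofReal (X b unitSquare ^ 2)
  have hXm : Measurable fun z : ℝ × convexPolygons Ω k => ENNReal.ofReal (X z.1 z.2 ^ 2) :=
    (((measurable_latticeCount_polygon hm r α).sub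
      (((measurable_volume_polygon hm).comp measurable_snd).const_mul _)).pow_const 2).ennreal_ofReal
  have hXm' : Measurable fun b => ENNReal.ofReal (X b unitSquare ^ 2) := by
    have hsq : MeasurableSet (rotationDilation r α ⁻¹' unitSquare) :=
      (LinearMap.continuous_of_finiteDimensional _).measurable
        (measurableSet_Icc.prod measurableSet_Icc)
    have hlc : Measurable (latticeCount (rotationDilation r α ⁻¹' unitSquare)) := by
      have : latticeCount (rotationDilation r α ⁻¹' unitSquare) = fun b =>
        latticeCount (rotationDilation r α ⁻¹' unitSquare) b := rfl
      rw [this]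
      simp only [latticeCount_eq_tsum]
      refine (Measurable.tsum fun q => ?_).ennreal_toReal
      exact (measurable_const.indicator hsq).comp (by fun_prop)
    exact ((hlc.sub measurable_const).pow_const 2).ennreal_ofReal
  have : IsProbabilityMeasure (volume.restrict (Set.Ioc (0 : ℝ) 1)) := ⟨by simp⟩
  have hGm : Measurable G := hXm.lintegral_prod_right'.add hXm'
  obtain ⟨b, hb⟩ := exists_le_lintegral (μ := volume.restrict (Set.Ioc (0 : ℝ) 1)) hGm.aemeasurable
  have hGb : ∀ (J : ℕ) (φ : ℝ), 0 < φ → SlopesBadlyApprox Ω' α φ J →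
      G b ≤ ENNReal.ofReal (meanSquareBound S k N J φ + meanSquareBound S 4 N J φ) := by
    intro J φ hφ hJ
    refine hb.trans ?_
    rw [lintegral_add_right _ hXm', ENNReal.ofReal_add (meanSquareBound_nonneg _ _ _ _ _)
      (meanSquareBound_nonneg _ _ _ _ _)]
    refine add_le_add ?_ (h.lintegral_le hN (unitSquare_mem_convexPolygons h0 h1) hφ hJ)
    rw [lintegral_lintegral_swap hXm.aemeasurable]
    refine (lintegral_mono fun B : convexPolygons Ω k =>
      (h.mono hΩ).lintegral_le hN B.2 hφ fun θ hθ => hJ θ (hΩ hθ)).trans ?_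
    simp
  obtain ⟨Q, hQ, hQc⟩ := exists_finset_latticeCount hN α b
  have hinf : unitSquare.Infinite := by
    have h01 : (Set.Icc (0 : ℝ) 1).Infinite := Set.Icc_infinite one_pos
    exact h01.prod_left ⟨0, by simp⟩
  obtain ⟨P, hP, hPN, hPQ⟩ := exists_finset_subset_or_superset hinf Q hQ N
  have hint := integrable_discrepancy_sq hm σ P
  refine ⟨P, hP, hPN, hint, fun J φ hφ hJ => ?_⟩
  have hsquare : (volume unitSquare).toReal = 1 := by
    rw [unitSquare, Measure.volume_eq_prod, Measure.prod_prod]; simp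
  have hQcard : (Q.card : ℝ) - N = X b unitSquare := by
    have := hQc unitSquare subset_rfl
    rw [Set.inter_eq_left.2 hQ, Set.ncard_coe_finset] at this
    simp only [X, hsquare, mul_one, this, hr]
  have hpt : ∀ B : convexPolygons Ω k, ENNReal.ofReal (discrepancy P B ^ 2) ≤
      2 * (ENNReal.ofReal (X b B ^ 2) + ENNReal.ofReal (X b unitSquare ^ 2)) := by
    intro B
    have h2 := discrepancy_le hPQ (B : Set (ℝ × ℝ))
    rw [hPN, hQc B B.2.1, hQcard] at h2
    rw [← ENNReal.ofReal_add (sq_nonneg _) (sq_nonneg _), ← ENNReal.ofReal_ofNat 2,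
      ← ENNReal.ofReal_mul (by norm_num)]
    refine ENNReal.ofReal_le_ofReal ?_
    have h3 := pow_le_pow_left₀ (abs_nonneg _) h2 2
    change discrepancy P B ^ 2 ≤ (|X b B| + |X b unitSquare|) ^ 2 at h3
    rw [← sq_abs (X b B), ← sq_abs (X b unitSquare)]
    nlinarith [sq_nonneg (|X b B| - |X b unitSquare|)]
  have hfinal : ENNReal.ofReal (∫ B : convexPolygons Ω k, discrepancy P B ^ 2 ∂σ) ≤
      ENNReal.ofReal (2 * (meanSquareBound S k N J φ + meanSquareBound S 4 N J φ)) := by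
    rw [ofReal_integral_eq_lintegral_ofReal hint
      (Filter.Eventually.of_forall fun B => sq_nonneg _)]
    refine (lintegral_mono hpt).trans ?_
    rw [lintegral_const_mul' _ _ ENNReal.ofNat_ne_top, lintegral_add_right _ measurable_const,
      ENNReal.ofReal_mul (by norm_num), ENNReal.ofReal_ofNat]
    refine mul_le_mul_right ?_ 2
    have := hGb J φ hφ hJ
    simpa [G] using this
  exact (ENNReal.ofReal_le_ofReal_iff (mul_nonneg (by norm_num)
    (add_nonneg (meanSquareBound_nonneg _ _ _ _ _) (meanSquareBound_nonneg _ _ _ _ _)))).1 hfinal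

theorem exists_coveringNumber {Ω : Set ℝ} (h : ∀ i : ℕ, ∃ F : Finset ℝ, Covers F ((1 / 2) ^ i) Ω) :
    ∃ κ : ℕ → ℕ, (∀ i, ∃ F : Finset ℝ, F.card = κ i ∧ Covers F ((1 / 2) ^ i) Ω) ∧
      ∀ (i : ℕ) (F : Finset ℝ), Covers F ((1 / 2) ^ i) Ω → κ i ≤ F.card := by
  refine ⟨fun i => sInf {n | ∃ F : Finset ℝ, F.card = n ∧ Covers F ((1 / 2) ^ i) Ω},
    fun i => ?_, fun i F hF => Nat.sInf_le ⟨F, rfl, hF⟩⟩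
  obtain ⟨F, hF⟩ := h i
  exact Nat.sInf_mem (s := {n | ∃ F : Finset ℝ, F.card = n ∧ Covers F ((1 / 2) ^ i) Ω})
    ⟨_, F, rfl, hF⟩

theorem exists_isGoodAngle {Ω : Set ℝ} (hΩ : Ω.Nonempty) {κ : ℕ → ℕ}
    (hcov : ∀ i, ∃ F : Finset ℝ, F.card = κ i ∧ Covers F ((1 / 2) ^ i) Ω)
    (hκ : ∀ a : ℕ, ∃ b : ℕ, 7 * ((κ b : ℝ) + 1) * 2 ^ a ≤ 2 ^ b) :
    ∃ α S : ℝ, IsGoodAngle Ω α S ∧ ∃ r : ℕ, ∀ ψ : ℕ → ℝ, Monotone ψ → (∀ i, 1 ≤ ψ i) →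
      (∀ i i' i'', ScaleStep κ i i' → ScaleStep κ i' i'' → (2 : ℝ) ^ i'' ≤ ψ i * 2 ^ i) →
        ∀ J, SlopesBadlyApprox Ω α (8 * 2 ^ r * ψ (r + 2 * J)) J := by
  obtain ⟨α, hα⟩ := exists_angle hΩ hcov hκ
  obtain ⟨_, _, e, -, -, -, he⟩ := hα 0 1 (by simp)
  have hsin : ∀ θ ∈ Ω, 1 ≤ 2 ^ e * |Real.sin (θ - α)| := fun θ hθ => by
    have h1 := he θ hθ
    simp only [Int.cast_zero, Int.cast_one, zero_mul, one_mul, zero_add] at h1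
    have h2 : (1 : ℝ) ≤ |2 ^ e * Real.sin (θ - α)| := by
      rw [← abs_one]
      exact sq_le_sq.1 (by linarith)
    rwa [abs_mul, abs_of_pos (by positivity)] at h2
  have hne : ∀ θ ∈ Ω, Real.sin (θ - α) ≠ 0 := fun θ hθ h0 => by
    have := hsin θ hθ
    rw [h0] at this
    norm_num at this
  have hS : ∀ θ ∈ Ω, |Real.cos (θ - α) / Real.sin (θ - α)| ≤ 2 ^ e := fun θ hθ => by
    rw [abs_div, div_le_iff₀ (abs_pos.2 (hne θ hθ))]
    exact (Real.abs_cos_le_one _).trans (hsin θ hθ)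
  refine ⟨α, 2 ^ e, ⟨hne, hS⟩, ?_⟩
  obtain ⟨r, hr⟩ := exists_le_two_pow (8 * (1 + ((2 : ℝ) ^ e + 1) ^ 2))
  refine ⟨r, fun ψ hψ hψ1 hstep J θ hθ q hq1 hqJ p => ?_⟩
  have hq : (1 : ℝ) ≤ q := by exact_mod_cast hq1
  have hψJ := hψ1 (r + 2 * J)
  have hr1 : (1 : ℝ) ≤ 2 ^ r := one_le_pow₀ (by norm_num)
  set s := Real.cos (θ - α) / Real.sin (θ - α) with hs
  have hsS : |s| ≤ 2 ^ e := hS θ hθ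
  have hφ1 : 1 ≤ 8 * 2 ^ r * ψ (r + 2 * J) := by nlinarith
  rcases le_or_gt 1 |q * s - p| with hbig | hsmall
  · have : (1 : ℝ) ≤ 8 * 2 ^ r * ψ (r + 2 * J) * q := by nlinarith
    nlinarith
  have hp : |(p : ℝ)| ≤ (2 ^ e + 1) * q := by
    have h1 := abs_sub_abs_le_abs_sub (p : ℝ) (q * s)
    rw [abs_sub_comm, abs_mul, abs_of_nonneg (by linarith : (0 : ℝ) ≤ q)] at h1
    have h2 := mul_le_mul_of_nonneg_left hsS (by linarith : (0 : ℝ) ≤ q)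
    linarith
  have hν : ((q : ℤ), -p) ≠ 0 := fun h => by
    have := (Prod.mk.inj h).1
    omega
  obtain ⟨i, i', i'', hi, hs1, hs2, hF⟩ := hα q (-p) hν
  have hF := hF θ hθ
  have hi'' := hstep i i' i'' hs1 hs2
  push_cast at hi hF
  set F : ℝ := q * Real.cos (θ - α) + -p * Real.sin (θ - α) with hFdef
  have hn0 : (1 : ℝ) ≤ (q : ℝ) ^ 2 + (-(p : ℝ)) ^ 2 := by nlinarith [sq_nonneg (p : ℝ)]
  have hn : 8 * ((q : ℝ) ^ 2 + (-(p : ℝ)) ^ 2) ≤ 2 ^ r * (q : ℝ) ^ 2 := by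
    have h1 : (p : ℝ) ^ 2 ≤ ((2 ^ e + 1) * q) ^ 2 := by
      rw [← sq_abs]; exact pow_le_pow_left₀ (abs_nonneg _) hp 2
    have h2 := mul_le_mul_of_nonneg_right hr (sq_nonneg (q : ℝ))
    nlinarith
  set n := Real.sqrt ((q : ℝ) ^ 2 + (-(p : ℝ)) ^ 2) with hndef
  have hnsq : n ^ 2 = (q : ℝ) ^ 2 + (-(p : ℝ)) ^ 2 := Real.sq_sqrt (by positivity)
  have hnpos : 0 < n := Real.sqrt_pos.2 (by linarith)
  have hnle : n ≤ 2 ^ r * q := by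
    refine Real.sqrt_le_iff.2 ⟨by positivity, ?_⟩
    rw [mul_pow]
    have h1 : (2 : ℝ) ^ r ≤ (2 ^ r) ^ 2 := by nlinarith
    have h2 := mul_le_mul_of_nonneg_right h1 (sq_nonneg (q : ℝ))
    linarith
  have hile : i ≤ r + 2 * J := by
    have h1 : (q : ℝ) ≤ 2 ^ J := by exact_mod_cast hqJ
    have h2 : (2 : ℝ) ^ i ≤ 2 ^ (r + 2 * J) := by
      rw [pow_add, pow_mul']
      refine (hi.trans hn).trans (mul_le_mul_of_nonneg_left ?_ (by positivity))
      exact pow_le_pow_left₀ (by linarith) h1 2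
    exact (pow_le_pow_iff_right₀ (by norm_num : (1 : ℝ) < 2)).1 h2
  have hψle := hψ hile
  rw [← hnsq] at hF hi
  have h3 : n ≤ 2 ^ i'' * |F| := by
    have := sq_le_sq.1 hF
    rwa [abs_of_pos hnpos, abs_mul, abs_of_pos (by positivity)] at this
  have h4 : n ≤ ψ (r + 2 * J) * (8 * n ^ 2) * |F| := by
    refine h3.trans (mul_le_mul_of_nonneg_right (hi''.trans ?_) (abs_nonneg _))
    exact mul_le_mul hψle hi (by positivity) (by linarith)
  have h5 : 1 ≤ 8 * ψ (r + 2 * J) * n * |F| := by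
    have : 1 * n ≤ (8 * ψ (r + 2 * J) * n * |F|) * n := by linarith
    exact le_of_mul_le_mul_right this hnpos
  have h6 : |F| ≤ |q * s - p| := by
    have : F = (q * s - p) * Real.sin (θ - α) := by
      rw [hFdef, hs]
      have := hne θ hθ
      field_simp
      ring
    rw [this, abs_mul]
    exact mul_le_of_le_one_right (abs_nonneg _) (Real.abs_sin_le_one _)
  calc (1 : ℝ) ≤ 8 * ψ (r + 2 * J) * n * |F| := h5
    _ ≤ 8 * ψ (r + 2 * J) * (2 ^ r * q) * |q * s - p| := by gcongr
    _ = 8 * 2 ^ r * ψ (r + 2 * J) * q * |q * s - p| := by ring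

theorem exists_sq_poly_le_two_pow (C : ℝ) (M : ℕ) :
    ∃ t : ℕ, ∀ b : ℕ, (C * ((b : ℝ) + 1) ^ M) ^ 2 ≤ 2 ^ t * 2 ^ b := by
  obtain ⟨K, hK⟩ := (tendsto_pow_const_div_const_pow_of_one_lt (2 * M)
    (by norm_num : (1 : ℝ) < 2)).bddAbove_range
  obtain ⟨t, ht⟩ := exists_le_two_pow (C ^ 2 * (2 * K))
  refine ⟨t, fun b => ?_⟩
  have h1 := hK ⟨b + 1, rfl⟩
  simp only at h1
  rw [div_le_iff₀ (by positivity)] at h1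
  push_cast at h1
  calc (C * ((b : ℝ) + 1) ^ M) ^ 2 = C ^ 2 * ((b : ℝ) + 1) ^ (2 * M) := by
        rw [mul_pow, ← pow_mul, mul_comm M]
    _ ≤ C ^ 2 * (K * 2 ^ (b + 1)) := mul_le_mul_of_nonneg_left h1 (sq_nonneg C)
    _ = C ^ 2 * (2 * K) * 2 ^ b := by ring
    _ ≤ 2 ^ t * 2 ^ b := mul_le_mul_of_nonneg_right ht (by positivity)

section LogGrowth

variable {κ : ℕ → ℕ} {C M : ℕ}

theorem exists_scale_of_log_growth (hκ : ∀ i, κ i ≤ C * (i + 1) ^ M) (a : ℕ) :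
    ∃ b : ℕ, 7 * ((κ b : ℝ) + 1) * 2 ^ a ≤ 2 ^ b := by
  obtain ⟨t, ht⟩ := exists_sq_poly_le_two_pow (7 * (C + 1)) M
  refine ⟨t + 2 * a, ?_⟩
  have h1 := ht (t + 2 * a)
  have h2 : (κ (t + 2 * a) : ℝ) ≤ C * (((t + 2 * a : ℕ) : ℝ) + 1) ^ M := by
    exact_mod_cast hκ (t + 2 * a)
  have h3 : (1 : ℝ) ≤ (((t + 2 * a : ℕ) : ℝ) + 1) ^ M := one_le_pow₀ (by
    have : (0 : ℝ) ≤ ((t + 2 * a : ℕ) : ℝ) := Nat.cast_nonneg _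
    linarith)
  have h4 : 7 * ((κ (t + 2 * a) : ℝ) + 1) ≤ 7 * (C + 1) * (((t + 2 * a : ℕ) : ℝ) + 1) ^ M := by
    linarith
  refine abs_le_of_sq_le_sq' ?_ (by positivity) |>.2
  calc (7 * ((κ (t + 2 * a) : ℝ) + 1) * 2 ^ a) ^ 2
      ≤ (7 * (C + 1) * (((t + 2 * a : ℕ) : ℝ) + 1) ^ M * 2 ^ a) ^ 2 := by gcongr
    _ = (7 * (C + 1) * (((t + 2 * a : ℕ) : ℝ) + 1) ^ M) ^ 2 * (2 ^ a) ^ 2 := mul_pow _ _ _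
    _ ≤ 2 ^ t * 2 ^ (t + 2 * a) * (2 ^ a) ^ 2 := mul_le_mul_of_nonneg_right h1 (by positivity)
    _ = (2 ^ (t + 2 * a)) ^ 2 := by ring

theorem exists_scaleStep_log_bound (hκ : ∀ i, κ i ≤ C * (i + 1) ^ M) :
    ∃ K : ℝ, 1 ≤ K ∧ ∀ i i' i'', ScaleStep κ i i' → ScaleStep κ i' i'' →
      (2 : ℝ) ^ i'' ≤ K * ((i : ℝ) + 1) ^ (2 * M) * 2 ^ i := by
  obtain ⟨t, ht⟩ := exists_sq_poly_le_two_pow (14 * (C + 1)) M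
  have hone : ∀ b : ℕ, (1 : ℝ) ≤ ((b : ℝ) + 1) ^ M := fun b => one_le_pow₀ (by
    have : (0 : ℝ) ≤ b := Nat.cast_nonneg _
    linarith)
  have h0 : ∀ a b, ScaleStep κ a b → (2 : ℝ) ^ b ≤ 14 * (C + 1) * ((b : ℝ) + 1) ^ M * 2 ^ a := by
    intro a b h
    refine h.trans (mul_le_mul_of_nonneg_right ?_ (by positivity))
    have h2 : (κ (b - 1) : ℝ) ≤ C * (((b - 1 : ℕ) : ℝ) + 1) ^ M := by exact_mod_cast hκ (b - 1)
    have h3 : (((b - 1 : ℕ) : ℝ) + 1) ^ M ≤ ((b : ℝ) + 1) ^ M := by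
      have : ((b - 1 : ℕ) : ℝ) ≤ b := by exact_mod_cast Nat.sub_le b 1
      gcongr
    have h4 := mul_le_mul_of_nonneg_left h3 (Nat.cast_nonneg (α := ℝ) C)
    linarith [hone b]
  have hlin : ∀ a b, ScaleStep κ a b → b ≤ t + 2 * a := by
    intro a b h
    have h1 : (2 : ℝ) ^ b * 2 ^ b ≤ 2 ^ (t + 2 * a) * 2 ^ b := by
      calc (2 : ℝ) ^ b * 2 ^ b = (2 ^ b) ^ 2 := by ring
        _ ≤ (14 * (C + 1) * ((b : ℝ) + 1) ^ M * 2 ^ a) ^ 2 :=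
          pow_le_pow_left₀ (by positivity) (h0 a b h) 2
        _ = (14 * (C + 1) * ((b : ℝ) + 1) ^ M) ^ 2 * (2 ^ a) ^ 2 := mul_pow _ _ _
        _ ≤ 2 ^ t * 2 ^ b * (2 ^ a) ^ 2 := mul_le_mul_of_nonneg_right (ht b) (by positivity)
        _ = 2 ^ (t + 2 * a) * 2 ^ b := by ring
    exact (pow_le_pow_iff_right₀ (by norm_num : (1 : ℝ) < 2)).1
      (le_of_mul_le_mul_right h1 (by positivity))
  have hpow : ∀ a b, ScaleStep κ a b →
      ((b : ℝ) + 1) ^ M ≤ ((t : ℝ) + 2) ^ M * ((a : ℝ) + 1) ^ M := by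
    intro a b h
    rw [← mul_pow]
    refine pow_le_pow_left₀ (by positivity) ?_ M
    have h1 : (b : ℝ) ≤ t + 2 * a := by exact_mod_cast hlin a b h
    have h2 : (0 : ℝ) ≤ t * a := by positivity
    nlinarith
  set D : ℝ := 14 * (C + 1) * ((t : ℝ) + 2) ^ M with hD
  have ht2 : (1 : ℝ) ≤ ((t : ℝ) + 2) ^ M := one_le_pow₀ (by
    have : (0 : ℝ) ≤ t := Nat.cast_nonneg _
    linarith)
  have hD1 : 1 ≤ D := by
    have : (0 : ℝ) ≤ C := Nat.cast_nonneg _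
    nlinarith
  have hstep : ∀ a b, ScaleStep κ a b → (2 : ℝ) ^ b ≤ D * ((a : ℝ) + 1) ^ M * 2 ^ a := by
    intro a b h
    refine (h0 a b h).trans (mul_le_mul_of_nonneg_right ?_ (by positivity))
    rw [hD, mul_assoc (14 * ((C : ℝ) + 1))]
    exact mul_le_mul_of_nonneg_left (hpow a b h) (by positivity)
  refine ⟨D * D * ((t : ℝ) + 2) ^ M, by nlinarith [mul_le_mul hD1 hD1 zero_le_one (by linarith)],
    fun i i' i'' h1 h2 => ?_⟩
  calc (2 : ℝ) ^ i'' ≤ D * ((i' : ℝ) + 1) ^ M * 2 ^ i' := hstep _ _ h2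
    _ ≤ D * (((t : ℝ) + 2) ^ M * ((i : ℝ) + 1) ^ M) * (D * ((i : ℝ) + 1) ^ M * 2 ^ i) := by
      refine mul_le_mul (mul_le_mul_of_nonneg_left (hpow _ _ h1) (by linarith)) (hstep _ _ h1)
        (by positivity) (by positivity)
    _ = _ := by rw [mul_comm 2 M, pow_mul]; ring

end LogGrowth

section PowerGrowth

variable {κ : ℕ → ℕ} {C s : ℝ}

theorem exists_scale_of_power_growth (hs1 : s < 1) (hs0 : 0 ≤ s)
    (hκ : ∀ i, (κ i : ℝ) ≤ C * ((2 : ℝ) ^ i) ^ s) (a : ℕ) :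
    ∃ b : ℕ, 7 * ((κ b : ℝ) + 1) * 2 ^ a ≤ 2 ^ b := by
  have hlim : Filter.Tendsto (fun b : ℕ => ((2 : ℝ) ^ b) ^ (1 - s)) Filter.atTop Filter.atTop :=
    (tendsto_rpow_atTop (by linarith)).comp (tendsto_pow_atTop_atTop_of_one_lt (by norm_num))
  obtain ⟨b, hb⟩ := (hlim.eventually_ge_atTop (7 * (C + 1) * 2 ^ a)).exists
  refine ⟨b, ?_⟩
  have h2b : (1 : ℝ) ≤ 2 ^ b := one_le_pow₀ (by norm_num)
  have h1 : 1 ≤ ((2 : ℝ) ^ b) ^ s := Real.one_le_rpow h2b hs0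
  calc 7 * ((κ b : ℝ) + 1) * 2 ^ a ≤ 7 * ((C + 1) * ((2 : ℝ) ^ b) ^ s) * 2 ^ a := by
        refine mul_le_mul_of_nonneg_right ?_ (by positivity)
        linarith [hκ b]
    _ = 7 * (C + 1) * 2 ^ a * ((2 : ℝ) ^ b) ^ s := by ring
    _ ≤ ((2 : ℝ) ^ b) ^ (1 - s) * ((2 : ℝ) ^ b) ^ s :=
        mul_le_mul_of_nonneg_right hb (by positivity)
    _ = 2 ^ b := by rw [← Real.rpow_add (by positivity), sub_add_cancel, Real.rpow_one]

theorem exists_scaleStep_power_bound (hs1 : s < 1) (hs0 : 0 ≤ s) (hC : 0 ≤ C)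
    (hκ : ∀ i, (κ i : ℝ) ≤ C * ((2 : ℝ) ^ i) ^ s) :
    ∃ K : ℝ, 1 ≤ K ∧ ∀ i i' i'', ScaleStep κ i i' → ScaleStep κ i' i'' →
      (2 : ℝ) ^ i'' ≤ K * ((2 : ℝ) ^ i) ^ (1 / (1 - s) ^ 2 - 1) * 2 ^ i := by
  have h1s : 0 < 1 - s := by linarith
  set β := 1 / (1 - s) with hβ
  have hβ0 : 0 < β := by positivity
  set D := 14 * (C + 1) with hD
  have hD1 : 1 ≤ D := by linarith
  have hstep : ∀ a b, ScaleStep κ a b → (2 : ℝ) ^ b ≤ D ^ β * ((2 : ℝ) ^ a) ^ β := by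
    intro a b h
    have h2b : (1 : ℝ) ≤ 2 ^ b := one_le_pow₀ (by norm_num)
    have hone : 1 ≤ ((2 : ℝ) ^ b) ^ s := Real.one_le_rpow h2b hs0
    have hmono : ((2 : ℝ) ^ (b - 1)) ^ s ≤ ((2 : ℝ) ^ b) ^ s :=
      Real.rpow_le_rpow (by positivity)
        (pow_le_pow_right₀ (by norm_num) (Nat.sub_le b 1)) hs0
    have h1 : (2 : ℝ) ^ b ≤ D * 2 ^ a * ((2 : ℝ) ^ b) ^ s := by
      calc (2 : ℝ) ^ b ≤ 14 * (κ (b - 1) + 1) * 2 ^ a := h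
        _ ≤ 14 * ((C + 1) * ((2 : ℝ) ^ b) ^ s) * 2 ^ a := by
          refine mul_le_mul_of_nonneg_right ?_ (by positivity)
          have := mul_le_mul_of_nonneg_left hmono hC
          linarith [hκ (b - 1)]
        _ = _ := by rw [hD]; ring
    have h2 : ((2 : ℝ) ^ b) ^ (1 - s) ≤ D * 2 ^ a := by
      rw [Real.rpow_sub (by positivity), Real.rpow_one, div_le_iff₀ (by positivity)]
      exact h1
    calc (2 : ℝ) ^ b = (((2 : ℝ) ^ b) ^ (1 - s)) ^ β := by
          rw [← Real.rpow_mul (by positivity), hβ, mul_one_div_cancel h1s.ne', Real.rpow_one]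
      _ ≤ (D * 2 ^ a) ^ β := Real.rpow_le_rpow (by positivity) h2 hβ0.le
      _ = D ^ β * ((2 : ℝ) ^ a) ^ β := Real.mul_rpow (by linarith) (by positivity)
  refine ⟨D ^ β * (D ^ β) ^ β, one_le_mul_of_one_le_of_one_le (Real.one_le_rpow hD1 hβ0.le)
    (Real.one_le_rpow (Real.one_le_rpow hD1 hβ0.le) hβ0.le), fun i i' i'' h1 h2 => ?_⟩
  have hD0 : (0 : ℝ) ≤ D := by linarith
  calc (2 : ℝ) ^ i'' ≤ D ^ β * ((2 : ℝ) ^ i') ^ β := hstep _ _ h2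
    _ ≤ D ^ β * (D ^ β * ((2 : ℝ) ^ i) ^ β) ^ β :=
        mul_le_mul_of_nonneg_left (Real.rpow_le_rpow (by positivity) (hstep _ _ h1) hβ0.le)
          (by positivity)
    _ = D ^ β * (D ^ β) ^ β * (((2 : ℝ) ^ i) ^ β) ^ β := by
        rw [Real.mul_rpow (x := D ^ β) (y := ((2 : ℝ) ^ i) ^ β) (by positivity) (by positivity),
          mul_assoc]
    _ = D ^ β * (D ^ β) ^ β * (((2 : ℝ) ^ i) ^ (1 / (1 - s) ^ 2 - 1) * 2 ^ i) := by
        congr 1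
        rw [← Real.rpow_mul (by positivity)]
        have : β * β = (1 / (1 - s) ^ 2 - 1) + 1 := by rw [hβ]; field_simp; ring
        rw [this, Real.rpow_add (by positivity), Real.rpow_one]
    _ = _ := by ring

end PowerGrowth

theorem HasCoveringExponent.exists_power_bound {Ω : Set ℝ} {s : ℝ} (hs0 : 0 ≤ s)
    (h : HasCoveringExponent Ω s) (a b : ℝ) :
    ∃ C : ℝ, 0 ≤ C ∧ ∀ i : ℕ, ∃ F : Finset ℝ, (F.card : ℝ) ≤ C * ((2 : ℝ) ^ i) ^ s ∧
      Covers F ((1 / 2) ^ i) (Ω ∪ {a, b}) := by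
  classical
  obtain ⟨C, δ₀, hδ₀, hcov⟩ := h
  obtain ⟨i₀, hi₀⟩ := exists_pow_lt_of_lt_one hδ₀ (by norm_num : (1 / 2 : ℝ) < 1)
  have hone : ∀ i : ℕ, 1 ≤ ((2 : ℝ) ^ i) ^ s := fun i =>
    Real.one_le_rpow (one_le_pow₀ (by norm_num)) hs0
  refine ⟨|C| * ((2 : ℝ) ^ i₀) ^ s + 2, by positivity, fun i => ?_⟩
  have hlt : (1 / 2 : ℝ) ^ (i + i₀) < δ₀ :=
    (pow_le_pow_of_le_one (by norm_num) (by norm_num) (Nat.le_add_left i₀ i)).trans_lt hi₀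
  obtain ⟨F, hF, hF'⟩ := hcov ((1 / 2) ^ (i + i₀)) (by positivity) hlt
  refine ⟨F ∪ {a, b}, ?_, ?_⟩
  · have h1 : ((F ∪ {a, b}).card : ℝ) ≤ F.card + 2 := by
      have h2 := Finset.card_union_le F {a, b}
      have h3 := Finset.card_le_two (a := a) (b := b)
      exact_mod_cast h2.trans (Nat.add_le_add_left h3 _)
    have h4 : ((1 / 2 : ℝ) ^ (i + i₀)) ^ (-s) = ((2 : ℝ) ^ i) ^ s * ((2 : ℝ) ^ i₀) ^ s := by
      rw [← Real.mul_rpow (by positivity) (by positivity), ← pow_add, one_div, inv_pow,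
        Real.inv_rpow (by positivity), Real.rpow_neg (by positivity), inv_inv]
    rw [h4] at hF
    have h5 : C * (((2 : ℝ) ^ i) ^ s * ((2 : ℝ) ^ i₀) ^ s) ≤
        |C| * (((2 : ℝ) ^ i) ^ s * ((2 : ℝ) ^ i₀) ^ s) :=
      mul_le_mul_of_nonneg_right (le_abs_self C) (by positivity)
    nlinarith [hone i]
  · have hle : (1 / 2 : ℝ) ^ (i + i₀) ≤ (1 / 2) ^ i :=
      pow_le_pow_of_le_one (by norm_num) (by norm_num) (Nat.le_add_right i i₀)
    rintro y (hy | hy)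
    · obtain ⟨c, hc, hyc⟩ := Set.mem_iUnion₂.1 (hF' hy)
      exact ⟨c, Finset.mem_union_left _ hc, hyc.1, by linarith [hyc.2]⟩
    · exact ⟨y, Finset.mem_union_right _ (by simpa using hy), le_rfl, by
        have : (0 : ℝ) ≤ (1 / 2) ^ i := by positivity
        linarith⟩

/-- The combined mean square bound for polygons with at most `k` sides and for the unit square. -/
theorem exists_meanSquareBound_le (S : ℝ) (k : ℕ) :
    ∃ A : ℝ, 0 ≤ A ∧ ∀ (N J : ℕ) (φ : ℝ), 2 * (meanSquareBound S k N J φ +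
      meanSquareBound S 4 N J φ) ≤ A * (1 + N / 4 ^ J + ((J : ℝ) + 1) * φ ^ 2) := by
  refine ⟨768 * S ^ 2 + 1200 * (k ^ 2 + 16), by positivity, fun N J φ => ?_⟩
  unfold meanSquareBound
  have h1 : (0 : ℝ) ≤ J := Nat.cast_nonneg _
  have h2 : (0 : ℝ) ≤ N / 4 ^ J := by positivity
  have h3 : 0 ≤ J * φ ^ 2 := by positivity
  have h4 := sq_nonneg φ
  have h5 : (0 : ℝ) ≤ (k : ℝ) ^ 2 + 16 := by positivity
  have h6 := mul_nonneg h5 h3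
  have h7 := mul_nonneg h5 h4
  have h8 := mul_nonneg (sq_nonneg S) h2
  have h9 := mul_nonneg (sq_nonneg S) h3
  have h10 := mul_nonneg (sq_nonneg S) h4
  rw [show (100 : ℝ) * N / 4 ^ J = 100 * (N / 4 ^ J) by ring]
  generalize (N : ℝ) / 4 ^ J = x at *
  push_cast
  linarith

theorem exists_pow_four_between {x : ℝ} (hx : 1 ≤ x) :
    ∃ J : ℕ, x ≤ (4 : ℝ) ^ J ∧ (4 : ℝ) ^ J ≤ 4 * x := by
  obtain ⟨n, hn1, hn2⟩ := exists_nat_pow_near hx (by norm_num : (1 : ℝ) < 4)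
  exact ⟨n + 1, hn2.le, by rw [pow_succ]; linarith⟩

theorem one_le_logPlus (N : ℕ) : 1 ≤ logPlus N := le_max_left _ _

theorem exists_log_bound {S K : ℝ} (hK : 0 ≤ K) (k M r : ℕ) :
    ∃ C : ℝ, 0 ≤ C ∧ ∀ N : ℕ, 1 ≤ N → ∃ J : ℕ, ∀ φ : ℝ,
      φ = 8 * 2 ^ r * (K * (((r + 2 * J : ℕ) : ℝ) + 1) ^ (2 * M)) →
      2 * (meanSquareBound S k N J φ + meanSquareBound S 4 N J φ) ≤
        C * logPlus N ^ (4 * M + 1) := by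
  obtain ⟨A, hA, hbound⟩ := exists_meanSquareBound_le S k
  set D : ℝ := 8 * 2 ^ r * (K * ((r : ℝ) + 5) ^ (2 * M)) with hD
  refine ⟨A * (2 + 3 * D ^ 2), by positivity, fun N hN => ?_⟩
  have hN1 : (1 : ℝ) ≤ N := by exact_mod_cast hN
  obtain ⟨J, hJ1, hJ2⟩ := exists_pow_four_between hN1
  refine ⟨J, fun φ hφ => (hbound N J φ).trans ?_⟩
  have hℓ := one_le_logPlus N
  have hJ : (J : ℝ) ≤ 2 * logPlus N := by
    have h1 : Real.logb 2 ((4 : ℝ) ^ J) ≤ Real.logb 2 (4 * N) :=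
      Real.logb_le_logb_of_le (by norm_num) (by positivity) hJ2
    have h4 : Real.logb 2 4 = 2 := by
      rw [show (4 : ℝ) = 2 ^ (2 : ℕ) by norm_num, Real.logb_pow, Real.logb_self_eq_one (by norm_num)]
      norm_num
    rw [Real.logb_pow, Real.logb_mul (by norm_num) (by positivity), h4] at h1
    have h2 : Real.logb 2 N ≤ logPlus N := le_max_right _ _
    linarith
  generalize logPlus N = l at *
  have hdiv : (N : ℝ) / 4 ^ J ≤ 1 := by
    rw [div_le_one (by positivity)]; exact hJ1
  have hφle : φ ≤ D * l ^ (2 * M) := by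
    rw [hφ, hD]
    have h1 : (((r + 2 * J : ℕ) : ℝ) + 1) ≤ ((r : ℝ) + 5) * l := by
      push_cast
      have : (0 : ℝ) ≤ r := Nat.cast_nonneg _
      nlinarith
    have h2 := pow_le_pow_left₀ (by positivity) h1 (2 * M)
    rw [mul_pow] at h2
    calc 8 * 2 ^ r * (K * (((r + 2 * J : ℕ) : ℝ) + 1) ^ (2 * M))
        ≤ 8 * 2 ^ r * (K * (((r : ℝ) + 5) ^ (2 * M) * l ^ (2 * M))) := by gcongr
      _ = _ := by ring
  have hφ0 : 0 ≤ φ := by rw [hφ]; positivity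
  have hφ2 : φ ^ 2 ≤ D ^ 2 * l ^ (4 * M) := by
    calc φ ^ 2 ≤ (D * l ^ (2 * M)) ^ 2 := pow_le_pow_left₀ hφ0 hφle 2
      _ = D ^ 2 * l ^ (4 * M) := by rw [mul_pow, ← pow_mul]; ring_nf
  have hl : 1 ≤ l ^ (4 * M + 1) := one_le_pow₀ hℓ
  have hmul : ((J : ℝ) + 1) * φ ^ 2 ≤ (3 * l) * (D ^ 2 * l ^ (4 * M)) :=
    mul_le_mul (by linarith) hφ2 (sq_nonneg _) (by linarith)
  rw [mul_assoc]
  refine mul_le_mul_of_nonneg_left ?_ hA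
  rw [pow_succ l] at hl ⊢
  linarith

theorem exists_power_bound {S K τ s ε : ℝ} (hτ : 0 ≤ τ) (hε : 0 < ε) (hs : 0 ≤ s) (hsτ : s ≤ τ + ε)
    (k r : ℕ) :
    ∃ C : ℝ, 0 ≤ C ∧ ∀ N : ℕ, 1 ≤ N → ∃ J : ℕ, ∀ φ : ℝ,
      φ = 8 * 2 ^ r * (K * ((2 : ℝ) ^ (r + 2 * J)) ^ (s / 2)) →
      2 * (meanSquareBound S k N J φ + meanSquareBound S 4 N J φ) ≤
        C * (N : ℝ) ^ (τ / (τ + 1) + 2 * ε) := by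
  obtain ⟨A, hA, hbound⟩ := exists_meanSquareBound_le S k
  set D : ℝ := 8 * 2 ^ r * (K * ((2 : ℝ) ^ r) ^ (s / 2)) with hD
  set E : ℝ := (1 / ε + 1) * D ^ 2 * 4 ^ (s + ε) with hE
  have hE0 : 0 ≤ E := by positivity
  refine ⟨A * (2 + E), by positivity, fun N hN => ?_⟩
  have hN1 : (1 : ℝ) ≤ N := by exact_mod_cast hN
  have hN0 : (0 : ℝ) < N := by linarith
  have hτ1 : 0 < τ + 1 := by linarith
  obtain ⟨J, hJ1, hJ2⟩ := exists_pow_four_between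
    (Real.one_le_rpow hN1 (by positivity : (0 : ℝ) ≤ 1 / (τ + 1)))
  refine ⟨J, fun φ hφ => (hbound N J φ).trans ?_⟩
  have h4J : (1 : ℝ) ≤ 4 ^ J := one_le_pow₀ (by norm_num)
  have hNpow : ∀ x : ℝ, x ≤ τ / (τ + 1) + 2 * ε →
      (N : ℝ) ^ x ≤ (N : ℝ) ^ (τ / (τ + 1) + 2 * ε) := fun x hx =>
    Real.rpow_le_rpow_of_exponent_le hN1 hx
  have hτd : 0 ≤ τ / (τ + 1) := by positivity
  have h1 : (1 : ℝ) ≤ (N : ℝ) ^ (τ / (τ + 1) + 2 * ε) := by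
    simpa only [Real.rpow_zero] using hNpow 0 (by positivity)
  have h2 : (N : ℝ) / 4 ^ J ≤ (N : ℝ) ^ (τ / (τ + 1) + 2 * ε) := by
    calc (N : ℝ) / 4 ^ J ≤ N / (N : ℝ) ^ (1 / (τ + 1)) := by gcongr
      _ = (N : ℝ) ^ (1 - 1 / (τ + 1)) := by rw [Real.rpow_sub hN0, Real.rpow_one]
      _ ≤ _ := hNpow _ (by
        have : 1 - 1 / (τ + 1) = τ / (τ + 1) := by field_simp; ring
        rw [this]; linarith)
  have hJ : (J : ℝ) + 1 ≤ (1 / ε + 1) * ((4 : ℝ) ^ J) ^ ε := by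
    have h3 := Real.log_le_rpow_div (by positivity : (0 : ℝ) ≤ 4 ^ J) hε
    rw [Real.log_pow] at h3
    have h4 : 1 ≤ Real.log 4 := by
      rw [Real.le_log_iff_exp_le (by norm_num)]
      linarith [Real.exp_one_lt_d9]
    have h5 : (J : ℝ) ≤ J * Real.log 4 := le_mul_of_one_le_right (Nat.cast_nonneg _) h4
    have h6 : 1 ≤ ((4 : ℝ) ^ J) ^ ε := Real.one_le_rpow h4J hε.le
    have h7 : ((4 : ℝ) ^ J) ^ ε / ε = 1 / ε * ((4 : ℝ) ^ J) ^ ε := by ring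
    linarith
  have hφ2 : φ ^ 2 = D ^ 2 * ((4 : ℝ) ^ J) ^ s := by
    have e1 : (((2 : ℝ) ^ (2 * J)) ^ (s / 2)) ^ 2 = ((4 : ℝ) ^ J) ^ s := by
      rw [← Real.rpow_natCast _ 2, ← Real.rpow_mul (by positivity), pow_mul]
      norm_num
    rw [hφ, hD, pow_add, Real.mul_rpow (by positivity) (by positivity), ← e1]
    ring
  have h3 : ((J : ℝ) + 1) * φ ^ 2 ≤ E * (N : ℝ) ^ (τ / (τ + 1) + 2 * ε) := by
    calc ((J : ℝ) + 1) * φ ^ 2 ≤ (1 / ε + 1) * ((4 : ℝ) ^ J) ^ ε * (D ^ 2 * ((4 : ℝ) ^ J) ^ s) := by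
          rw [hφ2]; gcongr
      _ = (1 / ε + 1) * D ^ 2 * ((4 : ℝ) ^ J) ^ (s + ε) := by
          rw [Real.rpow_add (by positivity)]; ring
      _ ≤ (1 / ε + 1) * D ^ 2 * (4 * (N : ℝ) ^ (1 / (τ + 1))) ^ (s + ε) := by gcongr
      _ = E * (N : ℝ) ^ (1 / (τ + 1) * (s + ε)) := by
          rw [Real.mul_rpow (by norm_num) (by positivity), ← Real.rpow_mul hN0.le, hE]; ring
      _ ≤ _ := by
          refine mul_le_mul_of_nonneg_left (hNpow _ ?_) hE0
          have : 1 / (τ + 1) * (s + ε) ≤ 1 / (τ + 1) * (τ + 2 * ε) :=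
            mul_le_mul_of_nonneg_left (by linarith) (by positivity)
          have h8 : 1 / (τ + 1) * (2 * ε) ≤ 1 * (2 * ε) :=
            mul_le_mul_of_nonneg_right ((div_le_one hτ1).2 (by linarith)) (by positivity)
          have h9 : τ / (τ + 1) = 1 / (τ + 1) * τ := by ring
          rw [h9]
          linarith
  rw [mul_assoc]
  refine mul_le_mul_of_nonneg_left ?_ hA
  linarith

theorem theorem4 (Ω : Set ℝ) (k : ℕ) :
    (∀ M : ℕ, 1 ≤ M → IsFiniteUnionLacunary M Ω →
      ∃ C : ℝ, ∀ N : ℕ, 1 ≤ N →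
        ∀ [MeasurableSpace (convexPolygons Ω k)],
        (∀ p : ℝ × ℝ, MeasurableSet {B : convexPolygons Ω k | p ∈ (B : Set (ℝ × ℝ))}) →
        ∀ (σ : Measure (convexPolygons Ω k)) [IsProbabilityMeasure σ],
          ∃ P : Finset (ℝ × ℝ), (P : Set (ℝ × ℝ)) ⊆ unitSquare ∧ P.card = N ∧
            Integrable (fun B : convexPolygons Ω k => discrepancy P B ^ 2) σ ∧
            Real.sqrt (∫ B : convexPolygons Ω k, discrepancy P B ^ 2 ∂σ) ≤
              C * logPlus N ^ (2 * (M : ℝ) + 1 / 2)) ∧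
    (∀ d τ : ℝ, 0 ≤ d → d < 1 → HasUpperMinkowskiDim Ω d →
      τ = 2 / (1 - d) ^ 2 - 2 → τ < 1 →
      ∃ C : ℝ → ℝ, ∀ N : ℕ, 1 ≤ N →
        ∀ [MeasurableSpace (convexPolygons Ω k)],
        (∀ p : ℝ × ℝ, MeasurableSet {B : convexPolygons Ω k | p ∈ (B : Set (ℝ × ℝ))}) →
        ∀ (σ : Measure (convexPolygons Ω k)) [IsProbabilityMeasure σ],
          ∃ P : Finset (ℝ × ℝ), (P : Set (ℝ × ℝ)) ⊆ unitSquare ∧ P.card = N ∧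
            Integrable (fun B : convexPolygons Ω k => discrepancy P B ^ 2) σ ∧
            ∀ ε : ℝ, 0 < ε →
              Real.sqrt (∫ B : convexPolygons Ω k, discrepancy P B ^ 2 ∂σ) ≤
                C ε * (N : ℝ) ^ (τ / (2 * (τ + 1)) + ε)) := by
  set Ω' : Set ℝ := Ω ∪ {0, Real.pi / 2} with hΩ'
  have hsub : Ω ⊆ Ω' := Set.subset_union_left
  have hzero : (0 : ℝ) ∈ Ω' := Or.inr (by simp)
  have hhalf : Real.pi / 2 ∈ Ω' := Or.inr (by simp)
  constructor
  · intro M _ hΩ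
    obtain ⟨C₀, hC₀⟩ := hΩ.hasLogCovering.union ((Set.toFinite {0, Real.pi / 2}).hasLogCovering M)
    obtain ⟨κ, hcov, hmin⟩ := exists_coveringNumber fun i => ⟨_, (hC₀ i).choose_spec.2⟩
    have hκ : ∀ i, κ i ≤ C₀ * (i + 1) ^ M := fun i => by
      obtain ⟨F, hF, hF'⟩ := hC₀ i
      exact (hmin i F hF').trans hF
    obtain ⟨α, S, hgood, r, hr⟩ :=
      exists_isGoodAngle ⟨0, hzero⟩ hcov (exists_scale_of_log_growth hκ)
    obtain ⟨K, hK1, hK⟩ := exists_scaleStep_log_bound hκ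
    have hbad := hr (fun i => K * ((i : ℝ) + 1) ^ (2 * M))
      (fun i j hij => by
        have : (i : ℝ) ≤ j := by exact_mod_cast hij
        have hK0 : 0 ≤ K := by linarith
        simp only
        gcongr)
      (fun i => one_le_mul_of_one_le_of_one_le hK1 (one_le_pow₀ (by
        have : (0 : ℝ) ≤ i := Nat.cast_nonneg _
        linarith))) hK
    obtain ⟨C, hC0, hC⟩ := exists_log_bound (S := S) (by linarith : 0 ≤ K) k M r
    refine ⟨Real.sqrt C, fun N hN _ hm σ _ => ?_⟩
    obtain ⟨P, hP, hPN, hint, hPb⟩ := hgood.exists_finset hsub hzero hhalf hN hm σ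
    refine ⟨P, hP, hPN, hint, ?_⟩
    obtain ⟨J, hJ⟩ := hC N hN
    have h1 := (hPb J _ (by positivity) (hbad J)).trans (hJ _ rfl)
    refine (Real.sqrt_le_sqrt h1).trans (le_of_eq ?_)
    have hl : 0 ≤ logPlus N := zero_le_one.trans (one_le_logPlus N)
    rw [Real.sqrt_mul hC0, Real.sqrt_eq_rpow (_ ^ _), ← Real.rpow_natCast, ← Real.rpow_mul hl]
    congr 2
    push_cast
    ring
  · intro d τ hd0 hd1 hdim hτ _
    have h1d : 0 < 1 - d := by linarith
    have hτ0 : 0 ≤ τ := by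
      have h1 : 2 ≤ 2 / (1 - d) ^ 2 := by
        rw [le_div_iff₀ (by positivity)]
        nlinarith
      linarith
    have hexp : ∀ s₁ > d, ∃ s, d ≤ s ∧ s < s₁ ∧ HasCoveringExponent Ω s := fun s₁ hs₁ => by
      obtain ⟨s, ⟨-, hs⟩, hds, hss⟩ := hdim.exists_between hs₁
      exact ⟨s, hds, hss, hs⟩
    obtain ⟨s₁, hds₁, hs₁1, hcov₁⟩ := hexp 1 hd1
    have hs₁0 : 0 ≤ s₁ := hd0.trans hds₁
    have hpow : ∀ s, 0 ≤ s → HasCoveringExponent Ω s → ∃ C₀ : ℝ, 0 ≤ C₀ ∧ ∀ i : ℕ, ∃ F : Finset ℝ,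
        (F.card : ℝ) ≤ C₀ * ((2 : ℝ) ^ i) ^ s ∧ Covers F ((1 / 2) ^ i) Ω' := fun s hs hc =>
      hc.exists_power_bound hs 0 (Real.pi / 2)
    obtain ⟨C₁, hC₁0, hC₁⟩ := hpow s₁ hs₁0 hcov₁
    obtain ⟨κ, hcov, hmin⟩ := exists_coveringNumber fun i => ⟨_, (hC₁ i).choose_spec.2⟩
    have hκ : ∀ {s C₀ : ℝ}, (∀ i : ℕ, ∃ F : Finset ℝ, (F.card : ℝ) ≤ C₀ * ((2 : ℝ) ^ i) ^ s ∧
        Covers F ((1 / 2) ^ i) Ω') → ∀ i, (κ i : ℝ) ≤ C₀ * ((2 : ℝ) ^ i) ^ s := fun h i => by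
      obtain ⟨F, hF, hF'⟩ := h i
      exact le_trans (by exact_mod_cast hmin i F hF') hF
    obtain ⟨α, S, hgood, r, hr⟩ :=
      exists_isGoodAngle ⟨0, hzero⟩ hcov (exists_scale_of_power_growth hs₁1 hs₁0 (hκ hC₁))
    have hmain : ∀ ε : ℝ, ∃ C : ℝ, 0 < ε → 0 ≤ C ∧ ∀ N : ℕ, 1 ≤ N → ∃ (J : ℕ) (φ : ℝ), 0 < φ ∧
        SlopesBadlyApprox Ω' α φ J ∧ 2 * (meanSquareBound S k N J φ + meanSquareBound S 4 N J φ) ≤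
          C * (N : ℝ) ^ (τ / (τ + 1) + 2 * ε) := by
      intro ε
      by_cases hε : 0 < ε
      swap
      · exact ⟨0, fun h => absurd h hε⟩
      have hcont : ContinuousAt (fun s : ℝ => 2 / (1 - s) ^ 2 - 2) d := by
        have : (1 - d) ^ 2 ≠ 0 := (pow_pos h1d 2).ne'
        fun_prop (disch := assumption)
      have hev := hcont.eventually_lt (continuousAt_const (y := τ + ε)) (by
        change 2 / (1 - d) ^ 2 - 2 < τ + ε; linarith)
      obtain ⟨s₂, hs₂, hds₂, hs₂1⟩ :=
        ((hev.filter_mono nhdsWithin_le_nhds).and (Ioo_mem_nhdsGT hd1)).exists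
      obtain ⟨s, hds, hss₂, hcovs⟩ := hexp s₂ hds₂
      have hs0 : 0 ≤ s := hd0.trans hds
      have hs1 : s < 1 := hss₂.trans hs₂1
      have h1s : 0 < 1 - s := by linarith
      obtain ⟨C₀, hC₀0, hC₀⟩ := hpow s hs0 hcovs
      obtain ⟨K, hK1, hK⟩ := exists_scaleStep_power_bound hs1 hs0 hC₀0 (hκ hC₀)
      have hexp0 : 0 ≤ 1 / (1 - s) ^ 2 - 1 := by
        have : 1 ≤ 1 / (1 - s) ^ 2 := by
          rw [le_div_iff₀ (by positivity)]
          nlinarith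
        linarith
      have hbad := hr (fun i => K * ((2 : ℝ) ^ i) ^ (1 / (1 - s) ^ 2 - 1))
        (fun i j hij => mul_le_mul_of_nonneg_left (Real.rpow_le_rpow (by positivity)
          (pow_le_pow_right₀ (by norm_num) hij) hexp0) (by linarith))
        (fun i => one_le_mul_of_one_le_of_one_le hK1
          (Real.one_le_rpow (one_le_pow₀ (by norm_num)) hexp0)) hK
      have hsτ : 2 / (1 - s) ^ 2 - 2 ≤ τ + ε := by
        refine le_trans ?_ hs₂.le
        have h2 : 0 < 1 - s₂ := by linarith
        have h3 : (1 - s₂) ^ 2 ≤ (1 - s) ^ 2 := pow_le_pow_left₀ h2.le (by linarith) 2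
        have h4 : 2 / (1 - s) ^ 2 ≤ 2 / (1 - s₂) ^ 2 := by gcongr
        linarith
      have hhalfexp : (2 / (1 - s) ^ 2 - 2) / 2 = 1 / (1 - s) ^ 2 - 1 := by ring
      obtain ⟨C, hC0, hC⟩ := exists_power_bound (S := S) (K := K) hτ0 hε (by linarith) hsτ k r
      refine ⟨C, fun _ => ⟨hC0, fun N hN => ?_⟩⟩
      obtain ⟨J, hJ⟩ := hC N hN
      rw [hhalfexp] at hJ
      exact ⟨J, _, by positivity, hbad J, hJ _ rfl⟩
    choose C hC using hmain
    refine ⟨fun ε => Real.sqrt (C ε), fun N hN _ hm σ _ => ?_⟩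
    obtain ⟨P, hP, hPN, hint, hPb⟩ := hgood.exists_finset hsub hzero hhalf hN hm σ
    refine ⟨P, hP, hPN, hint, fun ε hε => ?_⟩
    obtain ⟨hC0, hCN⟩ := hC ε hε
    obtain ⟨J, φ, hφ, hJ, hb⟩ := hCN N hN
    refine (Real.sqrt_le_sqrt ((hPb J φ hφ hJ).trans hb)).trans (le_of_eq ?_)
    have hτ1 : τ + 1 ≠ 0 := by linarith
    rw [Real.sqrt_mul hC0, Real.sqrt_eq_rpow (_ ^ _), ← Real.rpow_mul (Nat.cast_nonneg N)]
    congr 2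
    field_simp
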